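/- **Setting.** Let $n\ge 2$ and $\mathbb T^{n-1}=\mathbb R^{n-1}/2\pi\mathbb Z^{n-1}$; all functions of $\boldsymbol\xi\in\mathbb T^{n-1}$ below are real-valued. For $f$ on $\mathbb T^{n-1}$ put $\overline f=(2\pi)^{1-n}\int_{\mathbb T^{n-1}}f\,d\boldsymbol\xi$, $f^*=f-\overline f$. Fix $\varrho>0$. For $s>0$ and an integer $d\ge0$, $\mathcal A_{s,d}$ is the space of $f$ that extend holomorphically and $2\pi$-periodically to the strip $\{|\mathrm{Im}\,\xi_j|<s\varrho,\ 1\le j\le n-1\}$ with finite norm $\|f\|_{s,d}=\max_{|l|\le d}\sup|\partial^l f|$ (supremum over the strip; for vectors and matrices, the maximum over the entries). For $r\in\mathbb R$, $|u|_r^2=\sum_{m\in\mathbb Z^{n-1}}(1+|m|^2)^r|\hat u(m)|^2$ with $\hat u(m)=(2\pi)^{-(n-1)/2}\int_{\mathbb T^{n-1}}e^{-im\cdot\boldsymbol\xi}u\,d\boldsymbol\xi$. Let $H_0(\mathbf y,z_2)$, $\mathbf y\in\mathbb R^{n-1}$, $z_2\in\mathbb R$, be real-analytic near $0$ with $\nabla_{\mathbf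 y}H_0(0,0)=\boldsymbol\omega$ and $\partial_{z_2}H_0(0,0)=0$, where $\boldsymbol\omega$ is Diophantine: $\boldsymbol\omega\cdot\mathbf s\neq0$ and $|\boldsymbol\omega\cdot\mathbf s|^{-1}\le c_0|\mathbf s|^{n}$ for all $\mathbf s\in\mathbb Z^{n-1}\setminus\{0\}$. Put $\mathbf S_0=\partial^2_{\mathbf y}H_0(0,0)$, $\mathbf t_0=\nabla_{\mathbf y}\partial_{z_2}H_0(0,0)$, let $\mathbf T_0$ be the $2\times(n-1)$ matrix with rows $0,\mathbf t_0^\top$, and $\mathbf K_0=\mathbf S_0-\mathbf t_0\otimes\mathbf t_0$; assume $\det\mathbf K_0\ne0$. Let $\boldsymbol\partial=\boldsymbol\omega\cdot\nabla$, $\mathbf J=\begin{pmatrix}0&1\\-1&0\end{pmatrix}$, $\boldsymbol\Omega=\mathrm{diag}(-k,1)$, $\mathbf e_1=(1,0)^\top$. Fix $\sigma\in(1/2,1]$, an integer $d\ge2$ and a constant $C$. **Theorem.** There are $\varepsilon_0>0$ and $c>0$, depending only on the data fixed above, such that the following holds for all real $|\varepsilon|\le\varepsilon_0$, all $\alpha\in\mathbb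 R$, all $k\in[0,1]$, and all functions $w_1$ (scalar), $\mathbf V$ (invertible $(n-1)\times(n-1)$), $\mathbf W$ ($2\times2$), $\mathbf S$ ($(n-1)\times(n-1)$), $\mathbf T$ ($2\times(n-1)$) on $\mathbb T^{n-1}$ with $\overline{w_1}=\alpha$ and $$\|\mathbf V^{-1}-\mathbf I\|_{\sigma/2,0}+\|w_1-\alpha\|_{\sigma/2,d}+\|\mathbf W-\mathbf I\|_{\sigma/2,d}\le C|\varepsilon|,\qquad \|\mathbf S-\mathbf S_0\|_{\sigma/2,d-1}+\|\mathbf T-\mathbf T_0\|_{\sigma/2,d-1}\le C|\varepsilon|.$$ Consider the problem of finding $\boldsymbol\mu,\boldsymbol\chi$ (with values in $\mathbb R^{n-1}$) and $\boldsymbol\lambda$ (with values in $\mathbb R^2$) in $\mathcal A_{\sigma/4,0}$, and $p\in\mathbb R$, such that $$\boldsymbol\partial\boldsymbol\mu=-p\nabla w_1-\nabla g_1,\quad \mathbf J\boldsymbol\partial\boldsymbol\lambda+\boldsymbol\Omega\boldsymbol\lambda+\mathbf T\boldsymbol\mu+p\mathbf W^\top\mathbf e_1=\mathbf g_2,\quad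 -\boldsymbol\partial\boldsymbol\chi+\mathbf S\boldsymbol\mu+\mathbf T^\top\boldsymbol\lambda=0,$$ $$\overline{\mathbf W\boldsymbol\lambda\cdot\mathbf e_1}+\overline{\boldsymbol\chi\cdot\nabla w_1}=\gamma,\qquad \overline{\mathbf V^{-\top}\boldsymbol\chi}=0.$$ It has a unique solution $(\boldsymbol\mu^{(1)},\boldsymbol\lambda^{(1)},\boldsymbol\chi^{(1)},p^{(1)})$ for $g_1=0,\ \mathbf g_2=0,\ \gamma=1$, and a unique solution $(\boldsymbol\mu^{(2)},\boldsymbol\lambda^{(2)},\boldsymbol\chi^{(2)},p^{(2)})$ for $g_1=\tfrac12(w_1^*)^2,\ \mathbf g_2=-w_1^*\mathbf W^\top\mathbf e_1,\ \gamma=0$. The quantities $$L_{ij}=\int_{\mathbb T^{n-1}}\big\{\mathbf S\boldsymbol\mu^{(i)}\cdot\boldsymbol\mu^{(j)}-(\mathbf J\boldsymbol\partial\boldsymbol\lambda^{(i)}+\boldsymbol\Omega\boldsymbol\lambda^{(i)})\cdot\boldsymbol\lambda^{(j)}\big\}\,d\boldsymbol\xi$$ satisfy $$|L_{12}|\le c|\varepsilon|,\qquad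 |L_{11}|\le c,\qquad c^{-1}|w_1^*|_{-1}^2\le|L_{22}|\le c\,\|w_1^*\|_{\sigma/2,0}^2,\qquad \|w_1^*\|_{\sigma/2,0}^2\le c|\varepsilon|^2.$$ If $k=0$, then, with $\boldsymbol\mu_0=\mathbf K_0^{-1}\overline{\mathbf t_1}$, where $\mathbf t_1^\top$ is the first row of $\mathbf T$, $$\big|L_{11}-(2\pi)^{n-1}\mathbf K_0\boldsymbol\mu_0\cdot\boldsymbol\mu_0\big|\le c|\varepsilon|\,|\boldsymbol\mu_0|^2,\qquad |L_{12}|\le c|\varepsilon|\,|\boldsymbol\mu_0|.$$ -/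

import Mathlib

open scoped Matrix ENNReal

noncomputable section

namespace LowerTori

/-! ### Functions on the torus `𝕋ᵐ = ℝᵐ / 2πℤᵐ` and the analytic norms

Functions on the torus are `2π`-periodic functions on `Fin m → ℝ`. -/

/-- The complex strip `{ξ : |Im ξ_j| < ρ for all j}` around the real torus. -/
def strip (m : ℕ) (ρ : ℝ) : Set (Fin m → ℂ) := {ξ | ∀ j, |(ξ j).im| < ρ}

/-- `F` is a holomorphic `2π`-periodic extension of the real function `f` to the strip of
width `ρ`. -/
structure IsExtension {m : ℕ} (ρ : ℝ) (f : (Fin m → ℝ) → ℝ) (F : (Fin m → ℂ) → ℂ) : Prop where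
  holomorphic : DifferentiableOn ℂ F (strip m ρ)
  periodic : ∀ ξ ∈ strip m ρ, ∀ j, F (ξ + Pi.single j ((2 * Real.pi : ℝ) : ℂ)) = F ξ
  extends_real : ∀ x : Fin m → ℝ, F (fun j => (x j : ℂ)) = (f x : ℂ)

/-- `max_{l ≤ d} sup |∂_{j₁} ⋯ ∂_{j_l} F|`, the supremum being taken over the strip. -/
def stripNorm {m : ℕ} (ρ : ℝ) (d : ℕ) (F : (Fin m → ℂ) → ℂ) : ℝ≥0∞ :=
  ⨆ (l : ℕ) (_ : l ≤ d) (j : Fin l → Fin m) (ξ : Fin m → ℂ) (_ : ξ ∈ strip m ρ),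
    ‖iteratedFDeriv ℂ l F ξ (fun i => Pi.single (j i) 1)‖ₑ

/-- The norm of a real function on the torus in the space of analytic functions on the strip of
width `ρ` with bounded derivatives up to order `d`. The extension to the strip is unique if it
exists, so the infimum is the norm of that extension; it is `⊤` if `f` has no extension. Hence `f`
belongs to the space if and only if this norm is finite. -/
def anNorm {m : ℕ} (ρ : ℝ) (d : ℕ) (f : (Fin m → ℝ) → ℝ) : ℝ≥0∞ :=
  ⨅ (F : (Fin m → ℂ) → ℂ) (_ : IsExtension ρ f F), stripNorm ρ d F

/-- The analytic norm of a vector function: the largest norm of a component. -/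
def vecNorm {m a : ℕ} (ρ : ℝ) (d : ℕ) (f : (Fin m → ℝ) → (Fin a → ℝ)) : ℝ≥0∞ :=
  ⨆ i, anNorm ρ d (fun ξ => f ξ i)

/-- The analytic norm of a matrix function: the largest norm of an entry. -/
def matNorm {m a b : ℕ} (ρ : ℝ) (d : ℕ) (A : (Fin m → ℝ) → Matrix (Fin a) (Fin b) ℝ) : ℝ≥0∞ :=
  ⨆ (i : Fin a) (j : Fin b), anNorm ρ d (fun ξ => A ξ i j)

/-- Integral over the torus. -/
def torusInt {m : ℕ} {E : Type*} [NormedAddCommGroup E] [NormedSpace ℝ E]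
    (f : (Fin m → ℝ) → E) : E :=
  ∫ ξ in Set.Icc (0 : Fin m → ℝ) (fun _ => 2 * Real.pi), f ξ

/-- Mean value over the torus. -/
def mean {m : ℕ} {E : Type*} [NormedAddCommGroup E] [NormedSpace ℝ E]
    (f : (Fin m → ℝ) → E) : E :=
  ((2 * Real.pi) ^ m)⁻¹ • torusInt f

/-- The oscillating part `f* = f - mean f`. -/
def osc {m : ℕ} (f : (Fin m → ℝ) → ℝ) : (Fin m → ℝ) → ℝ := fun ξ => f ξ - mean f

/-- `û(s) = (2π)^{-m/2} ∫ e^{-i s·ξ} u(ξ) dξ`. -/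
def fourierHat {m : ℕ} (u : (Fin m → ℝ) → ℝ) (s : Fin m → ℤ) : ℂ :=
  (((2 * Real.pi) ^ (-(m : ℝ) / 2) : ℝ) : ℂ) *
    torusInt (fun ξ => Complex.exp (-Complex.I * ((∑ i, (s i : ℝ) * ξ i : ℝ) : ℂ)) * (u ξ : ℂ))

/-- The Sobolev norm `|u|_r = (∑_s (1 + |s|²)^r |û(s)|²)^{1/2}`. -/
def sobolevNorm {m : ℕ} (r : ℝ) (u : (Fin m → ℝ) → ℝ) : ℝ :=
  Real.sqrt (∑' s : Fin m → ℤ, (1 + ∑ i, (s i : ℝ) ^ 2) ^ r * ‖fourierHat u s‖ ^ 2)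

/-- Gradient of a scalar function. -/
def grad {m : ℕ} (f : (Fin m → ℝ) → ℝ) (ξ : Fin m → ℝ) : Fin m → ℝ :=
  fun i => fderiv ℝ f ξ (Pi.single i 1)

/-- The derivative `∂ = ω · ∇` along the frequency vector. -/
def dir {m : ℕ} {E : Type*} [NormedAddCommGroup E] [NormedSpace ℝ E]
    (ω : Fin m → ℝ) (f : (Fin m → ℝ) → E) (ξ : Fin m → ℝ) : E :=
  fderiv ℝ f ξ ω

/-- Euclidean length of a vector. -/
def eucl {a : ℕ} (v : Fin a → ℝ) : ℝ := Real.sqrt (∑ i, v i ^ 2)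

/-- `ω` is Diophantine: `|ω·s|⁻¹ ≤ c₀ |s|^τ` for all nonzero integer vectors `s`
(in particular `ω·s ≠ 0`). -/
def Diophantine {m : ℕ} (ω : Fin m → ℝ) (τ : ℕ) (c₀ : ℝ) : Prop :=
  ∀ s : Fin m → ℤ, s ≠ 0 →
    1 ≤ c₀ * eucl (fun i => (s i : ℝ)) ^ τ * |∑ i, ω i * (s i : ℝ)|

/-! ### Constant matrices -/

def J : Matrix (Fin 2) (Fin 2) ℝ := !![0, 1; -1, 0]

def Omega (k : ℝ) : Matrix (Fin 2) (Fin 2) ℝ := !![-k, 0; 0, 1]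

/-- The `i`-th coordinate direction in the `y`-space, inside the `(y, z₂)`-space. -/
def yDir {m : ℕ} (i : Fin m) : (Fin m → ℝ) × ℝ := (Pi.single i 1, 0)

/-- The coordinate direction of `z₂`. -/
def zDir {m : ℕ} : (Fin m → ℝ) × ℝ := (0, 1)

/-- `S₀ = ∂²H₀/∂y²(0,0)`. -/
def S₀ {m : ℕ} (H₀ : (Fin m → ℝ) × ℝ → ℝ) : Matrix (Fin m) (Fin m) ℝ :=
  Matrix.of fun i j => fderiv ℝ (fun q => fderiv ℝ H₀ q (yDir j)) 0 (yDir i)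

/-- `t₀ = ∇_y ∂_{z₂} H₀(0,0)`. -/
def t₀ {m : ℕ} (H₀ : (Fin m → ℝ) × ℝ → ℝ) : Fin m → ℝ :=
  fun i => fderiv ℝ (fun q => fderiv ℝ H₀ q zDir) 0 (yDir i)

/-- `T₀ = ∂²H₀/∂z∂y(0,0)`; its first row vanishes because `H₀` does not depend on `z₁`. -/
def T₀ {m : ℕ} (H₀ : (Fin m → ℝ) × ℝ → ℝ) : Matrix (Fin 2) (Fin m) ℝ :=
  Matrix.of ![0, t₀ H₀]

/-- `K₀ = S₀ - t₀ ⊗ t₀`. -/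
def K₀ {m : ℕ} (H₀ : (Fin m → ℝ) × ℝ → ℝ) : Matrix (Fin m) (Fin m) ℝ :=
  S₀ H₀ - Matrix.vecMulVec (t₀ H₀) (t₀ H₀)

/-! ### The linear problem and the quadratic form -/

/-- The coefficients of the linear problem, as functions on the torus. -/
structure Coeffs (m : ℕ) where
  w₁ : (Fin m → ℝ) → ℝ
  V : (Fin m → ℝ) → Matrix (Fin m) (Fin m) ℝ
  W : (Fin m → ℝ) → Matrix (Fin 2) (Fin 2) ℝ
  S : (Fin m → ℝ) → Matrix (Fin m) (Fin m) ℝ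
  T : (Fin m → ℝ) → Matrix (Fin 2) (Fin m) ℝ

/-- The standing assumptions on the coefficients. -/
structure Coeffs.Admissible {m : ℕ} (A : Coeffs m) (H₀ : (Fin m → ℝ) × ℝ → ℝ)
    (ϱ σ : ℝ) (d : ℕ) (C α ε : ℝ) : Prop where
  mean_w₁ : mean A.w₁ = α
  det_V : ∀ ξ, IsUnit (A.V ξ).det
  est₁ : matNorm (σ / 2 * ϱ) 0 (fun ξ => (A.V ξ)⁻¹ - 1)
      + anNorm (σ / 2 * ϱ) d (fun ξ => A.w₁ ξ - α)
      + matNorm (σ / 2 * ϱ) d (fun ξ => A.W ξ - 1) ≤ ENNReal.ofReal (C * |ε|)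
  est₂ : matNorm (σ / 2 * ϱ) (d - 1) (fun ξ => A.S ξ - S₀ H₀)
      + matNorm (σ / 2 * ϱ) (d - 1) (fun ξ => A.T ξ - T₀ H₀) ≤ ENNReal.ofReal (C * |ε|)

/-- The unknowns `(μ, λ, χ, p)` of the linear problem. -/
structure Unknowns (m : ℕ) where
  mu : (Fin m → ℝ) → (Fin m → ℝ)
  lam : (Fin m → ℝ) → (Fin 2 → ℝ)
  chi : (Fin m → ℝ) → (Fin m → ℝ)
  p : ℝ

/-- `X = (μ, λ, χ, p)` is an analytic solution, on the strip of width `r`, of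
`∂μ = -p∇w₁ - ∇g₁`, `J∂λ + Ωλ + Tμ + pWᵀe₁ = g₂`, `-∂χ + Sμ + Tᵀλ = 0`
with `mean((Wλ)·e₁) + mean(χ·∇w₁) = γ` and `mean(V⁻ᵀχ) = 0`. -/
structure Solves {m : ℕ} (A : Coeffs m) (ω : Fin m → ℝ) (k r : ℝ)
    (g₁ : (Fin m → ℝ) → ℝ) (g₂ : (Fin m → ℝ) → (Fin 2 → ℝ)) (γ : ℝ) (X : Unknowns m) : Prop where
  mu_mem : vecNorm r 0 X.mu < ⊤
  lam_mem : vecNorm r 0 X.lam < ⊤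
  chi_mem : vecNorm r 0 X.chi < ⊤
  eq_mu : ∀ ξ, dir ω X.mu ξ = -(X.p • grad A.w₁ ξ) - grad g₁ ξ
  eq_lam : ∀ ξ, J *ᵥ dir ω X.lam ξ + Omega k *ᵥ X.lam ξ + A.T ξ *ᵥ X.mu ξ
      + X.p • ((A.W ξ)ᵀ *ᵥ Pi.single 0 1) = g₂ ξ
  eq_chi : ∀ ξ, -dir ω X.chi ξ + A.S ξ *ᵥ X.mu ξ + (A.T ξ)ᵀ *ᵥ X.lam ξ = 0
  norm_lam : mean (fun ξ => (A.W ξ *ᵥ X.lam ξ) 0) + mean (fun ξ => X.chi ξ ⬝ᵥ grad A.w₁ ξ) = γ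
  norm_chi : mean (fun ξ => ((A.V ξ)⁻¹)ᵀ *ᵥ X.chi ξ) = 0

/-- The first problem: zero right-hand sides and `γ = 1`. -/
def Solves₁ {m : ℕ} (A : Coeffs m) (ω : Fin m → ℝ) (k r : ℝ) (X : Unknowns m) : Prop :=
  Solves A ω k r 0 0 1 X

/-- The second problem: `g₁ = (w₁*)²/2`, `g₂ = -w₁* Wᵀ e₁` and `γ = 0`. -/
def Solves₂ {m : ℕ} (A : Coeffs m) (ω : Fin m → ℝ) (k r : ℝ) (X : Unknowns m) : Prop :=
  Solves A ω k r (fun ξ => (1 / 2 : ℝ) * osc A.w₁ ξ ^ 2)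
    (fun ξ => -(osc A.w₁ ξ • ((A.W ξ)ᵀ *ᵥ Pi.single 0 1))) 0 X

/-- `∫ {Sμ·μ' - (J∂λ + Ωλ)·λ'} dξ`; the entry `L_{ij}` is `quadForm A ω k X⁽ⁱ⁾ X⁽ʲ⁾`. -/
def quadForm {m : ℕ} (A : Coeffs m) (ω : Fin m → ℝ) (k : ℝ) (X Y : Unknowns m) : ℝ :=
  torusInt fun ξ => (A.S ξ *ᵥ X.mu ξ) ⬝ᵥ Y.mu ξ
    - (J *ᵥ dir ω X.lam ξ + Omega k *ᵥ X.lam ξ) ⬝ᵥ Y.lam ξ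

/-- `μ₀ = K₀⁻¹ mean(t₁)`, where `t₁` is the first row of `T`. -/
def mu₀ {m : ℕ} (H₀ : (Fin m → ℝ) × ℝ → ℝ) (A : Coeffs m) : Fin m → ℝ :=
  (K₀ H₀)⁻¹ *ᵥ mean (fun ξ => A.T ξ 0)

end LowerTori

end

open LowerTori

/-! Functions are handled through their Fourier coefficients. Analyticity on a strip amounts, up to
an arbitrarily small loss of width, to exponential decay of the coefficients (`decays_of_extension`,
`Decays.exists_extension`). By the Diophantine condition, `∂⁻¹` and `(k - ∂²)⁻¹` on functions of
mean zero have polynomially bounded symbols, the second one uniformly in `k ≥ 0`, so they too cost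
only strip width.

The system is triangular. The first equation gives `μ` up to its mean. Eliminating one component of
`λ` turns the second into two equations for `k - ∂²`, which give `λ` up to its mean. The third gives
`χ` up to its mean, provided that `Sμ + Tᵀλ` has mean zero. What remains is a finite linear system
`LinData.Phi` for `(mean μ, p, mean λ₁, mean λ₂)`. The mean of `χ` does not enter it, because `∇w₁`
has mean zero; that mean is fixed afterwards by the last normalization, where the mean of `V⁻ᵀ` is
close to the identity. Up to `O(ε)` the linear part of `Phi` is the explicit map `lam₀`
(`Near.Phi_sub`), whose elimination leaves the matrix `K₀`, with bounds uniform in `k ∈ [0,1]`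
(`isBigO_of_lam₀`). This gives existence, uniqueness, and parameters of size `O(1)` in the first
problem and of the size of `w = w₁*` in the second; the upper bounds on `L_ij` follow.

The lower bound on `L₂₂` is in a weak norm, so the errors must be measured in the energy `en² = mean
(w (1 - ∂²)⁻¹ w)`, which dominates `|w|²_{-1}`. Pairing `w` with an analytic function costs only one
factor `en`. Moving resolvents across pairings by symmetry then shows that the parameters of the
second solution are `O(ε en)`, and that `L₂₂` differs by `O(ε en²)` from the form obtained by
solving `J∂λ + Ωλ = g₂` with mean zero (`Near.quadSol_second_sub`). That form is a resolvent form
minus a variance; the variational principle for the resolvent, with the trial function `Wb ∂H - H`,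
`H = (1 - ∂²)⁻¹ w`, and `k ≤ 1`, bounds it below by `(1 - cε) en²` (`Near.exists_le_res`).

For `k = 0` the constant `λ = (1,0)`, `μ = 0`, `p = 0` solves the first problem up to a scalar
factor and the defect `mean t₁ = K₀μ₀`. Subtracting its multiple leaves the quadratic form unchanged
and leaves parameters `-(μ₀, 0, 0, -t₀·μ₀) + O(ε|μ₀|)`, whence the leading value `S₀μ₀·μ₀ - (t₀·μ₀)²
= K₀μ₀·μ₀`.

Uniformity of the constants is obtained by proving every estimate for families over an arbitrary
index set (`UO`, and `=O[⊤]` for numbers) and applying it to the set of all admissible data. -/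

noncomputable section

namespace LowerTori

/-! ### Characters and Fourier coefficients on the torus -/

/-- The inclusion of real vectors into complex vectors. -/
def toC {m : ℕ} (x : Fin m → ℝ) : Fin m → ℂ := fun j => (x j : ℂ)

/-- The entire function `ξ ↦ exp (i s·ξ)`. -/
def char {m : ℕ} (s : Fin m → ℤ) (ξ : Fin m → ℂ) : ℂ :=
  Complex.exp (Complex.I * ∑ j, (s j : ℂ) * ξ j)

/-- The length `∑ |s_j|` of an integer vector. -/
def len {m : ℕ} (s : Fin m → ℤ) : ℝ := ∑ j, |(s j : ℝ)|

variable {m : ℕ}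

theorem len_nonneg (s : Fin m → ℤ) : 0 ≤ len s := Finset.sum_nonneg fun _ _ => abs_nonneg _

theorem len_add_le (s t : Fin m → ℤ) : len (s + t) ≤ len s + len t := by
  simp only [len, ← Finset.sum_add_distrib]
  exact Finset.sum_le_sum fun j _ => by simpa using abs_add_le (s j : ℝ) (t j : ℝ)

@[simp] theorem len_neg (s : Fin m → ℤ) : len (-s) = len s := by simp [len]

@[simp] theorem len_zero : len (0 : Fin m → ℤ) = 0 := by simp [len]

theorem char_add (s t : Fin m → ℤ) (ξ : Fin m → ℂ) : char (s + t) ξ = char s ξ * char t ξ := by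
  simp only [char, ← Complex.exp_add, ← mul_add, ← Finset.sum_add_distrib, Pi.add_apply,
    Int.cast_add, add_mul]

theorem char_add_arg (s : Fin m → ℤ) (ξ η : Fin m → ℂ) :
    char s (ξ + η) = char s ξ * char s η := by
  simp only [char, ← Complex.exp_add, ← mul_add, ← Finset.sum_add_distrib, Pi.add_apply]

@[simp] theorem char_zero (ξ : Fin m → ℂ) : char 0 ξ = 1 := by simp [char]

theorem norm_char (s : Fin m → ℤ) (ξ : Fin m → ℂ) :
    ‖char s ξ‖ = Real.exp (-∑ j, (s j : ℝ) * (ξ j).im) := by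
  rw [char, Complex.norm_exp]
  simp

@[simp] theorem norm_char_toC (s : Fin m → ℤ) (x : Fin m → ℝ) : ‖char s (toC x)‖ = 1 := by
  simp [norm_char, toC]

theorem char_single_two_pi (s : Fin m → ℤ) (j : Fin m) :
    char s (Pi.single j ((2 * Real.pi : ℝ) : ℂ)) = 1 := by
  have : Complex.I * ∑ i, (s i : ℂ) * (Pi.single j ((2 * Real.pi : ℝ) : ℂ) : Fin m → ℂ) i
      = (s j : ℂ) * (2 * Real.pi * Complex.I) := by
    rw [Finset.sum_eq_single j]
    · simp; ring
    · intro b _ hb; simp [hb]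
    · simp
  rw [char, this]
  exact Complex.exp_int_mul_two_pi_mul_I (s j)

theorem toC_add (x y : Fin m → ℝ) : toC (x + y) = toC x + toC y := by
  ext; simp [toC]

theorem toC_single (j : Fin m) (a : ℝ) : toC (Pi.single j a) = Pi.single j (a : ℂ) := by
  ext i; by_cases h : i = j
  · subst h; simp [toC]
  · simp [toC, h]

theorem continuous_toC : Continuous (toC : (Fin m → ℝ) → _) := by
  unfold toC; fun_prop

theorem continuous_char (s : Fin m → ℤ) : Continuous (char s) := by
  unfold char; fun_prop

theorem char_neg_toC (s : Fin m → ℤ) (x : Fin m → ℝ) :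
    char (-s) (toC x) = (starRingEnd ℂ) (char s (toC x)) := by
  simp only [char, ← Complex.exp_conj, map_mul, Complex.conj_I, map_sum, toC]
  simp

/-- `2π`-periodicity in each variable. -/
def Periodic {E : Type*} (f : (Fin m → ℝ) → E) : Prop :=
  ∀ x j, f (x + Pi.single j (2 * Real.pi)) = f x

theorem periodic_char (s : Fin m → ℤ) : Periodic fun x : Fin m → ℝ => char s (toC x) := by
  intro x j
  simp only [toC_add, char_add_arg, toC_single, char_single_two_pi, mul_one]

theorem Periodic.add_intVec {E : Type*} {f : (Fin m → ℝ) → E} (hf : Periodic f) (x : Fin m → ℝ)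
    (z : Fin m → ℤ) : f (x + fun j => 2 * Real.pi * z j) = f x := by
  have h1 : ∀ (j : Fin m) (a : ℤ) x, f (x + Pi.single j (2 * Real.pi * a)) = f x := by
    intro j a
    have hp : ∀ y, Function.Periodic (fun t : ℝ => f (y + (Pi.single j t : Fin m → ℝ))) (2 * Real.pi) := by
      intro y t
      simp only [Pi.single_add, ← add_assoc]
      exact hf _ j
    intro x
    have := (hp x).int_mul a 0
    simpa [mul_comm] using this
  have h2 : ∀ (S : Finset (Fin m)) x,
      f (x + ∑ j ∈ S, Pi.single j (2 * Real.pi * (z j : ℝ))) = f x := by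
    intro S
    induction S using Finset.induction_on with
    | empty => simp
    | insert a S ha ih =>
      intro x
      rw [Finset.sum_insert ha, ← add_assoc, ih, h1]
  have := h2 Finset.univ x
  rwa [Finset.univ_sum_single] at this

/-! ### Periodic functions as functions on the unit torus -/

section Torus

/-- The covering map from `ℝᵐ` to the unit torus, sending `x` to the class of `x / 2π`. -/
def cover (x : Fin m → ℝ) : UnitAddTorus (Fin m) := fun j => ((x j : ℝ) : UnitAddCircle)

theorem isOpenQuotientMap_cover : IsOpenQuotientMap (cover (m := m)) :=
  IsOpenQuotientMap.piMap (f := fun _ : Fin m => ((↑) : ℝ → UnitAddCircle))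
    fun _ => QuotientAddGroup.isOpenQuotientMap_mk

/-- Periodicity makes the rescaled function constant on the fibres of `cover`, and continuity
descends along an open quotient map. This gives access to the Fourier theory of `UnitAddTorus`. -/
theorem exists_torus_lift {f : (Fin m → ℝ) → ℂ} (hf : Continuous f) (hp : Periodic f) :
    ∃ g : C(UnitAddTorus (Fin m), ℂ), ∀ x, g (cover x) = f ((2 * Real.pi) • x) := by
  have hcompat : ∀ x y : Fin m → ℝ, cover x = cover y →
      f ((2 * Real.pi) • x) = f ((2 * Real.pi) • y) := by
    intro x y hxy
    have : ∀ j, ∃ z : ℤ, x j - y j = z := by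
      intro j
      have h := congrFun hxy j
      simp only [cover] at h
      rw [QuotientAddGroup.eq_iff_sub_mem] at h
      obtain ⟨z, hz⟩ := AddSubgroup.mem_zmultiples_iff.1 h
      exact ⟨z, by rw [← hz]; simp⟩
    choose z hz using this
    have h2 : (2 * Real.pi) • x = (2 * Real.pi) • y + fun j => 2 * Real.pi * (z j : ℝ) := by
      ext j
      simp only [Pi.smul_apply, Pi.add_apply, smul_eq_mul, ← hz j]; ring
    rw [h2, hp.add_intVec]
  have hs := (isOpenQuotientMap_cover (m := m)).surjective
  let g : UnitAddTorus (Fin m) → ℂ := fun t => f ((2 * Real.pi) • (hs t).choose)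
  have hg : ∀ x, g (cover x) = f ((2 * Real.pi) • x) := fun x =>
    hcompat _ _ (hs (cover x)).choose_spec
  refine ⟨⟨g, ?_⟩, hg⟩
  rw [isOpenQuotientMap_cover.isQuotientMap.continuous_iff]
  have : g ∘ cover = fun x => f ((2 * Real.pi) • x) := funext hg
  rw [this]
  fun_prop

theorem setIntegral_unit_box_eq_Icc {E : Type*} [NormedAddCommGroup E] [NormedSpace ℝ E]
    (f : (Fin m → ℝ) → E) :
    ∫ x in {x : Fin m → ℝ | ∀ i, x i ∈ Set.Ioc ((0 : Fin m → ℝ) i) ((0 : Fin m → ℝ) i + 1)}, f x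
      = ∫ x in Set.Icc (0 : Fin m → ℝ) 1, f x := by
  apply MeasureTheory.setIntegral_congr_set
  have h : {x : Fin m → ℝ | ∀ i, x i ∈ Set.Ioc ((0 : Fin m → ℝ) i) ((0 : Fin m → ℝ) i + 1)}
      = Set.univ.pi fun i => Set.Ioc ((0 : Fin m → ℝ) i) ((1 : Fin m → ℝ) i) := by
    ext x; simp
  rw [h]
  exact MeasureTheory.Measure.univ_pi_Ioc_ae_eq_Icc

theorem torusInt_eq_unit {E : Type*} [NormedAddCommGroup E] [NormedSpace ℝ E]
    (f : (Fin m → ℝ) → E) :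
    mean f = ∫ x in Set.Icc (0 : Fin m → ℝ) 1, f ((2 * Real.pi) • x) := by
  have h0 : (0 : ℝ) < 2 * Real.pi := by positivity
  rw [MeasureTheory.Measure.setIntegral_comp_smul _ _ _ h0.ne']
  simp only [mean, torusInt, Module.finrank_fin_fun]
  rw [abs_of_pos (by positivity)]
  congr 3
  ext x
  rw [Set.mem_smul_set_iff_inv_smul_mem₀ h0.ne']
  simp only [Set.mem_Icc, Pi.le_def, Pi.smul_apply, smul_eq_mul, Pi.zero_apply, Pi.one_apply]
  refine and_congr (forall_congr' fun i => ?_) (forall_congr' fun i => ?_)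
  · rw [inv_mul_eq_div, le_div_iff₀ h0, zero_mul]
  · rw [inv_mul_eq_div, div_le_one h0]

/-- Both means are integrals of the same function on the unit torus, computed over fundamental boxes
with different corners. -/
theorem mean_translate {f : (Fin m → ℝ) → ℂ} (hf : Continuous f) (hp : Periodic f)
    (v : Fin m → ℝ) : mean (fun x => f (x + v)) = mean f := by
  obtain ⟨g, hg⟩ := exists_torus_lift hf hp
  set u : Fin m → ℝ := (2 * Real.pi)⁻¹ • v with hu
  have hv : v = (2 * Real.pi) • u := by
    rw [hu, smul_smul, mul_inv_cancel₀ (by positivity), one_smul]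
  have h1 := (UnitAddTorus.integral_preimage g (0 : Fin m → ℝ)).symm.trans
    (UnitAddTorus.integral_preimage g u)
  have hcov : ∀ x : Fin m → ℝ, g (fun i => (x i : UnitAddCircle)) = f ((2 * Real.pi) • x) := hg
  simp only [hcov] at h1
  rw [torusInt_eq_unit, torusInt_eq_unit, ← setIntegral_unit_box_eq_Icc,
    ← setIntegral_unit_box_eq_Icc (fun x => f ((2 * Real.pi) • x)), h1]
  have hmp := MeasureTheory.measurePreserving_add_right MeasureTheory.volume u
  have hemb : MeasurableEmbedding (fun x : Fin m → ℝ => x + u) :=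
    (Homeomorph.addRight u).measurableEmbedding
  rw [← hmp.setIntegral_preimage_emb hemb (fun x => f ((2 * Real.pi) • x))
    {x | ∀ i, x i ∈ Set.Ioc (u i) (u i + 1)}]
  simp only [hv, smul_add]
  congr 2
  ext x
  simp only [Set.mem_ofPred_eq, Set.mem_preimage, Pi.add_apply, Set.mem_Ioc, Pi.zero_apply]
  refine forall_congr' fun i => ?_
  constructor <;> rintro ⟨h, h'⟩ <;> constructor <;> linarith

end Torus

/-- The Fourier coefficient `(2π)⁻ᵐ ∫ e^{-i s·x} f(x) dx` of a real function. -/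
def coef (f : (Fin m → ℝ) → ℝ) (s : Fin m → ℤ) : ℂ :=
  mean fun x => char (-s) (toC x) * (f x : ℂ)

theorem mFourier_cover (s : Fin m → ℤ) (x : Fin m → ℝ) :
    UnitAddTorus.mFourier s (cover x) = char s (toC ((2 * Real.pi) • x)) := by
  simp only [UnitAddTorus.mFourier, ContinuousMap.coe_mk, cover, fourier_coe_apply, char,
    ← Complex.exp_sum, toC]
  congr 1
  rw [Finset.mul_sum]
  refine Finset.sum_congr rfl fun j _ => ?_
  simp
  ring

theorem hasSum_coef {f : (Fin m → ℝ) → ℝ} (hf : Continuous f) (hp : Periodic f)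
    (hs : Summable (coef f)) (x : Fin m → ℝ) :
    HasSum (fun s => coef f s * char s (toC x)) (f x : ℂ) := by
  obtain ⟨g, hg⟩ := exists_torus_lift (f := fun x => (f x : ℂ)) (by fun_prop)
    (fun x j => congrArg _ (hp x j))
  have hcoef : UnitAddTorus.mFourierCoeff g = coef f := by
    ext s
    rw [UnitAddTorus.mFourierCoeff_eq_integral _ _ 0, setIntegral_unit_box_eq_Icc, coef,
      torusInt_eq_unit]
    congr 1
    ext x
    have h1 := hg x
    have h2 := mFourier_cover (-s) x
    unfold cover at h1 h2
    rw [h1, h2, smul_eq_mul]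
  have hx : x = (2 * Real.pi) • ((2 * Real.pi)⁻¹ • x) := by
    rw [smul_smul, mul_inv_cancel₀ (by positivity), one_smul]
  have := UnitAddTorus.hasSum_mFourier_series_apply_of_summable (hcoef ▸ hs)
    (cover ((2 * Real.pi)⁻¹ • x))
  simp only [hg, mFourier_cover, hcoef, smul_eq_mul, ← hx] at this
  exact this

/-! ### Mean values -/

theorem volume_real_box :
    MeasureTheory.volume.real (Set.Icc (0 : Fin m → ℝ) fun _ => 2 * Real.pi)
      = (2 * Real.pi) ^ m := by
  rw [MeasureTheory.Measure.real, Real.volume_Icc_pi]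
  simp [ENNReal.toReal_ofReal Real.pi_pos.le]

theorem integrableOn_box {E : Type*} [NormedAddCommGroup E] {f : (Fin m → ℝ) → E}
    (hf : Continuous f) :
    MeasureTheory.IntegrableOn f (Set.Icc (0 : Fin m → ℝ) fun _ => 2 * Real.pi) :=
  hf.continuousOn.integrableOn_compact isCompact_Icc

section Mean
variable {E : Type*} [NormedAddCommGroup E] [NormedSpace ℝ E]

theorem mean_add {f g : (Fin m → ℝ) → E} (hf : Continuous f) (hg : Continuous g) :
    mean (fun x => f x + g x) = mean f + mean g := by
  simp only [mean, torusInt]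
  rw [MeasureTheory.integral_add (integrableOn_box hf) (integrableOn_box hg), smul_add]

theorem mean_smul (c : ℝ) (f : (Fin m → ℝ) → E) : mean (fun x => c • f x) = c • mean f := by
  simp only [mean, torusInt]
  rw [MeasureTheory.integral_smul, smul_comm]

theorem mean_mul_left (c : ℂ) (f : (Fin m → ℝ) → ℂ) : mean (fun x => c * f x) = c * mean f := by
  simp only [mean, torusInt]
  rw [MeasureTheory.integral_const_mul, mul_smul_comm]

theorem mean_ofReal (f : (Fin m → ℝ) → ℝ) : mean (fun x => (f x : ℂ)) = ((mean f : ℝ) : ℂ) := by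
  simp only [mean, torusInt]
  rw [integral_complex_ofReal]
  simp

theorem mean_const [CompleteSpace E] (c : E) : mean (fun _ : Fin m → ℝ => c) = c := by
  simp only [mean, torusInt]
  rw [MeasureTheory.setIntegral_const, volume_real_box, smul_smul,
    inv_mul_cancel₀ (by positivity), one_smul]

theorem norm_mean_le {f : (Fin m → ℝ) → E} {M : ℝ} (h : ∀ x, ‖f x‖ ≤ M) : ‖mean f‖ ≤ M := by
  have h1 := MeasureTheory.norm_setIntegral_le_of_norm_le_const
    (μ := MeasureTheory.volume) (s := Set.Icc (0 : Fin m → ℝ) fun _ => 2 * Real.pi) (f := f) (C := M)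
    isCompact_Icc.measure_lt_top (fun x _ => h x)
  rw [volume_real_box] at h1
  simp only [mean, torusInt]
  rw [norm_smul, norm_inv, norm_pow, Real.norm_of_nonneg Real.two_pi_pos.le,
    inv_mul_le_iff₀ (by positivity), mul_comm _ M]
  exact h1

theorem hasSum_mean [CompleteSpace E] {ι : Type*} [Countable ι] {F : ι → (Fin m → ℝ) → E}
    {f : (Fin m → ℝ) → E} {u : ι → ℝ} (hu : Summable u) (hF : ∀ i, Continuous (F i))
    (hb : ∀ i x, ‖F i x‖ ≤ u i) (hs : ∀ x, HasSum (fun i => F i x) (f x)) :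
    HasSum (fun i => mean (F i)) (mean f) := by
  have hfe : f = fun x => ∑' i, F i x := funext fun x => (hs x).tsum_eq.symm
  simp only [mean, torusInt]
  refine HasSum.const_smul _ ?_
  rw [hfe]
  refine MeasureTheory.hasSum_integral_of_summable_integral_norm
    (fun i => integrableOn_box (hF i)) ?_
  refine Summable.of_nonneg_of_le (fun i => by positivity) (fun i => ?_)
    (hu.mul_right ((2 * Real.pi) ^ m))
  have := MeasureTheory.norm_setIntegral_le_of_norm_le_const
    (μ := MeasureTheory.volume) (s := Set.Icc (0 : Fin m → ℝ) fun _ => 2 * Real.pi)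
    (f := fun x => ‖F i x‖) (C := u i)
    isCompact_Icc.measure_lt_top (fun x _ => by simpa using hb i x)
  rw [volume_real_box] at this
  exact (le_abs_self _).trans this

theorem mean_pi {a : ℕ} {f : (Fin m → ℝ) → (Fin a → ℝ)} (hf : ∀ i, Continuous fun x => f x i)
    (i : Fin a) : mean f i = mean fun x => f x i := by
  simp only [mean, torusInt, Pi.smul_apply]
  congr 1
  have := (ContinuousLinearMap.proj (R := ℝ) (φ := fun _ : Fin a => ℝ) i).integral_comp_comm
    (integrableOn_box (continuous_pi hf))
  exact this.symm

end Mean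

/-- If `s j ≠ 0`, translation by `π / s j` in direction `j` multiplies the character by `-1` and
preserves the mean, so the mean vanishes. -/
theorem mean_char (s : Fin m → ℤ) :
    mean (fun x => char s (toC x)) = if s = 0 then 1 else 0 := by
  split_ifs with h
  · subst h; simp only [char_zero]; exact mean_const 1
  · obtain ⟨j, hj⟩ := Function.ne_iff.1 h
    have hc : Continuous fun x : Fin m → ℝ => char s (toC x) :=
      (continuous_char s).comp continuous_toC
    have hj' : (s j : ℝ) ≠ 0 := by exact_mod_cast hj
    have h1 := mean_translate hc (periodic_char s) (Pi.single j (Real.pi / s j))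
    have h2 : char s (toC (Pi.single j (Real.pi / s j))) = -1 := by
      rw [char, ← Complex.exp_pi_mul_I]
      congr 1
      rw [toC_single, Finset.sum_eq_single j]
      · have : (s j : ℂ) ≠ 0 := by exact_mod_cast hj
        simp; field_simp
      · intro b _ hb; simp [hb]
      · simp
    simp only [toC_add, char_add_arg, h2] at h1
    have h3 := mean_mul_left (-1) fun x : Fin m → ℝ => char s (toC x)
    simp only [mul_comm _ (-1 : ℂ)] at h1
    rw [h3] at h1
    linear_combination (-1 / 2 : ℂ) * h1

/-! ### Exponential weights -/

theorem summable_exp_len {r : ℝ} (hr : 0 < r) :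
    Summable fun s : Fin m → ℤ => Real.exp (-(r * len s)) := by
  induction m with
  | zero => exact Summable.of_finite
  | succ m ih =>
    rw [← (Fin.consEquiv fun _ : Fin (m + 1) => ℤ).summable_iff]
    have h1 : Summable fun z : ℤ => Real.exp (-(r * |(z : ℝ)|)) := by
      have h2 : Summable fun n : ℕ => Real.exp (-(r * (n : ℝ))) := by
        have := Real.summable_exp_nat_mul_iff.2 (show -r < 0 by linarith)
        refine this.congr fun n => ?_
        ring_nf
      refine Summable.of_nat_of_neg ?_ ?_
      · simpa using h2
      · simpa using h2
    refine (Summable.mul_of_nonneg h1 ih (fun _ => (Real.exp_pos _).le)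
      (fun _ => (Real.exp_pos _).le)).congr fun p => ?_
    simp only [Function.comp, Fin.consEquiv, Equiv.coe_fn_mk, len, Fin.sum_univ_succ, Fin.cons_zero,
      Fin.cons_succ]
    rw [← Real.exp_add]
    ring_nf

/-- The gap `δ = r - r'` pays for any polynomial factor, since `(δ(1+t))^τ / τ! ≤ e^{δ(1+t)}`. Every
loss of strip width caused by derivatives and small divisors is paid for in this way. -/
theorem exists_pow_mul_exp_le (τ : ℕ) {r r' : ℝ} (h : r' < r) :
    ∃ K, 0 ≤ K ∧ ∀ t : ℝ, 0 ≤ t → (1 + t) ^ τ * Real.exp (-(r * t)) ≤ K * Real.exp (-(r' * t)) := by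
  set δ := r - r' with hδ
  have hδ0 : 0 < δ := by linarith
  refine ⟨τ.factorial / δ ^ τ * Real.exp δ, by positivity, fun t ht => ?_⟩
  have h1 := Real.pow_div_factorial_le_exp (δ * (1 + t)) (by positivity) τ
  rw [div_le_iff₀ (by positivity), mul_pow] at h1
  have h2 : (1 + t) ^ τ ≤ τ.factorial / δ ^ τ * Real.exp (δ * (1 + t)) := by
    rw [div_mul_eq_mul_div, le_div_iff₀ (by positivity)]
    linarith
  calc (1 + t) ^ τ * Real.exp (-(r * t))
      ≤ τ.factorial / δ ^ τ * Real.exp (δ * (1 + t)) * Real.exp (-(r * t)) := by gcongr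
    _ = _ := by
      rw [mul_assoc, mul_assoc, ← Real.exp_add, ← Real.exp_add]
      congr 2
      rw [hδ]; ring

/-! ### Fourier coefficients of sums and products -/

theorem continuous_charReal (s : Fin m → ℤ) : Continuous fun x : Fin m → ℝ => char s (toC x) :=
  (continuous_char s).comp continuous_toC

theorem coef_zero_eq_mean (f : (Fin m → ℝ) → ℝ) : coef f 0 = ((mean f : ℝ) : ℂ) := by
  simp only [coef, neg_zero, char_zero, one_mul]
  exact mean_ofReal f

theorem coef_add {f g : (Fin m → ℝ) → ℝ} (hf : Continuous f) (hg : Continuous g)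
    (s : Fin m → ℤ) : coef (f + g) s = coef f s + coef g s := by
  have h1 := continuous_charReal (m := m) (-s)
  simp only [coef]
  rw [← mean_add (by fun_prop) (by fun_prop)]
  simp [mul_add]

theorem coef_smul (c : ℝ) (f : (Fin m → ℝ) → ℝ) (s : Fin m → ℤ) :
    coef (c • f) s = c * coef f s := by
  simp only [coef]
  rw [← mean_mul_left]
  congr 1
  ext x
  simp only [Pi.smul_apply, smul_eq_mul, Complex.ofReal_mul]
  ring

theorem coef_const (c : ℝ) (s : Fin m → ℤ) :
    coef (fun _ => c) s = if s = 0 then (c : ℂ) else 0 := by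
  have h := mean_char (-s)
  simp only [coef, mul_comm _ (c : ℂ)]
  rw [mean_mul_left, h]
  simp

theorem coef_neg (f : (Fin m → ℝ) → ℝ) (s : Fin m → ℤ) :
    coef f (-s) = (starRingEnd ℂ) (coef f s) := by
  simp only [coef, mean, torusInt, Complex.real_smul, map_mul, Complex.conj_ofReal]
  rw [← integral_conj]
  simp [char_neg_toC]

theorem coef_eq_of_hasSum {f : (Fin m → ℝ) → ℝ} {a : (Fin m → ℤ) → ℂ}
    (ha : Summable fun s => ‖a s‖)
    (hs : ∀ x, HasSum (fun s => a s * char s (toC x)) (f x : ℂ)) (t : Fin m → ℤ) :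
    coef f t = a t := by
  have h1 := hasSum_mean (F := fun s x => char (-t) (toC x) * (a s * char s (toC x)))
    (f := fun x => char (-t) (toC x) * (f x : ℂ)) ha
    (fun s => by
      have h1 := continuous_charReal (m := m) (-t)
      have h2 := continuous_charReal (m := m) s
      fun_prop)
    (fun s x => by simp) (fun x => (hs x).mul_left _)
  have h2 : ∀ s, mean (fun x => char (-t) (toC x) * (a s * char s (toC x)))
      = if s = t then a t else 0 := by
    intro s
    have : (fun x : Fin m → ℝ => char (-t) (toC x) * (a s * char s (toC x)))
        = fun x => a s * char (-t + s) (toC x) := by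
      ext x; rw [char_add]; ring
    rw [this, mean_mul_left, mean_char]
    have h3 : -t + s = 0 ↔ s = t := by rw [neg_add_eq_zero, eq_comm]
    simp only [h3]
    split_ifs with h
    · rw [h, mul_one]
    · simp
  simp only [h2] at h1
  exact h1.unique (hasSum_ite_eq t (a t))

/-- Only `f` is expanded in its Fourier series, and the series is integrated term by term against
the bounded function `g`; so `g` needs no summability. -/
theorem hasSum_coef_mul {f g : (Fin m → ℝ) → ℝ} (hf : Continuous f) (hpf : Periodic f)
    (hsf : Summable fun s => ‖coef f s‖) (hg : Continuous g) {M : ℝ} (hM : ∀ x, |g x| ≤ M)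
    (s : Fin m → ℤ) :
    HasSum (fun t => coef f t * coef g (s - t)) (coef (f * g) s) := by
  have h1 := hasSum_mean
    (F := fun t x => coef f t * (char (-(s - t)) (toC x) * (g x : ℂ)))
    (f := fun x => char (-s) (toC x) * ((f * g) x : ℂ)) (hsf.mul_right M)
    (fun t => by
      have h2 := continuous_charReal (m := m) (-(s - t))
      fun_prop)
    (fun t x => by
      simp only [norm_mul, norm_char_toC, one_mul, Complex.norm_real]
      exact mul_le_mul_of_nonneg_left (hM x) (norm_nonneg _)) (fun x => by
        have h3 := (hasSum_coef hf hpf hsf.of_norm x).mul_left (char (-s) (toC x) * (g x : ℂ))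
        convert! h3 using 1
        · ext t
          rw [neg_sub, sub_eq_add_neg, char_add]; ring
        · simp; ring)
  simp only [mean_mul_left] at h1
  exact h1

/-! ### Analytic extensions and decay of Fourier coefficients -/

/-- The Fourier coefficients of `f` decay like `M e^{-r |s|}`. -/
def Decays (f : (Fin m → ℝ) → ℝ) (r M : ℝ) : Prop :=
  ∀ s, ‖coef f s‖ ≤ M * Real.exp (-(r * len s))

theorem norm_char_le_of_mem_strip {R : ℝ} {ξ : Fin m → ℂ} (hξ : ξ ∈ strip m R) (s : Fin m → ℤ) :
    ‖char s ξ‖ ≤ Real.exp (R * len s) := by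
  rw [norm_char, Real.exp_le_exp, len, Finset.mul_sum, ← Finset.sum_neg_distrib]
  refine Finset.sum_le_sum fun j _ => ?_
  calc -((s j : ℝ) * (ξ j).im) ≤ |(s j : ℝ) * (ξ j).im| := neg_le_abs _
    _ = |(ξ j).im| * |(s j : ℝ)| := by rw [abs_mul, mul_comm]
    _ ≤ R * |(s j : ℝ)| := by gcongr; exact (hξ j).le

theorem differentiable_char (s : Fin m → ℤ) : Differentiable ℂ (char s) := by
  unfold char; fun_prop

theorem isOpen_strip (R : ℝ) : IsOpen (strip m R) := by
  have : strip m R = ⋂ j, {ξ : Fin m → ℂ | |(ξ j).im| < R} := by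
    ext; simp [strip]
  rw [this]
  refine isOpen_iInter_of_finite fun j => isOpen_lt ?_ continuous_const
  fun_prop

theorem convex_strip (R : ℝ) : Convex ℝ (strip m R) := by
  intro x hx y hy a b ha hb hab j
  have h1 : ((a • x + b • y) j).im = a * (x j).im + b * (y j).im := by simp
  rw [h1]
  calc |a * (x j).im + b * (y j).im| ≤ a * |(x j).im| + b * |(y j).im| := by
        refine (abs_add_le _ _).trans ?_
        rw [abs_mul, abs_mul, abs_of_nonneg ha, abs_of_nonneg hb]
    _ < R := by
        have h1 := hx j
        have h2 := hy j
        have h3 : max |(x j).im| |(y j).im| < R := max_lt h1 h2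
        have h4 := mul_le_mul_of_nonneg_left (le_max_left |(x j).im| |(y j).im|) ha
        have h5 := mul_le_mul_of_nonneg_left (le_max_right |(x j).im| |(y j).im|) hb
        have h6 : a * max |(x j).im| |(y j).im| + b * max |(x j).im| |(y j).im|
            = max |(x j).im| |(y j).im| := by rw [← add_mul, hab, one_mul]
        linarith

theorem toC_mem_strip {R : ℝ} (hR : 0 < R) (x : Fin m → ℝ) : toC x ∈ strip m R := by
  intro j; simpa [toC] using hR

theorem toC_add_smul_mem_strip {R r : ℝ} {v : Fin m → ℝ} (hv : ∀ j, |v j| ≤ r) {z : ℂ}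
    (hz : |z.im| * r < R) (x : Fin m → ℝ) : toC x + z • toC v ∈ strip m R := by
  intro j
  have : ((toC x + z • toC v) j).im = z.im * v j := by simp [toC]
  rw [this, abs_mul]
  exact (mul_le_mul_of_nonneg_left (hv j) (abs_nonneg _)).trans_lt hz

/-! ### Shifting the torus of integration into the complex domain -/

section Shift
variable {R r B : ℝ} {G : (Fin m → ℂ) → ℂ} {v : Fin m → ℝ}

theorem differentiableAt_along (hG : DifferentiableOn ℂ G (strip m R)) (hv : ∀ j, |v j| ≤ r) {z : ℂ}
    (hz : |z.im| * r < R) (x : Fin m → ℝ) :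
    DifferentiableAt ℂ (fun z : ℂ => G (toC x + z • toC v)) z := by
  have h1 := (hG _ (toC_add_smul_mem_strip hv hz x)).differentiableAt
    ((isOpen_strip R).mem_nhds (toC_add_smul_mem_strip hv hz x))
  have h2 : DifferentiableAt ℂ (fun z : ℂ => toC x + z • toC v) z := by fun_prop
  exact DifferentiableAt.comp z h1 h2

theorem continuous_along (hG : DifferentiableOn ℂ G (strip m R)) (hv : ∀ j, |v j| ≤ r) {z : ℂ}
    (hz : |z.im| * r < R) : Continuous fun x : Fin m → ℝ => G (toC x + z • toC v) :=
  hG.continuousOn.comp_continuous (by have := continuous_toC (m := m); fun_prop)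
    (toC_add_smul_mem_strip hv hz)

theorem isOpen_im_mul_lt (r R : ℝ) : IsOpen {z : ℂ | |z.im| * r < R} :=
  isOpen_lt (by fun_prop) continuous_const

/-- The mean of a bounded holomorphic function along a shifted torus depends holomorphically on the
shift. -/
theorem differentiableAt_mean_along (hG : DifferentiableOn ℂ G (strip m R))
    (hB : ∀ ξ ∈ strip m R, ‖G ξ‖ ≤ B) (hv : ∀ j, |v j| ≤ r) {z : ℂ} (hz : |z.im| * r < R) :
    DifferentiableAt ℂ (fun z : ℂ => mean fun x => G (toC x + z • toC v)) z := by
  obtain ⟨δ, hδ, hball⟩ := Metric.isOpen_iff.1 (isOpen_im_mul_lt r R) z hz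
  set η := δ / 2 with hη
  have hη0 : 0 < η := by positivity
  have hin : ∀ w ∈ Metric.ball z η, |w.im| * r < R := fun w hw =>
    hball (Metric.ball_subset_ball (by rw [hη]; linarith) hw)
  set D : ℂ → (Fin m → ℝ) → ℂ := fun w x => deriv (fun z : ℂ => G (toC x + z • toC v)) w with hD
  have hd : ∀ w ∈ Metric.ball z η, ∀ x, HasDerivAt (fun z : ℂ => G (toC x + z • toC v)) (D w x) w :=
    fun w hw x => (differentiableAt_along hG hv (hin w hw) x).hasDerivAt
  -- Cauchy's estimate on discs of radius `η/2`, which stay in the admissible ball because `η + η/2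
  -- < δ`.
  have hb : ∀ w ∈ Metric.ball z η, ∀ x, ‖D w x‖ ≤ B / (η / 2) := by
    intro w hw x
    have hcl : ∀ u ∈ Metric.closedBall w (η / 2), |u.im| * r < R := by
      intro u hu
      apply hball
      rw [Metric.mem_ball] at hw ⊢
      rw [Metric.mem_closedBall] at hu
      have := dist_triangle u w z
      linarith
    refine Complex.norm_deriv_le_of_forall_mem_sphere_norm_le (by positivity) ?_ ?_
    · refine DifferentiableOn.diffContOnCl fun u hu => ?_
      rw [closure_ball _ (by positivity)] at hu
      exact (differentiableAt_along hG hv (hcl u hu) x).differentiableWithinAt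
    · intro u hu
      exact hB _ (toC_add_smul_mem_strip hv (hcl u (Metric.sphere_subset_closedBall hu)) x)
  -- `D z` is a pointwise limit of continuous difference quotients; the increments are real, so the
  -- imaginary part of the shift does not change.
  have hmeas : MeasureTheory.AEStronglyMeasurable (D z)
      (MeasureTheory.volume.restrict (Set.Icc (0 : Fin m → ℝ) fun _ => 2 * Real.pi)) := by
    have hz' := hd z (Metric.mem_ball_self hη0)
    set t : ℕ → ℂ := fun n => ((η / (n + 2) : ℝ) : ℂ) with ht
    have ht0 : ∀ n : ℕ, 0 < η / ((n : ℝ) + 2) := fun n => by positivity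
    have htend : Filter.Tendsto t Filter.atTop (nhdsWithin 0 {0}ᶜ) := by
      refine tendsto_nhdsWithin_iff.2 ⟨?_, Filter.Eventually.of_forall fun n => ?_⟩
      · rw [← Complex.ofReal_zero]
        refine (Complex.continuous_ofReal.tendsto 0).comp ?_
        refine Filter.Tendsto.div_atTop tendsto_const_nhds ?_
        exact Filter.tendsto_atTop_add_const_right _ _ tendsto_natCast_atTop_atTop
      · simpa only [ht, Set.mem_compl_iff, Set.mem_singleton_iff, Complex.ofReal_eq_zero]
          using (ht0 n).ne'
    refine aestronglyMeasurable_of_tendsto_ae Filter.atTop (f := fun n x =>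
      (t n)⁻¹ • (G (toC x + (z + t n) • toC v) - G (toC x + z • toC v))) (fun n => ?_)
      (Filter.Eventually.of_forall fun x => (hz' x).tendsto_slope_zero.comp htend)
    have h1 : |(z + t n).im| * r < R := by
      simpa only [ht, Complex.add_im, Complex.ofReal_im, add_zero] using hz
    have h2 := continuous_along hG hv h1
    have h3 := continuous_along hG hv hz
    exact ((h2.sub h3).const_smul (t n)⁻¹).aestronglyMeasurable
  have key := hasDerivAt_integral_of_dominated_loc_of_deriv_le
    (μ := MeasureTheory.volume.restrict (Set.Icc (0 : Fin m → ℝ) fun _ => 2 * Real.pi))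
    (F := fun w x => G (toC x + w • toC v)) (F' := D) (bound := fun _ => B / (η / 2))
    (Metric.ball_mem_nhds z hη0)
    (Filter.eventually_of_mem (Metric.ball_mem_nhds z hη0) fun w hw =>
      (continuous_along hG hv (hin w hw)).aestronglyMeasurable)
    (integrableOn_box (continuous_along hG hv hz)) hmeas
    (Filter.Eventually.of_forall fun x w hw => hb w hw x)
    (integrableOn_box continuous_const)
    (Filter.Eventually.of_forall fun x w hw => hd w hw x)
  exact key.2.differentiableAt.const_smul _

/-- Shift of the torus of integration. -/
theorem mean_shift (hG : DifferentiableOn ℂ G (strip m R)) (hB : ∀ ξ ∈ strip m R, ‖G ξ‖ ≤ B)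
    (hper : ∀ ξ ∈ strip m R, ∀ j, G (ξ + Pi.single j ((2 * Real.pi : ℝ) : ℂ)) = G ξ)
    (hv : ∀ j, |v j| ≤ r) (hr0 : 0 ≤ r) (hrR : r < R) :
    mean (fun x => G (toC x)) = mean fun x => G (toC x + Complex.I • toC v) := by
  set U : Set ℂ := {z | |z.im| * r < R} with hU
  set I : ℂ → ℂ := fun z => mean fun x => G (toC x + z • toC v) with hI
  have hdiff : ∀ z ∈ U, DifferentiableAt ℂ I z := fun z hz =>
    differentiableAt_mean_along hG hB hv hz
  -- A real increment of `z` only translates the torus. Hence the holomorphic function `I` has zero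
  -- derivative in the real direction, so it is constant.
  have htr : ∀ z ∈ U, ∀ t : ℝ, I (z + t) = I z := by
    intro z hz t
    have h1 := mean_translate (continuous_along hG hv hz) (fun x j => by
      have := hper _ (toC_add_smul_mem_strip hv hz x) j
      simp only
      rw [← this, toC_add, toC_single]
      congr 1; ring) (t • v)
    rw [hI]
    simp only
    rw [← h1]
    congr 1
    ext x
    congr 1
    ext j
    simp [toC]
    ring
  have hder : ∀ z ∈ U, deriv I z = 0 := by
    intro z hz
    have h1 : HasDerivAt (fun t : ℝ => I (z + t)) (deriv I z) 0 := by
      have h2 : HasDerivAt I (deriv I z) (z + ((0 : ℝ) : ℂ)) := by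
        simpa using (hdiff z hz).hasDerivAt
      have h3 : HasDerivAt (fun t : ℂ => z + t) 1 ((0 : ℝ) : ℂ) := by
        simpa using (hasDerivAt_id ((0 : ℝ) : ℂ)).const_add z
      simpa using (h2.comp _ h3).comp_ofReal
    have h2 : (fun t : ℝ => I (z + t)) = fun _ => I z := funext fun t => htr z hz t
    rw [h2] at h1
    exact h1.unique (hasDerivAt_const _ _)
  have hconv : IsPreconnected U := by
    have hc : Convex ℝ U := by
      intro x hx y hy a b ha hb hab
      simp only [hU, Set.mem_ofPred_eq] at hx hy ⊢
      have h1 : (a • x + b • y).im = a * x.im + b * y.im := by simp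
      rw [h1]
      have h2 : |a * x.im + b * y.im| ≤ a * |x.im| + b * |y.im| := by
        refine (abs_add_le _ _).trans ?_
        rw [abs_mul, abs_mul, abs_of_nonneg ha, abs_of_nonneg hb]
      have h3 : |a * x.im + b * y.im| * r ≤ a * (|x.im| * r) + b * (|y.im| * r) := by nlinarith
      rcases ha.eq_or_lt with h | h
      · have : b = 1 := by linarith
        subst this; rw [← h] at h3 ⊢; linarith
      · nlinarith
    exact hc.isPreconnected
  have hEq := (isOpen_im_mul_lt r R).is_const_of_deriv_eq_zero hconv
    (fun z hz => (hdiff z hz).differentiableWithinAt) (fun z hz => hder z hz)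
    (x := 0) (y := Complex.I) (by simp; linarith) (by simpa using hrR)
  simpa [hI] using hEq

end Shift

/-- Shift the torus by `i v` with `v j = -sign(s j) r`: there `e^{-i s·ξ}` has modulus exactly
`e^{-r len s}`, while `F` is still bounded by `M`. -/
theorem decays_of_extension {R r M : ℝ} {f : (Fin m → ℝ) → ℝ} {F : (Fin m → ℂ) → ℂ}
    (hF : IsExtension R f F) (hM : ∀ ξ ∈ strip m R, ‖F ξ‖ ≤ M) (hr0 : 0 ≤ r) (hrR : r < R) :
    Decays f r M := by
  intro s
  obtain ⟨sg, hsg⟩ : ∃ sg : Fin m → ℝ, ∀ j, |sg j| ≤ 1 ∧ sg j * (s j : ℝ) = |(s j : ℝ)| := by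
    refine ⟨fun j => SignType.sign (s j : ℝ), fun j => ⟨?_, sign_mul_self _⟩⟩
    beta_reduce
    rcases lt_trichotomy (s j : ℝ) 0 with h | h | h
    · rw [sign_neg h]; simp
    · rw [h]; simp
    · rw [sign_pos h]; simp
  set v : Fin m → ℝ := fun j => -sg j * r with hv
  have hvr : ∀ j, |v j| ≤ r := by
    intro j
    rw [hv]
    simp only [abs_mul, abs_neg, abs_of_nonneg hr0]
    exact mul_le_of_le_one_left hr0 (hsg j).1
  have h0 : coef f s = mean fun x => char (-s) (toC x) * F (toC x) := by
    rw [coef]; congr 1; ext x; rw [← hF.extends_real]; rfl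
  have hM0 : 0 ≤ M := (norm_nonneg _).trans (hM _ (toC_mem_strip (by linarith) 0))
  have hshift := mean_shift (G := fun ξ => char (-s) ξ * F ξ) (B := Real.exp (R * len s) * M)
    (v := v) (r := r) (R := R) ((differentiable_char _).differentiableOn.mul hF.holomorphic)
    (fun ξ hξ => by
      rw [norm_mul]
      have := norm_char_le_of_mem_strip hξ (-s)
      rw [len_neg] at this
      exact mul_le_mul this (hM ξ hξ) (norm_nonneg _) (Real.exp_pos _).le)
    (fun ξ hξ j => by
      rw [hF.periodic ξ hξ j, char_add_arg, char_single_two_pi, mul_one]) hvr hr0 hrR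
  rw [h0, hshift]
  refine norm_mean_le fun x => ?_
  have hmem : toC x + Complex.I • toC v ∈ strip m R :=
    toC_add_smul_mem_strip hvr (by simpa using hrR) x
  rw [norm_mul, mul_comm]
  refine mul_le_mul (hM _ hmem) (le_of_eq ?_) (norm_nonneg _) hM0
  rw [norm_char]
  congr 2
  rw [len, Finset.mul_sum]
  refine Finset.sum_congr rfl fun j _ => ?_
  simp only [Pi.add_apply, Pi.smul_apply, toC, hv, Pi.neg_apply]
  simp
  linear_combination r * (hsg j).2

/-! ### Synthesis of analytic functions from decaying coefficients -/

theorem summable_of_decay {a : (Fin m → ℤ) → ℂ} {r M : ℝ} (hr : 0 < r)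
    (ha : ∀ s, ‖a s‖ ≤ M * Real.exp (-(r * len s))) : Summable fun s => ‖a s‖ :=
  Summable.of_nonneg_of_le (fun _ => norm_nonneg _) ha ((summable_exp_len hr).mul_left M)

theorem exists_series {a : (Fin m → ℤ) → ℂ} (ha : Summable fun s => ‖a s‖)
    (hsym : ∀ s, a (-s) = (starRingEnd ℂ) (a s)) :
    ∃ f : (Fin m → ℝ) → ℝ, Continuous f ∧ Periodic f ∧ coef f = a := by
  have hs : ∀ x : Fin m → ℝ, Summable fun s => a s * char s (toC x) := fun x =>
    Summable.of_norm (by simpa using ha)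
  set f : (Fin m → ℝ) → ℝ := fun x => (∑' s, a s * char s (toC x)).re with hf
  -- Conjugation and the reindexing `s ↦ -s` show that the series is real.
  have hreal : ∀ x, ((f x : ℝ) : ℂ) = ∑' s, a s * char s (toC x) := by
    intro x
    rw [hf]
    refine Complex.conj_eq_iff_re.1 ?_
    rw [Complex.conj_tsum, ← (Equiv.neg (Fin m → ℤ)).tsum_eq]
    refine tsum_congr fun s => ?_
    simp only [Equiv.neg_apply, map_mul, hsym, char_neg_toC, Complex.conj_conj]
  refine ⟨f, ?_, ?_, ?_⟩
  · refine Complex.continuous_re.comp (continuous_tsum (u := fun s => ‖a s‖) (fun s => ?_) ha ?_)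
    · have := continuous_charReal s
      fun_prop
    · intro s x; simp
  · intro x j
    simp only [hf]
    congr 1
    refine tsum_congr fun s => ?_
    exact congrArg _ (periodic_char s x j)
  · ext s
    refine coef_eq_of_hasSum ha (fun x => ?_) s
    rw [hreal]
    exact (hs x).hasSum

/-- The linear form `v ↦ i s·v`. -/
def charForm (s : Fin m → ℤ) : (Fin m → ℂ) →L[ℂ] ℂ :=
  ∑ j, (Complex.I * (s j : ℂ)) • ContinuousLinearMap.proj (R := ℂ) (φ := fun _ : Fin m => ℂ) j

theorem charForm_apply (s : Fin m → ℤ) (v : Fin m → ℂ) :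
    charForm s v = Complex.I * ∑ j, (s j : ℂ) * v j := by
  simp [charForm, Finset.mul_sum, mul_assoc]

theorem norm_charForm_le (s : Fin m → ℤ) : ‖charForm s‖ ≤ len s := by
  refine ContinuousLinearMap.opNorm_le_bound _ (len_nonneg s) fun v => ?_
  rw [charForm_apply, norm_mul, Complex.norm_I, one_mul, len, Finset.sum_mul]
  refine (norm_sum_le _ _).trans (Finset.sum_le_sum fun j _ => ?_)
  rw [norm_mul, Complex.norm_intCast]
  exact mul_le_mul_of_nonneg_left (norm_le_pi_norm v j) (abs_nonneg _)

theorem hasFDerivAt_char (s : Fin m → ℤ) (ξ : Fin m → ℂ) :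
    HasFDerivAt (char s) (char s ξ • charForm s) ξ := by
  have h : HasFDerivAt (fun ξ : Fin m → ℂ => charForm s ξ) (charForm s) ξ :=
    (charForm s).hasFDerivAt
  have h2 := h.cexp
  have h3 : (fun ξ : Fin m → ℂ => Complex.exp (charForm s ξ)) = char s := by
    ext ξ; rw [charForm_apply]; rfl
  have h4 : Complex.exp (charForm s ξ) = char s ξ := congrFun h3 ξ
  rw [h3, h4] at h2
  exact h2

/-- On the strip of width `r'` a character is at most `e^{r' len s}`, and differentiation costs a
factor `len s`. Half of the gap `r - r'` absorbs that factor; the other half keeps the series of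
derivatives summable. -/
theorem hasFDerivAt_series {a : (Fin m → ℤ) → ℂ} {r r' M : ℝ} (hr' : 0 < r') (hr : r' < r)
    (ha : ∀ s, ‖a s‖ ≤ M * Real.exp (-(r * len s))) {ξ : Fin m → ℂ} (hξ : ξ ∈ strip m r') :
    HasFDerivAt (fun ξ => ∑' s, a s * char s ξ) (∑' s, a s • (char s ξ • charForm s)) ξ := by
  have hM : 0 ≤ M := by simpa using (norm_nonneg _).trans (ha 0)
  obtain ⟨K, hK0, hK⟩ := exists_pow_mul_exp_le 1 (show (r - r') / 2 < r - r' by linarith)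
  refine hasFDerivAt_tsum_of_isPreconnected (f := fun s ξ => a s * char s ξ)
    (f' := fun s ξ => a s • (char s ξ • charForm s))
    (((summable_exp_len (m := m) (show 0 < (r - r') / 2 by linarith)).mul_left K).mul_left M)
    (isOpen_strip r') (convex_strip r').isPreconnected
    (fun s x _ => (hasFDerivAt_char s x).const_mul (a s)) (fun s x hx => ?_)
    (toC_mem_strip hr' 0) ?_ hξ
  · rw [norm_smul, norm_smul]
    have h1 := norm_char_le_of_mem_strip hx s
    calc ‖a s‖ * (‖char s x‖ * ‖charForm s‖)
        ≤ (M * Real.exp (-(r * len s))) * (Real.exp (r' * len s) * (1 + len s) ^ 1) := by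
          have := norm_charForm_le s
          have := len_nonneg s
          gcongr
          · exact ha s
          · linarith
      _ = M * ((1 + len s) ^ 1 * Real.exp (-((r - r') * len s))) := by
          rw [show -((r - r') * len s) = -(r * len s) + r' * len s by ring, Real.exp_add]; ring
      _ ≤ _ := mul_le_mul_of_nonneg_left (hK _ (len_nonneg s)) hM
  · refine Summable.of_norm ?_
    simpa using summable_of_decay (by linarith) ha

theorem Decays.exists_extension {f : (Fin m → ℝ) → ℝ} (hf : Continuous f) (hp : Periodic f)
    {r r' M : ℝ} (hr' : 0 < r') (hr : r' < r) (hd : Decays f r M) :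
    ∃ F, IsExtension r' f F ∧ ∃ B, ∀ ξ ∈ strip m r', ‖F ξ‖ ≤ B := by
  have hs : Summable fun s => ‖coef f s‖ := summable_of_decay (by linarith) hd
  refine ⟨fun ξ => ∑' s, coef f s * char s ξ, ⟨?_, ?_, ?_⟩,
    ∑' s : Fin m → ℤ, M * Real.exp (-((r - r') * len s)), ?_⟩
  · exact fun ξ hξ => (hasFDerivAt_series hr' hr hd hξ).differentiableAt.differentiableWithinAt
  · intro ξ _ j
    exact tsum_congr fun s => by rw [char_add_arg, char_single_two_pi, mul_one]
  · exact fun x => (hasSum_coef hf hp hs.of_norm x).tsum_eq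
  · intro ξ hξ
    refine tsum_of_norm_bounded
      ((summable_exp_len (m := m) (show 0 < r - r' by linarith)).mul_left M).hasSum fun s => ?_
    rw [norm_mul]
    calc ‖coef f s‖ * ‖char s ξ‖ ≤ (M * Real.exp (-(r * len s))) * Real.exp (r' * len s) := by
          gcongr
          · exact (norm_nonneg _).trans (hd s)
          · exact hd s
          · exact norm_char_le_of_mem_strip hξ s
      _ = _ := by rw [mul_assoc, ← Real.exp_add]; ring_nf

/-! ### The algebra of real-analytic functions on the torus -/

/-- The coefficients of a product are a convolution. By the triangle inequality `r len t + r len (s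
- t) ≥ (r - r') len t + r' len s`: the first part sums over `t`, the second is the decay in `s`. -/
theorem Decays.mul {f g : (Fin m → ℝ) → ℝ} (hf : Continuous f) (hpf : Periodic f)
    (hg : Continuous g) (hpg : Periodic g) {r r' M N : ℝ} (hr' : 0 ≤ r') (hr : r' < r)
    (hdf : Decays f r M) (hdg : Decays g r N) :
    Decays (f * g) r' (M * N * ∑' s : Fin m → ℤ, Real.exp (-((r - r') * len s))) := by
  intro s
  have hsf : Summable fun s => ‖coef f s‖ := summable_of_decay (by linarith) hdf
  have hsg : Summable fun s => ‖coef g s‖ := summable_of_decay (by linarith) hdg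
  have hM : 0 ≤ M := by simpa using (norm_nonneg _).trans (hdf 0)
  have hN : 0 ≤ N := by simpa using (norm_nonneg _).trans (hdg 0)
  have hgb : ∀ x, |g x| ≤ ∑' s, ‖coef g s‖ := by
    intro x
    have := (hasSum_coef hg hpg hsg.of_norm x)
    rw [← Real.norm_eq_abs, ← Complex.norm_real, ← this.tsum_eq]
    exact tsum_of_norm_bounded hsg.hasSum fun s => by simp
  have h1 := hasSum_coef_mul hf hpf hsf hg hgb s
  rw [← h1.tsum_eq]
  have h2 := ((summable_exp_len (m := m) (show 0 < r - r' by linarith)).hasSum.mul_left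
    (M * N)).mul_right (Real.exp (-(r' * len s)))
  refine tsum_of_norm_bounded h2 fun t => ?_
  rw [norm_mul]
  calc ‖coef f t‖ * ‖coef g (s - t)‖
      ≤ (M * Real.exp (-(r * len t))) * (N * Real.exp (-(r * len (s - t)))) := by
        gcongr
        · exact hdf t
        · exact hdg _
    _ = M * N * Real.exp (-(r * len t) + -(r * len (s - t))) := by rw [Real.exp_add]; ring
    _ ≤ M * N * Real.exp (-((r - r') * len t) + -(r' * len s)) := by
        have h3 := len_add_le t (s - t)
        rw [add_sub_cancel] at h3
        have h4 := len_nonneg (s - t)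
        have : -(r * len t) + -(r * len (s - t)) ≤ -((r - r') * len t) + -(r' * len s) := by
          nlinarith
        gcongr
    _ = _ := by rw [Real.exp_add]; ring

theorem Decays.mono {f : (Fin m → ℝ) → ℝ} {r r' M M' : ℝ} (h : Decays f r M) (hr : r' ≤ r)
    (hM : M ≤ M') : Decays f r' M' := by
  intro s
  have hM0 : 0 ≤ M := by simpa using (norm_nonneg _).trans (h 0)
  refine (h s).trans ?_
  have := len_nonneg s
  have hM' : 0 ≤ M' := hM0.trans hM
  gcongr

theorem Decays.add {f g : (Fin m → ℝ) → ℝ} (hf : Continuous f) (hg : Continuous g) {r M N : ℝ}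
    (hdf : Decays f r M) (hdg : Decays g r N) : Decays (f + g) r (M + N) := by
  intro s
  rw [coef_add hf hg, add_mul]
  exact (norm_add_le _ _).trans (add_le_add (hdf s) (hdg s))

theorem decays_const (c r : ℝ) : Decays (fun _ : Fin m → ℝ => c) r |c| := by
  intro s
  rw [coef_const]
  split_ifs with h
  · subst h; simp
  · simp only [norm_zero]; positivity

/-- The algebra of real-analytic functions on the torus. -/
def analyticAlg (m : ℕ) : Subalgebra ℝ ((Fin m → ℝ) → ℝ) where
  carrier := {f | Continuous f ∧ Periodic f ∧ ∃ r M, 0 < r ∧ Decays f r M}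
  mul_mem' := by
    rintro f g ⟨hf, hpf, r, M, hr, hdf⟩ ⟨hg, hpg, r', M', hr', hdg⟩
    refine ⟨hf.mul hg, fun x j => by simp only [Pi.mul_apply, hpf x j, hpg x j],
      min r r' / 2, _, by positivity, Decays.mul (r := min r r') hf hpf hg hpg (by positivity)
        (half_lt_self (by positivity)) (hdf.mono (min_le_left _ _) le_rfl)
        (hdg.mono (min_le_right _ _) le_rfl)⟩
  add_mem' := by
    rintro f g ⟨hf, hpf, r, M, hr, hdf⟩ ⟨hg, hpg, r', M', hr', hdg⟩
    exact ⟨hf.add hg, fun x j => by simp only [Pi.add_apply, hpf x j, hpg x j],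
      min r r', _, by positivity, (hdf.mono (min_le_left _ _) le_rfl).add hf hg
      (hdg.mono (min_le_right _ _) le_rfl)⟩
  algebraMap_mem' c := ⟨continuous_const, fun _ _ => rfl, 1, |c|, one_pos, decays_const c 1⟩

/-- Real-analytic functions on the torus. -/
abbrev TA (m : ℕ) : Type := analyticAlg m

namespace TA

/-- Fourier coefficients of an analytic function. -/
def cf (f : TA m) (s : Fin m → ℤ) : ℂ := coef f.1 s

theorem continuous (f : TA m) : Continuous f.1 := f.2.1
theorem periodic (f : TA m) : Periodic f.1 := f.2.2.1
theorem exists_decays (f : TA m) : ∃ r M, 0 < r ∧ Decays f.1 r M := f.2.2.2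

theorem summable_cf (f : TA m) : Summable fun s => ‖cf f s‖ := by
  obtain ⟨r, M, hr, h⟩ := f.exists_decays
  exact summable_of_decay hr h

theorem hasSum_cf (f : TA m) (x : Fin m → ℝ) :
    HasSum (fun s => cf f s * char s (toC x)) (f.1 x : ℂ) :=
  hasSum_coef f.continuous f.periodic f.summable_cf.of_norm x

theorem ext_cf {f g : TA m} (h : ∀ s, cf f s = cf g s) : f = g := by
  ext x
  have h1 := f.hasSum_cf x
  simp only [h] at h1
  exact_mod_cast h1.unique (g.hasSum_cf x)

@[simp] theorem cf_add (f g : TA m) (s : Fin m → ℤ) : cf (f + g) s = cf f s + cf g s :=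
  coef_add f.continuous g.continuous s

@[simp] theorem cf_smul (c : ℝ) (f : TA m) (s : Fin m → ℤ) : cf (c • f) s = c * cf f s :=
  coef_smul c f.1 s

@[simp] theorem cf_neg_fun (f : TA m) (s : Fin m → ℤ) : cf (-f) s = -cf f s := by
  rw [← neg_one_smul ℝ f, cf_smul]; simp

@[simp] theorem cf_sub (f g : TA m) (s : Fin m → ℤ) : cf (f - g) s = cf f s - cf g s := by
  rw [sub_eq_add_neg, cf_add, cf_neg_fun, sub_eq_add_neg]

theorem cf_algebraMap (c : ℝ) (s : Fin m → ℤ) :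
    cf (algebraMap ℝ (TA m) c) s = if s = 0 then (c : ℂ) else 0 := coef_const c s

theorem cf_neg (f : TA m) (s : Fin m → ℤ) : cf f (-s) = (starRingEnd ℂ) (cf f s) := coef_neg _ s

theorem hasSum_cf_mul (f g : TA m) (s : Fin m → ℤ) :
    HasSum (fun t => cf f t * cf g (s - t)) (cf (f * g) s) := by
  refine hasSum_coef_mul f.continuous f.periodic f.summable_cf g.continuous
    (M := ∑' s, ‖cf g s‖) (fun x => ?_) s
  rw [← Real.norm_eq_abs, ← Complex.norm_real, ← (g.hasSum_cf x).tsum_eq]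
  exact tsum_of_norm_bounded g.summable_cf.hasSum fun s => by simp

/-- The mean value as a linear form. -/
def mn : TA m →ₗ[ℝ] ℝ where
  toFun f := mean f.1
  map_add' f g := mean_add f.continuous g.continuous
  map_smul' c f := mean_smul c f.1

theorem mn_def (f : TA m) : mn f = mean f.1 := rfl

theorem cf_zero (f : TA m) : cf f 0 = (mn f : ℂ) := coef_zero_eq_mean f.1

@[simp] theorem mn_algebraMap (c : ℝ) : mn (algebraMap ℝ (TA m) c) = c := mean_const c

theorem exists_of_decay {a : (Fin m → ℤ) → ℂ} {r M : ℝ} (hr : 0 < r)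
    (ha : ∀ s, ‖a s‖ ≤ M * Real.exp (-(r * len s)))
    (hsym : ∀ s, a (-s) = (starRingEnd ℂ) (a s)) : ∃ f : TA m, ∀ s, cf f s = a s := by
  obtain ⟨f, h1, h2, h3⟩ := exists_series (summable_of_decay hr ha) hsym
  refine ⟨⟨f, h1, h2, r, M, hr, fun s => ?_⟩, fun s => congrFun h3 s⟩
  rw [h3]; exact ha s

end TA

/-- Symbols of Fourier multipliers: polynomially bounded, and real in the sense
`φ(-s) = conj φ(s)`. -/
structure Symb (m : ℕ) where
  toFun : (Fin m → ℤ) → ℂ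
  sym : ∀ s, toFun (-s) = (starRingEnd ℂ) (toFun s)
  bdd : ∃ K : ℝ, ∃ τ : ℕ, ∀ s, ‖toFun s‖ ≤ K * (1 + len s) ^ τ

/-! ### Fourier multipliers on analytic functions -/

namespace TA

/-- The constant is chosen before the symbol and the function; this is what permits families of
symbols, such as the resolvents for varying `k`. -/
theorem exists_mult_decay (K : ℝ) (τ : ℕ) {r r' : ℝ} (h : r' < r) :
    ∃ K' : ℝ, ∀ (φ : (Fin m → ℤ) → ℂ) (M : ℝ) (a : (Fin m → ℤ) → ℂ),
      (∀ s, ‖φ s‖ ≤ K * (1 + len s) ^ τ) → (∀ s, ‖a s‖ ≤ M * Real.exp (-(r * len s))) →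
      ∀ s, ‖φ s * a s‖ ≤ K' * M * Real.exp (-(r' * len s)) := by
  obtain ⟨C, hC0, hC⟩ := exists_pow_mul_exp_le τ h
  refine ⟨K * C, fun φ M a hφ ha s => ?_⟩
  have hM : 0 ≤ M := by simpa using (norm_nonneg _).trans (ha 0)
  have hK : 0 ≤ K := by simpa using (norm_nonneg _).trans (hφ 0)
  have hl := len_nonneg s
  rw [norm_mul]
  calc ‖φ s‖ * ‖a s‖ ≤ (K * (1 + len s) ^ τ) * (M * Real.exp (-(r * len s))) := by
        gcongr
        · exact hφ s
        · exact ha s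
    _ = K * M * ((1 + len s) ^ τ * Real.exp (-(r * len s))) := by ring
    _ ≤ K * M * (C * Real.exp (-(r' * len s))) := by exact mul_le_mul_of_nonneg_left (hC _ hl) (by positivity)
    _ = _ := by ring

theorem exists_mult (φ : Symb m) (f : TA m) : ∃ g : TA m, ∀ s, cf g s = φ.toFun s * cf f s := by
  obtain ⟨r, M, hr, h⟩ := f.exists_decays
  obtain ⟨K, τ, hK⟩ := φ.bdd
  obtain ⟨K', hK'⟩ := exists_mult_decay (m := m) K τ (half_lt_self hr)
  refine exists_of_decay (half_pos hr) (hK' _ M _ hK h) fun s => ?_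
  rw [map_mul, φ.sym, cf_neg]

/-- The Fourier multiplier with symbol `φ`. -/
def mult (φ : Symb m) : TA m →ₗ[ℝ] TA m where
  toFun f := (exists_mult φ f).choose
  map_add' f g := ext_cf fun s => by
    rw [cf_add, (exists_mult φ _).choose_spec, (exists_mult φ _).choose_spec,
      (exists_mult φ _).choose_spec, cf_add, mul_add]
  map_smul' c f := ext_cf fun s => by
    rw [RingHom.id_apply, cf_smul, (exists_mult φ _).choose_spec, (exists_mult φ _).choose_spec,
      cf_smul]
    ring

@[simp] theorem cf_mult (φ : Symb m) (f : TA m) (s : Fin m → ℤ) :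
    cf (mult φ f) s = φ.toFun s * cf f s := (exists_mult φ f).choose_spec s

end TA

/-- The symbol of the derivative in the direction `v`. -/
def dirSymb (v : Fin m → ℝ) : Symb m where
  toFun s := Complex.I * ((∑ j, v j * (s j : ℝ) : ℝ) : ℂ)
  sym s := by
    simp only [map_mul, Complex.conj_I, Complex.conj_ofReal, Pi.neg_apply, Int.cast_neg, mul_neg,
      Finset.sum_neg_distrib, Complex.ofReal_neg, neg_mul]
  bdd := by
    refine ⟨‖v‖, 1, fun s => ?_⟩
    rw [norm_mul, Complex.norm_I, one_mul, Complex.norm_real]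
    have : ‖∑ j, v j * (s j : ℝ)‖ ≤ ‖v‖ * len s := by
      rw [len, Finset.mul_sum]
      refine (norm_sum_le _ _).trans (Finset.sum_le_sum fun j _ => ?_)
      rw [norm_mul]
      exact mul_le_mul_of_nonneg_right (norm_le_pi_norm v j) (norm_nonneg _)
    refine this.trans ?_
    rw [pow_one]
    gcongr
    linarith

/-! ### Directional derivatives -/

namespace TA

/-- The derivative in the direction `v`. -/
def pd (v : Fin m → ℝ) : TA m →ₗ[ℝ] TA m := mult (dirSymb v)

/-- The complex Fourier series is differentiated term by term and restricted to real vectors. This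
identifies the multiplier `pd v` with the actual derivative. -/
theorem hasFDerivAt (f : TA m) (x : Fin m → ℝ) :
    ∃ L : (Fin m → ℝ) →L[ℝ] ℝ, HasFDerivAt f.1 L x ∧ ∀ v, L v = (pd v f).1 x := by
  obtain ⟨r, M, hr, hd⟩ := f.exists_decays
  have h1 := hasFDerivAt_series (half_pos hr) (half_lt_self hr) hd
    (toC_mem_strip (half_pos hr) x)
  have h1' := h1.restrictScalars ℝ
  set T : (Fin m → ℝ) →L[ℝ] (Fin m → ℂ) :=
    ContinuousLinearMap.pi fun j =>
      Complex.ofRealCLM.comp (ContinuousLinearMap.proj (R := ℝ) (φ := fun _ : Fin m => ℝ) j) with hT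
  have hTx : ∀ y, T y = toC y := fun y => rfl
  have h2 := HasFDerivAt.comp x (f := T) (by rw [hTx]; exact h1') T.hasFDerivAt
  have h3 := Complex.reCLM.hasFDerivAt.comp x h2
  have hfun : (Complex.reCLM ∘ (fun ξ => ∑' s, coef f.1 s * char s ξ) ∘ T) = f.1 := by
    ext y
    simp only [Function.comp, hTx]
    have := (f.hasSum_cf y).tsum_eq
    simp only [cf] at this
    rw [this]; simp
  rw [hfun] at h3
  refine ⟨_, h3, fun v => ?_⟩
  have hsum : Summable fun s : Fin m → ℤ => coef f.1 s • (char s (toC x) • charForm s) := by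
    obtain ⟨K', hK'⟩ := exists_mult_decay (m := m) 1 1 (half_lt_self hr)
    refine Summable.of_norm (Summable.of_nonneg_of_le (fun _ => norm_nonneg _) (fun s => ?_)
      (summable_of_decay (half_pos hr) (hK' (fun s => ((len s : ℝ) : ℂ)) M _ (fun s => ?_) hd)))
    · rw [norm_smul, norm_smul, norm_mul, norm_char_toC, one_mul, Complex.norm_real,
        Real.norm_of_nonneg (len_nonneg s), mul_comm]
      exact mul_le_mul_of_nonneg_right (norm_charForm_le s) (norm_nonneg _)
    · rw [Complex.norm_real, Real.norm_of_nonneg (len_nonneg s)]; linarith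
  have h4 : (∑' s : Fin m → ℤ, coef f.1 s • (char s (toC x) • charForm s)) (toC v)
      = ((pd v f).1 x : ℂ) := by
    rw [← ((pd v f).hasSum_cf x).tsum_eq]
    have := (ContinuousLinearMap.apply ℂ ℂ (toC v)).map_tsum hsum
    simp only [ContinuousLinearMap.apply_apply] at this
    rw [this]
    refine tsum_congr fun s => ?_
    rw [pd, cf_mult]
    simp only [_root_.smul_apply, smul_eq_mul, charForm_apply, dirSymb, cf, toC]
    push_cast
    simp only [mul_comm (v _ : ℂ)]
    ring
  simp only [ContinuousLinearMap.comp_apply, ContinuousLinearMap.coe_restrictScalars', hTx, h4,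
    Complex.reCLM_apply, Complex.ofReal_re]

theorem fderiv_apply (f : TA m) (x v : Fin m → ℝ) : fderiv ℝ f.1 x v = (pd v f).1 x := by
  obtain ⟨L, h1, h2⟩ := f.hasFDerivAt x
  rw [h1.fderiv, h2]

theorem differentiableAt (f : TA m) (x : Fin m → ℝ) : DifferentiableAt ℝ f.1 x := by
  obtain ⟨L, h1, _⟩ := f.hasFDerivAt x
  exact h1.differentiableAt

end TA

/-! ### The analytic norm -/

theorem norm_le_of_stripNorm_le {R M : ℝ} {d : ℕ} {F : (Fin m → ℂ) → ℂ} (hM : 0 ≤ M)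
    (h : stripNorm R d F ≤ ENNReal.ofReal M) : ∀ ξ ∈ strip m R, ‖F ξ‖ ≤ M := by
  intro ξ hξ
  have h1 : ‖F ξ‖ₑ ≤ stripNorm R d F := by
    have : ‖F ξ‖ₑ = ‖iteratedFDeriv ℂ 0 F ξ
        (fun i => Pi.single ((Fin.elim0 : Fin 0 → Fin m) i) 1)‖ₑ := by
      rw [iteratedFDeriv_zero_apply]
    rw [this, stripNorm]
    exact le_iSup₂_of_le 0 (Nat.zero_le _) (le_iSup_of_le Fin.elim0 (le_iSup₂_of_le ξ hξ le_rfl))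
  have h2 := h1.trans h
  rwa [← ofReal_norm, ENNReal.ofReal_le_ofReal_iff hM] at h2

theorem stripNorm_zero_le {R M : ℝ} {F : (Fin m → ℂ) → ℂ} (h : ∀ ξ ∈ strip m R, ‖F ξ‖ ≤ M) :
    stripNorm R 0 F ≤ ENNReal.ofReal M := by
  refine iSup₂_le fun l hl => iSup_le fun j => iSup₂_le fun ξ hξ => ?_
  obtain rfl : l = 0 := by omega
  rw [iteratedFDeriv_zero_apply, ← ofReal_norm]
  exact ENNReal.ofReal_le_ofReal (h ξ hξ)

theorem exists_extension_of_anNorm_lt {R M : ℝ} {d : ℕ} {f : (Fin m → ℝ) → ℝ} (hM : 0 ≤ M)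
    (h : anNorm R d f < ENNReal.ofReal M) :
    ∃ F, IsExtension R f F ∧ ∀ ξ ∈ strip m R, ‖F ξ‖ ≤ M := by
  simp only [anNorm, iInf_lt_iff] at h
  obtain ⟨F, hF, hlt⟩ := h
  exact ⟨F, hF, norm_le_of_stripNorm_le hM hlt.le⟩

theorem continuous_of_extension {R : ℝ} (hR : 0 < R) {f : (Fin m → ℝ) → ℝ} {F : (Fin m → ℂ) → ℂ}
    (hF : IsExtension R f F) : Continuous f := by
  have h1 : f = fun x => (F (toC x)).re := by
    ext x
    have := hF.extends_real x
    change F (toC x) = _ at this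
    rw [this]; simp
  rw [h1]
  exact Complex.continuous_re.comp
    (hF.holomorphic.continuousOn.comp_continuous continuous_toC (toC_mem_strip hR))

theorem periodic_of_extension {R : ℝ} (hR : 0 < R) {f : (Fin m → ℝ) → ℝ} {F : (Fin m → ℂ) → ℂ}
    (hF : IsExtension R f F) : Periodic f := by
  intro x j
  have h1 := hF.extends_real (x + Pi.single j (2 * Real.pi))
  have h2 := hF.periodic _ (toC_mem_strip hR x) j
  change F (toC _) = _ at h1
  rw [toC_add, toC_single, h2] at h1
  have h3 := hF.extends_real x
  change F (toC _) = _ at h3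
  rw [h3] at h1
  exact_mod_cast h1.symm

/-- The norm is an infimum, so an extension is only at hand with bound `M + δ`; the estimate for the
coefficients survives `δ → 0`. -/
theorem decays_of_anNorm_le {R r M : ℝ} {d : ℕ} {f : (Fin m → ℝ) → ℝ} (hM : 0 ≤ M)
    (h : anNorm R d f ≤ ENNReal.ofReal M) (hr0 : 0 ≤ r) (hr : r < R) : Decays f r M := by
  intro s
  refine le_of_forall_pos_le_add fun δ hδ => ?_
  have h1 : anNorm R d f < ENNReal.ofReal (M + δ) :=
    h.trans_lt ((ENNReal.ofReal_lt_ofReal_iff (by linarith)).2 (by linarith))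
  obtain ⟨F, hF, hb⟩ := exists_extension_of_anNorm_lt (by linarith) h1
  refine (decays_of_extension hF hb hr0 hr s).trans ?_
  rw [add_mul]
  have h2 : Real.exp (-(r * len s)) ≤ 1 := by
    rw [Real.exp_le_one_iff]
    have := mul_nonneg hr0 (len_nonneg s)
    linarith
  have h3 := mul_le_mul_of_nonneg_left h2 hδ.le
  linarith

theorem mem_TA_of_anNorm_lt_top {R : ℝ} {d : ℕ} (hR : 0 < R) {f : (Fin m → ℝ) → ℝ}
    (h : anNorm R d f < ⊤) : f ∈ analyticAlg m := by
  have h0 : anNorm R d f ≤ ENNReal.ofReal (anNorm R d f).toReal := (ENNReal.ofReal_toReal h.ne).ge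
  obtain ⟨F, hF, -⟩ := exists_extension_of_anNorm_lt (M := (anNorm R d f).toReal + 1)
    (by positivity) (h0.trans_lt ((ENNReal.ofReal_lt_ofReal_iff (by positivity)).2 (by linarith)))
  exact ⟨continuous_of_extension hR hF, periodic_of_extension hR hF, R / 2, _, half_pos hR,
    decays_of_anNorm_le ENNReal.toReal_nonneg h0 (half_pos hR).le (half_lt_self hR)⟩

theorem anNorm_lt_top_of_decays (f : TA m) {r r' M : ℝ} (hr' : 0 < r') (hr : r' < r)
    (hd : Decays f.1 r M) : anNorm r' 0 f.1 < ⊤ := by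
  obtain ⟨F, hF, B, hB⟩ := hd.exists_extension f.continuous f.periodic hr' hr
  exact (iInf₂_le F hF).trans_lt ((stripNorm_zero_le hB).trans_lt ENNReal.ofReal_lt_top)

namespace TA

/-! ### Pairings -/

theorem hasSum_mn_mul (f g : TA m) :
    HasSum (fun t => cf f t * cf g (-t)) ((mn (f * g) : ℝ) : ℂ) := by
  have := hasSum_cf_mul f g 0
  simpa only [zero_sub, cf_zero] using this

theorem mn_mul_mult {φ ψ : Symb m} (h : ∀ s, φ.toFun (-s) = ψ.toFun s) (f g : TA m) :
    mn (f * mult φ g) = mn (mult ψ f * g) := by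
  have h1 := hasSum_mn_mul f (mult φ g)
  have h2 := hasSum_mn_mul (mult ψ f) g
  simp only [cf_mult, h] at h1 h2
  have h3 : (fun t => cf f t * (ψ.toFun t * cf g (-t)))
      = fun t => ψ.toFun t * cf f t * cf g (-t) := by ext t; ring
  rw [h3] at h1
  exact_mod_cast h1.unique h2

theorem hasSum_mn_quad {φ : Symb m} {ρ : (Fin m → ℤ) → ℝ} (h : ∀ s, φ.toFun s = (ρ s : ℂ))
    (f : TA m) : HasSum (fun s => ρ s * ‖cf f s‖ ^ 2) (mn (f * mult φ f)) := by
  have h1 := hasSum_mn_mul f (mult φ f)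
  have h2 : (fun t => cf f t * cf (mult φ f) (-t))
      = fun t => ((ρ t * ‖cf f t‖ ^ 2 : ℝ) : ℂ) := by
    ext t
    rw [cf_mult, cf_neg, φ.sym, h, Complex.conj_ofReal]
    push_cast
    rw [← Complex.mul_conj']
    ring
  rw [h2] at h1
  exact_mod_cast h1

theorem hasSum_mn_sq (f : TA m) : HasSum (fun s => ‖cf f s‖ ^ 2) (mn (f * f)) := by
  have h1 := hasSum_mn_mul f f
  have h2 : (fun t => cf f t * cf f (-t)) = fun t => ((‖cf f t‖ ^ 2 : ℝ) : ℂ) := by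
    ext t
    rw [cf_neg, Complex.mul_conj']
    push_cast; rfl
  rw [h2] at h1
  exact_mod_cast h1

theorem mn_mono {f g : TA m} (h : ∀ x, f.1 x ≤ g.1 x) : mn f ≤ mn g := by
  simp only [mn_def, mean, torusInt, smul_eq_mul]
  refine mul_le_mul_of_nonneg_left ?_ (by positivity)
  exact MeasureTheory.setIntegral_mono (integrableOn_box f.continuous)
    (integrableOn_box g.continuous) h

theorem mn_sq_nonneg (f : TA m) : 0 ≤ mn (f * f) :=
  (hasSum_mn_sq f).nonneg fun _ => by positivity

theorem torusInt_eq (f : TA m) : torusInt f.1 = (2 * Real.pi) ^ m * mn f := by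
  simp only [mn_def, mean, smul_eq_mul]
  rw [← mul_assoc, mul_inv_cancel₀ (by positivity), one_mul]

/-! ### Uniform estimates for families of analytic functions -/

section UO
variable {I I' : Type*}

/-- The functions `f i` are `O(δ i)`, uniformly in `i`, on some fixed complex strip. -/
def UO (f : I → TA m) (δ : I → ℝ) : Prop :=
  ∃ r, 0 < r ∧ ∃ c, 0 ≤ c ∧ ∀ i, Decays (f i).1 r (c * |δ i|)

variable {f g : I → TA m} {δ δ' : I → ℝ}

/-- Along the filter `⊤`, a big-O relation is an inequality at every index with one constant. This
encodes uniformity in the whole family. -/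
theorem isBigO_top_of_le {a b : I → ℝ} (c : ℝ) (h : ∀ i, |a i| ≤ c * |b i|) : a =O[⊤] b :=
  Asymptotics.isBigO_top.2 ⟨c, h⟩

theorem exists_of_isBigO_top {a b : I → ℝ} (h : a =O[⊤] b) :
    ∃ c, 0 ≤ c ∧ ∀ i, |a i| ≤ c * |b i| := by
  obtain ⟨c, hc⟩ := Asymptotics.isBigO_top.1 h
  refine ⟨|c|, abs_nonneg c, fun i => (hc i).trans ?_⟩
  exact mul_le_mul_of_nonneg_right (le_abs_self c) (norm_nonneg _)

theorem UO.mono (hf : UO f δ) (h : δ =O[⊤] δ') : UO f δ' := by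
  obtain ⟨r, hr, c, hc, hd⟩ := hf
  obtain ⟨c', hc', h'⟩ := exists_of_isBigO_top h
  refine ⟨r, hr, c * c', by positivity, fun i => (hd i).mono le_rfl ?_⟩
  rw [mul_assoc]
  exact mul_le_mul_of_nonneg_left (h' i) hc

theorem UO.comp (hf : UO f δ) (π : I' → I) : UO (fun i => f (π i)) (fun i => δ (π i)) := by
  obtain ⟨r, hr, c, hc, hd⟩ := hf
  exact ⟨r, hr, c, hc, fun i => hd (π i)⟩

theorem UO.add (hf : UO f δ) (hg : UO g δ) : UO (fun i => f i + g i) δ := by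
  obtain ⟨r, hr, c, hc, hd⟩ := hf
  obtain ⟨r', hr', c', hc', hd'⟩ := hg
  refine ⟨min r r', by positivity, c + c', by positivity, fun i => ?_⟩
  rw [add_mul]
  exact ((hd i).mono (min_le_left _ _) le_rfl).add (f i).continuous (g i).continuous
    ((hd' i).mono (min_le_right _ _) le_rfl)

theorem UO.neg (hf : UO f δ) : UO (fun i => -f i) δ := by
  obtain ⟨r, hr, c, hc, hd⟩ := hf
  refine ⟨r, hr, c, hc, fun i s => ?_⟩
  have h := cf_neg_fun (f i) s
  simp only [cf] at h
  rw [h, norm_neg]; exact hd i s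

theorem UO.sub (hf : UO f δ) (hg : UO g δ) : UO (fun i => f i - g i) δ := by
  simpa only [sub_eq_add_neg] using hf.add hg.neg

theorem UO.zero : UO (fun _ : I => (0 : TA m)) δ := by
  refine ⟨1, one_pos, 0, le_rfl, fun i s => ?_⟩
  have h := cf_smul (0 : ℝ) (0 : TA m) s
  rw [zero_smul] at h
  simp only [cf] at h
  rw [h]; simp

theorem UO.sum {ι : Type*} (S : Finset ι) {F : ι → I → TA m} (h : ∀ j ∈ S, UO (F j) δ) :
    UO (fun i => ∑ j ∈ S, F j i) δ := by
  classical
  induction S using Finset.induction_on with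
  | empty => simpa using UO.zero
  | insert a S ha ih =>
    simp only [Finset.sum_insert ha]
    exact (h a (by simp)).add (ih fun j hj => h j (by simp [hj]))

theorem UO.mul (hf : UO f δ) (hg : UO g δ') : UO (fun i => f i * g i) (fun i => δ i * δ' i) := by
  obtain ⟨r, hr, c, hc, hd⟩ := hf
  obtain ⟨r', hr', c', hc', hd'⟩ := hg
  have h0 : 0 < min r r' := by positivity
  refine ⟨min r r' / 2, by positivity, c * c' * ∑' s : Fin m → ℤ,
    Real.exp (-((min r r' - min r r' / 2) * len s)),
    mul_nonneg (by positivity) (tsum_nonneg fun _ => (Real.exp_pos _).le), fun i => ?_⟩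
  refine (Decays.mul (f i).continuous (f i).periodic (g i).continuous (g i).periodic
    (r' := min r r' / 2) (by positivity) (half_lt_self h0)
    ((hd i).mono (min_le_left _ _) le_rfl)
    ((hd' i).mono (min_le_right _ _) le_rfl)).mono le_rfl (le_of_eq ?_)
  rw [abs_mul]; ring

theorem UO.const {a : I → ℝ} (ha : a =O[⊤] δ) : UO (fun i => algebraMap ℝ (TA m) (a i)) δ := by
  obtain ⟨c, hc, h⟩ := exists_of_isBigO_top ha
  exact ⟨1, one_pos, c, hc, fun i => (decays_const (a i) 1).mono le_rfl (h i)⟩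

theorem UO.smul {a : I → ℝ} (ha : a =O[⊤] δ) (hf : UO f δ') :
    UO (fun i => a i • f i) (fun i => δ i * δ' i) := by
  simp only [Algebra.smul_def]
  exact (UO.const ha).mul hf

theorem UO.fixed (f : TA m) : UO (fun _ : I => f) (fun _ => 1) := by
  obtain ⟨r, M, hr, h⟩ := f.exists_decays
  have hM : 0 ≤ M := by simpa using (norm_nonneg _).trans (h 0)
  exact ⟨r, hr, M, hM, fun _ => by simpa using h⟩

/-- The symbols may depend on the index, as long as the polynomial bound does not. -/
theorem UO.mult (hf : UO f δ) {φ : I → Symb m} {K : ℝ} {τ : ℕ}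
    (h : ∀ i s, ‖(φ i).toFun s‖ ≤ K * (1 + len s) ^ τ) : UO (fun i => TA.mult (φ i) (f i)) δ := by
  obtain ⟨r, hr, c, hc, hd⟩ := hf
  obtain ⟨K', hK'⟩ := exists_mult_decay (m := m) K τ (half_lt_self hr)
  refine ⟨r / 2, half_pos hr, |K'| * c, by positivity, fun i s => ?_⟩
  have h1 := cf_mult (φ i) (f i) s
  simp only [cf] at h1
  rw [h1]
  refine (hK' _ _ _ (h i) (hd i) s).trans ?_
  rw [mul_assoc |K'|]
  have := le_abs_self K'
  gcongr

theorem UO.pd (hf : UO f δ) (v : Fin m → ℝ) : UO (fun i => TA.pd v (f i)) δ := by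
  obtain ⟨K, τ, h⟩ := (dirSymb v).bdd
  exact hf.mult (φ := fun _ => dirSymb v) fun _ => h

theorem UO.mn (hf : UO f δ) : (fun i => TA.mn (f i)) =O[⊤] δ := by
  obtain ⟨r, hr, c, hc, hd⟩ := hf
  refine isBigO_top_of_le c fun i => ?_
  have := hd i 0
  have h2 := cf_zero (f i)
  simp only [cf] at h2
  rw [h2, Complex.norm_real] at this
  simpa using this

theorem UO.sup (hf : UO f δ) : ∃ c, 0 ≤ c ∧ ∀ i x, |(f i).1 x| ≤ c * |δ i| := by
  obtain ⟨r, hr, c, hc, hd⟩ := hf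
  refine ⟨c * ∑' s : Fin m → ℤ, Real.exp (-(r * len s)),
    mul_nonneg hc (tsum_nonneg fun _ => (Real.exp_pos _).le), fun i x => ?_⟩
  rw [← Real.norm_eq_abs, ← Complex.norm_real, ← ((f i).hasSum_cf x).tsum_eq]
  have h2 := (summable_exp_len (m := m) hr).hasSum.mul_left (c * |δ i|)
  refine (tsum_of_norm_bounded h2 fun s => ?_).trans (le_of_eq (by ring))
  rw [norm_mul, norm_char_toC, mul_one]
  exact hd i s

end UO

/-! ### The operators `∂`, `∂⁻¹` and `(k - ∂²)⁻¹` -/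

end TA

/-- The small divisor `ω·s`. -/
def theta (ω : Fin m → ℝ) (s : Fin m → ℤ) : ℝ := ∑ j, ω j * (s j : ℝ)

theorem theta_neg (ω : Fin m → ℝ) (s : Fin m → ℤ) : theta ω (-s) = -theta ω s := by
  simp [theta]

theorem eucl_intCast_le (s : Fin m → ℤ) : eucl (fun i => (s i : ℝ)) ≤ len s := by
  rw [eucl]
  refine Real.sqrt_le_iff.2 ⟨len_nonneg s, ?_⟩
  rw [len]
  refine le_trans (Finset.sum_le_sum fun i _ => (sq_abs (s i : ℝ)).ge) ?_
  exact Finset.sum_sq_le_sq_sum_of_nonneg fun i _ => abs_nonneg _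

theorem Diophantine.theta_ne_zero {ω : Fin m → ℝ} {τ : ℕ} {c₀ : ℝ} (h : Diophantine ω τ c₀)
    {s : Fin m → ℤ} (hs : s ≠ 0) : theta ω s ≠ 0 := by
  intro h0
  have := h s hs
  simp only [theta] at h0
  rw [h0, abs_zero, mul_zero] at this
  linarith

theorem Diophantine.inv_le {ω : Fin m → ℝ} {τ : ℕ} {c₀ : ℝ} (h : Diophantine ω τ c₀)
    (s : Fin m → ℤ) : |theta ω s|⁻¹ ≤ |c₀| * (1 + len s) ^ τ := by
  -- At `s = 0` the left side is `0⁻¹ = 0`.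
  by_cases hs : s = 0
  · subst hs; simp [theta]
  have h0 : 0 < |theta ω s| := abs_pos.2 (h.theta_ne_zero hs)
  rw [inv_le_iff_one_le_mul₀ h0]
  refine (h s hs).trans ?_
  change c₀ * _ ^ τ * |theta ω s| ≤ _
  have h1 : eucl (fun i => (s i : ℝ)) ≤ 1 + len s := by linarith [eucl_intCast_le s]
  have h2 : 0 ≤ eucl (fun i => (s i : ℝ)) := Real.sqrt_nonneg _
  have := le_abs_self c₀
  gcongr

/-- The symbol of `∂⁻¹`. -/
def dinvSymb {ω : Fin m → ℝ} {τ : ℕ} {c₀ : ℝ} (h : Diophantine ω τ c₀) : Symb m where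
  -- At `s = 0` the convention `0⁻¹ = 0` makes the operator annihilate the mean.
  toFun s := (Complex.I * (theta ω s : ℂ))⁻¹
  sym s := by
    simp only [theta_neg, map_inv₀, map_mul, Complex.conj_I, Complex.conj_ofReal,
      Complex.ofReal_neg, mul_neg, neg_mul]
  bdd := ⟨|c₀|, τ, fun s => by simpa using h.inv_le s⟩

/-- The real symbol of `(k - ∂²)⁻¹` on functions of mean zero. -/
def resolventWeight (ω : Fin m → ℝ) (k : ℝ) (s : Fin m → ℤ) : ℝ :=
  -- The absolute value keeps the weight nonnegative for every real `k`; the resolvent identity is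
  -- used only for `k ≥ 0`.
  if s = 0 then 0 else (|k| + theta ω s ^ 2)⁻¹

theorem resolventWeight_nonneg (ω : Fin m → ℝ) (k : ℝ) (s : Fin m → ℤ) :
    0 ≤ resolventWeight ω k s := by
  rw [resolventWeight]; split_ifs <;> positivity

/-- Dropping `|k|` from the denominator only increases the weight, so the bound is that of the
squared small divisor and is independent of `k`. -/
theorem Diophantine.resolventWeight_le {ω : Fin m → ℝ} {τ : ℕ} {c₀ : ℝ} (h : Diophantine ω τ c₀)
    (k : ℝ) (s : Fin m → ℤ) :
    resolventWeight ω k s ≤ |c₀| ^ 2 * (1 + len s) ^ (2 * τ) := by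
  rw [resolventWeight]
  have hl := len_nonneg s
  split_ifs with hs
  · positivity
  · have h0 : 0 < |theta ω s| := abs_pos.2 (h.theta_ne_zero hs)
    calc (|k| + theta ω s ^ 2)⁻¹ ≤ (|theta ω s| ^ 2)⁻¹ := by
          rw [sq_abs]
          have : 0 < theta ω s ^ 2 := by rw [← sq_abs]; positivity
          gcongr
          linarith [abs_nonneg k]
      _ = (|theta ω s|⁻¹) ^ 2 := by rw [inv_pow]
      _ ≤ (|c₀| * (1 + len s) ^ τ) ^ 2 := by
          gcongr
          exact h.inv_le s
      _ = _ := by rw [mul_pow, ← pow_mul, mul_comm τ]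

/-- The symbol of `(k - ∂²)⁻¹` on functions of mean zero. -/
def resSymb {ω : Fin m → ℝ} {τ : ℕ} {c₀ : ℝ} (h : Diophantine ω τ c₀) (k : ℝ) : Symb m where
  toFun s := (resolventWeight ω k s : ℂ)
  sym s := by
    simp only [Complex.conj_ofReal, resolventWeight, theta_neg, neg_eq_zero, neg_sq]
  bdd := ⟨|c₀| ^ 2, 2 * τ, fun s => by
    rw [Complex.norm_real, Real.norm_of_nonneg (resolventWeight_nonneg _ _ _)]
    exact h.resolventWeight_le k s⟩

namespace TA
variable {ω : Fin m → ℝ} {τ : ℕ} {c₀ : ℝ} (h : Diophantine ω τ c₀)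

/-- The inverse of `∂` on functions of mean zero. -/
def Dinv : TA m →ₗ[ℝ] TA m := mult (dinvSymb h)

/-- The inverse of `k - ∂²` on functions of mean zero. -/
def Res (k : ℝ) : TA m →ₗ[ℝ] TA m := mult (resSymb h k)

@[simp] theorem cf_pd (v : Fin m → ℝ) (f : TA m) (s : Fin m → ℤ) :
    cf (pd v f) s = Complex.I * (theta v s : ℂ) * cf f s := cf_mult _ _ _

@[simp] theorem cf_Dinv (f : TA m) (s : Fin m → ℤ) :
    cf (Dinv h f) s = (Complex.I * (theta ω s : ℂ))⁻¹ * cf f s := cf_mult _ _ _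

@[simp] theorem cf_Res (k : ℝ) (f : TA m) (s : Fin m → ℤ) :
    cf (Res h k f) s = (resolventWeight ω k s : ℂ) * cf f s := cf_mult _ _ _

@[simp] theorem theta_zero (v : Fin m → ℝ) : theta v (0 : Fin m → ℤ) = 0 := by simp [theta]

theorem mn_of_cf_zero {f : TA m} (hf : cf f 0 = 0) : mn f = 0 := by
  rw [cf_zero] at hf; exact_mod_cast hf

@[simp] theorem mn_pd (v : Fin m → ℝ) (f : TA m) : mn (pd v f) = 0 :=
  mn_of_cf_zero (by simp)

@[simp] theorem mn_Res (k : ℝ) (f : TA m) : mn (Res h k f) = 0 :=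
  mn_of_cf_zero (by simp [resolventWeight])

@[simp] theorem pd_algebraMap (v : Fin m → ℝ) (c : ℝ) : pd v (algebraMap ℝ (TA m) c) = 0 := by
  -- Writing zero as `0 - 0` lets `cf_sub` show that its coefficients vanish.
  rw [← sub_self (0 : TA m)]
  refine ext_cf fun s => ?_
  rw [cf_pd, cf_algebraMap, cf_sub, sub_self]
  split_ifs with hs
  · subst hs; simp
  · simp

@[simp] theorem Dinv_algebraMap (c : ℝ) : Dinv h (algebraMap ℝ (TA m) c) = 0 := by
  rw [← sub_self (0 : TA m)]
  refine ext_cf fun s => ?_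
  rw [cf_Dinv, cf_algebraMap, cf_sub, sub_self]
  split_ifs with hs
  · subst hs; simp
  · simp

@[simp] theorem Res_algebraMap (k c : ℝ) : Res h k (algebraMap ℝ (TA m) c) = 0 := by
  rw [← sub_self (0 : TA m)]
  refine ext_cf fun s => ?_
  rw [cf_Res, cf_algebraMap, cf_sub, sub_self]
  split_ifs with hs
  · subst hs; simp [resolventWeight]
  · simp

theorem Dinv_pd (v : Fin m → ℝ) (f : TA m) : Dinv h (pd v f) = pd v (Dinv h f) :=
  ext_cf fun s => by simp only [cf_pd, cf_Dinv]; ring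

theorem Res_pd (k : ℝ) (v : Fin m → ℝ) (f : TA m) : Res h k (pd v f) = pd v (Res h k f) :=
  ext_cf fun s => by simp only [cf_pd, cf_Res]; ring

theorem pd_Dinv (f : TA m) : pd ω (Dinv h f) = f - algebraMap ℝ (TA m) (mn f) := by
  refine ext_cf fun s => ?_
  rw [cf_pd, cf_Dinv, cf_sub, cf_algebraMap]
  by_cases hs : s = 0
  · subst hs; simp [cf_zero]
  · have : (theta ω s : ℂ) ≠ 0 := by exact_mod_cast h.theta_ne_zero hs
    rw [if_neg hs]
    field_simp
    simp

theorem Dinv_D (f : TA m) : Dinv h (pd ω f) = f - algebraMap ℝ (TA m) (mn f) := by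
  rw [Dinv_pd, pd_Dinv]

theorem Res_eq {k : ℝ} (hk : 0 ≤ k) (f : TA m) :
    k • Res h k f - pd ω (pd ω (Res h k f)) = f - algebraMap ℝ (TA m) (mn f) := by
  refine ext_cf fun s => ?_
  rw [cf_sub, cf_smul, cf_pd, cf_pd, cf_Res, cf_sub, cf_algebraMap]
  by_cases hs : s = 0
  · subst hs; simp [cf_zero, resolventWeight]
  · have h1 : 0 < k + theta ω s ^ 2 := by
      have := h.theta_ne_zero hs
      positivity
    have h2 : (k : ℂ) + (theta ω s : ℂ) ^ 2 ≠ 0 := by exact_mod_cast h1.ne'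
    rw [if_neg hs, resolventWeight, if_neg hs, abs_of_nonneg hk]
    push_cast
    have h3 : ((k : ℂ) + (theta ω s : ℂ) ^ 2)⁻¹ * ((k : ℂ) + (theta ω s : ℂ) ^ 2) = 1 :=
      inv_mul_cancel₀ h2
    linear_combination cf f s * h3 - ((k : ℂ) + (theta ω s : ℂ) ^ 2)⁻¹ * cf f s
      * (theta ω s : ℂ) ^ 2 * Complex.I_sq

theorem mn_mul_pd (v : Fin m → ℝ) (f g : TA m) : mn (f * pd v g) = -mn (pd v f * g) := by
  have h1 : pd v f = -mult (dirSymb (-v)) f := ext_cf fun s => by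
    simp [dirSymb, theta]
  have h2 : -mult (dirSymb (-v)) f * g = -(mult (dirSymb (-v)) f * g) := by ring
  rw [h1, h2, map_neg, neg_neg]
  exact mn_mul_mult (fun s => by simp [dirSymb]) f g

theorem mn_mul_Res (k : ℝ) (f g : TA m) : mn (f * Res h k g) = mn (Res h k f * g) :=
  mn_mul_mult (φ := resSymb h k) (ψ := resSymb h k) (fun s => by
    rw [(resSymb h k).sym]; exact Complex.conj_ofReal _) f g

/-- The Leibniz rule is taken from the pointwise derivative, which avoids convolutions of
coefficients. -/
theorem pd_mul (v : Fin m → ℝ) (f g : TA m) : pd v (f * g) = pd v f * g + f * pd v g := by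
  ext x
  rw [← fderiv_apply]
  have h1 := fderiv_mul (f.differentiableAt x) (g.differentiableAt x)
  have h2 : (f * g : TA m).1 = f.1 * g.1 := rfl
  rw [h2, h1]
  simp only [_root_.add_apply, _root_.smul_apply, fderiv_apply,
    smul_eq_mul]
  change _ = (pd v f).1 x * g.1 x + f.1 x * (pd v g).1 x
  ring

section UO
variable {I : Type*} {f : I → TA m} {δ : I → ℝ}

theorem UO.Dinv (hf : UO f δ) : UO (fun i => TA.Dinv h (f i)) δ := by
  obtain ⟨K, τ, hb⟩ := (dinvSymb h).bdd
  exact hf.mult (φ := fun _ => dinvSymb h) fun _ => hb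

theorem UO.Res (hf : UO f δ) (k : I → ℝ) : UO (fun i => TA.Res h (k i) (f i)) δ :=
  hf.mult (φ := fun i => resSymb h (k i)) (K := |c₀| ^ 2) (τ := 2 * τ) fun i s => by
    change ‖((resolventWeight ω (k i) s : ℝ) : ℂ)‖ ≤ _
    rw [Complex.norm_real, Real.norm_of_nonneg (resolventWeight_nonneg _ _ _)]
    exact h.resolventWeight_le (k i) s

end UO

end TA

open TA

/-! ### The linear problem in the algebra of analytic functions -/

/-- The coefficients of the linear problem: the oscillating part `w` of `w₁`, the first row
`(Wa, Wb)` of `W`, and the matrix `S` and the rows `Ta`, `Tb` of `T`. -/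
structure LinData (m : ℕ) where
  k : ℝ
  w : TA m
  Wa : TA m
  Wb : TA m
  S : Fin m → Fin m → TA m
  Ta : Fin m → TA m
  Tb : Fin m → TA m

/-- The finite-dimensional part `(mean μ, p, mean λ₁, mean λ₂)` of the unknowns. -/
abbrev Par (m : ℕ) : Type := (Fin m → ℝ) × ℝ × ℝ × ℝ

/-- The right-hand sides `(g₁, g₂)`. -/
abbrev Rhs (m : ℕ) : Type := TA m × TA m × TA m

/-- The `j`-th unit vector. -/
abbrev unitVec (j : Fin m) : Fin m → ℝ := Pi.single j 1

/-- The linear problem, without the normalization of the mean value of `χ`. -/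
structure AlgSol (ω : Fin m → ℝ) (L : LinData m) (g : Rhs m) (γ : ℝ) (μ : Fin m → TA m)
    (la lb : TA m) (χ : Fin m → TA m) (p : ℝ) : Prop where
  eq_mu : ∀ j, pd ω (μ j) = -(p • pd (unitVec j) L.w) - pd (unitVec j) g.1
  eq_la : -(L.k • la) + pd ω lb + (∑ j, L.Ta j * μ j + p • L.Wa) = g.2.1
  eq_lb : lb - pd ω la + (∑ j, L.Tb j * μ j + p • L.Wb) = g.2.2
  eq_chi : ∀ i, -pd ω (χ i) + (∑ j, L.S i j * μ j + L.Ta i * la + L.Tb i * lb) = 0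
  norm_lam : mn (L.Wa * la + L.Wb * lb) + ∑ i, mn (χ i * pd (unitVec i) L.w) = γ

namespace LinData
variable {ω : Fin m → ℝ} {τ : ℕ} {c₀ : ℝ} (h : Diophantine ω τ c₀) (L : LinData m)
  (y y' : Par m) (g g' : Rhs m)

/-- The component `μ` determined by the parameters and the right-hand sides. -/
def mu (j : Fin m) : TA m :=
  algebraMap ℝ (TA m) (y.1 j) - y.2.1 • Dinv h (pd (unitVec j) L.w) - Dinv h (pd (unitVec j) g.1)

/-- The first component of `Tμ + p Wᵀe₁`. -/
def qa : TA m := ∑ j, L.Ta j * L.mu h y g j + y.2.1 • L.Wa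

/-- The second component of `Tμ + p Wᵀe₁`. -/
def qb : TA m := ∑ j, L.Tb j * L.mu h y g j + y.2.1 • L.Wb

/-- The first component of the solution of `J∂λ + Ωλ = f` with mean value zero. -/
def resA (fa fb : TA m) : TA m := -Res h L.k (fa - pd ω fb)

/-- The second component of the solution of `J∂λ + Ωλ = f` with mean value zero. -/
def resB (fa fb : TA m) : TA m := -Res h L.k (pd ω fa - L.k • fb)

/-- The component `λ₁` determined by the parameters and the right-hand sides. -/
def la : TA m := algebraMap ℝ (TA m) y.2.2.1
  + L.resA h (g.2.1 - L.qa h y g) (g.2.2 - L.qb h y g)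

/-- The component `λ₂` determined by the parameters and the right-hand sides. -/
def lb : TA m := algebraMap ℝ (TA m) y.2.2.2
  + L.resB h (g.2.1 - L.qa h y g) (g.2.2 - L.qb h y g)

/-- The vector `Sμ + Tᵀλ`. -/
def flux (i : Fin m) : TA m :=
  ∑ j, L.S i j * L.mu h y g j + L.Ta i * L.la h y g + L.Tb i * L.lb h y g

/-- The finite-dimensional solvability conditions. -/
def Phi : Par m :=
  (fun i => mn (L.flux h y g i), -L.k * y.2.2.1 + mn (L.qa h y g) - mn g.2.1,
    y.2.2.2 + mn (L.qb h y g) - mn g.2.2,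
    mn (L.Wa * L.la h y g + L.Wb * L.lb h y g)
      + ∑ i, mn (Dinv h (L.flux h y g i) * pd (unitVec i) L.w))

section Linear

theorem resA_add (fa fb fa' fb' : TA m) :
    L.resA h (fa + fa') (fb + fb') = L.resA h fa fb + L.resA h fa' fb' := by
  simp only [resA, map_add, map_sub]; abel

theorem resB_add (fa fb fa' fb' : TA m) :
    L.resB h (fa + fa') (fb + fb') = L.resB h fa fb + L.resB h fa' fb' := by
  simp only [resB, map_add, map_sub, smul_add]; abel

theorem resA_smul (c : ℝ) (fa fb : TA m) :
    L.resA h (c • fa) (c • fb) = c • L.resA h fa fb := by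
  simp only [resA, map_sub, map_smul]; module

theorem resB_smul (c : ℝ) (fa fb : TA m) :
    L.resB h (c • fa) (c • fb) = c • L.resB h fa fb := by
  simp only [resB, map_sub, map_smul]; module

theorem resA_sub (fa fb fa' fb' : TA m) :
    L.resA h (fa - fa') (fb - fb') = L.resA h fa fb - L.resA h fa' fb' := by
  rw [eq_sub_iff_add_eq, ← resA_add, sub_add_cancel, sub_add_cancel]

theorem resB_sub (fa fb fa' fb' : TA m) :
    L.resB h (fa - fa') (fb - fb') = L.resB h fa fb - L.resB h fa' fb' := by
  rw [eq_sub_iff_add_eq, ← resB_add, sub_add_cancel, sub_add_cancel]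

@[simp] theorem resA_const (a b : ℝ) :
    L.resA h (algebraMap ℝ (TA m) a) (algebraMap ℝ (TA m) b) = 0 := by
  rw [resA, pd_algebraMap, sub_zero, Res_algebraMap, neg_zero]

@[simp] theorem resB_const (a b : ℝ) :
    L.resB h (algebraMap ℝ (TA m) a) (algebraMap ℝ (TA m) b) = 0 := by
  rw [resB, pd_algebraMap, zero_sub, map_neg, map_smul, Res_algebraMap, smul_zero, neg_zero,
    neg_zero]

theorem mu_add (j : Fin m) : L.mu h (y + y') (g + g') j = L.mu h y g j + L.mu h y' g' j := by
  simp only [mu, Prod.fst_add, Prod.snd_add, Pi.add_apply, map_add, add_smul]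
  abel

theorem mu_smul (c : ℝ) (j : Fin m) : L.mu h (c • y) (c • g) j = c • L.mu h y g j := by
  simp only [mu, Prod.smul_fst, Prod.smul_snd, Pi.smul_apply, map_smul, smul_eq_mul,
    Algebra.algebraMap_eq_smul_one]
  module

theorem qa_add : L.qa h (y + y') (g + g') = L.qa h y g + L.qa h y' g' := by
  simp only [qa, mu_add, mul_add, Finset.sum_add_distrib, Prod.fst_add, Prod.snd_add, add_smul]
  abel

theorem qb_add : L.qb h (y + y') (g + g') = L.qb h y g + L.qb h y' g' := by
  simp only [qb, mu_add, mul_add, Finset.sum_add_distrib, Prod.fst_add, Prod.snd_add, add_smul]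
  abel

theorem qa_smul (c : ℝ) : L.qa h (c • y) (c • g) = c • L.qa h y g := by
  simp only [qa, mu_smul, mul_smul_comm, ← Finset.smul_sum, Prod.smul_fst, Prod.smul_snd,
    smul_eq_mul]
  module

theorem qb_smul (c : ℝ) : L.qb h (c • y) (c • g) = c • L.qb h y g := by
  simp only [qb, mu_smul, mul_smul_comm, ← Finset.smul_sum, Prod.smul_fst, Prod.smul_snd,
    smul_eq_mul]
  module

theorem la_add : L.la h (y + y') (g + g') = L.la h y g + L.la h y' g' := by
  simp only [la, qa_add, qb_add, Prod.fst_add, Prod.snd_add, map_add, add_sub_add_comm, resA_add]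
  abel

theorem lb_add : L.lb h (y + y') (g + g') = L.lb h y g + L.lb h y' g' := by
  simp only [lb, qa_add, qb_add, Prod.fst_add, Prod.snd_add, map_add, add_sub_add_comm, resB_add]
  abel

theorem la_smul (c : ℝ) : L.la h (c • y) (c • g) = c • L.la h y g := by
  simp only [la, qa_smul, qb_smul, Prod.smul_fst, Prod.smul_snd, ← smul_sub, resA_smul,
    Algebra.algebraMap_eq_smul_one, smul_eq_mul]
  module

theorem lb_smul (c : ℝ) : L.lb h (c • y) (c • g) = c • L.lb h y g := by
  simp only [lb, qa_smul, qb_smul, Prod.smul_fst, Prod.smul_snd, ← smul_sub, resB_smul,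
    Algebra.algebraMap_eq_smul_one, smul_eq_mul]
  module

theorem flux_add (i : Fin m) :
    L.flux h (y + y') (g + g') i = L.flux h y g i + L.flux h y' g' i := by
  simp only [flux, mu_add, la_add, lb_add, mul_add, Finset.sum_add_distrib]
  abel

theorem flux_smul (c : ℝ) (i : Fin m) : L.flux h (c • y) (c • g) i = c • L.flux h y g i := by
  simp only [flux, mu_smul, la_smul, lb_smul, mul_smul_comm, ← Finset.smul_sum, smul_add]

theorem Phi_add : L.Phi h (y + y') (g + g') = L.Phi h y g + L.Phi h y' g' := by
  simp only [Phi, flux_add, qa_add, qb_add, la_add, lb_add, map_add, mul_add, add_mul,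
    Finset.sum_add_distrib, Prod.fst_add, Prod.snd_add, Prod.mk_add_mk]
  refine Prod.ext (funext fun i => rfl) (Prod.ext ?_ (Prod.ext ?_ ?_)) <;> simp only <;> ring

theorem Phi_smul (c : ℝ) : L.Phi h (c • y) (c • g) = c • L.Phi h y g := by
  simp only [Phi, flux_smul, qa_smul, qb_smul, la_smul, lb_smul, map_smul, mul_smul_comm,
    smul_mul_assoc, Prod.smul_fst, Prod.smul_snd, Prod.smul_mk, ← smul_add,
    smul_eq_mul]
  refine Prod.ext (funext fun i => rfl) (Prod.ext ?_ (Prod.ext ?_ ?_)) <;> simp only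
  · ring
  · ring
  · rw [← Finset.mul_sum]; ring

/-- The linear part of the solvability conditions. -/
def Lam : Par m →ₗ[ℝ] Par m where
  toFun y := L.Phi h y 0
  map_add' y y' := by
    have := L.Phi_add h y y' 0 0
    rwa [add_zero] at this
  map_smul' c y := by
    have := L.Phi_smul h y 0 c
    rwa [smul_zero] at this

theorem Lam_apply : L.Lam h y = L.Phi h y 0 := rfl

theorem Phi_eq : L.Phi h y g = L.Lam h y + L.Phi h 0 g := by
  have := L.Phi_add h y 0 0 g
  rwa [add_zero, zero_add] at this

end Linear

/-- The solvability conditions are necessary. -/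
theorem eq_of_algSol {L : LinData m} (hk : 0 ≤ L.k) {g : Rhs m} {γ : ℝ} {μ χ : Fin m → TA m}
    {la lb : TA m} {p : ℝ} (hX : AlgSol ω L g γ μ la lb χ p) :
    ∃ y : Par m, L.Phi h y g = (0, 0, 0, γ) ∧ μ = L.mu h y g ∧ la = L.la h y g ∧ lb = L.lb h y g ∧
      p = y.2.1 ∧ ∀ i, χ i = algebraMap ℝ (TA m) (mn (χ i)) + Dinv h (L.flux h y g i) := by
  set y : Par m := (fun j => mn (μ j), p, mn la, mn lb) with hy
  have hmu : ∀ j, μ j = L.mu h y g j := by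
    intro j
    have h1 := Dinv_D h (μ j)
    rw [hX.eq_mu, map_sub, map_neg, map_smul] at h1
    rw [mu, hy]
    simp only
    linear_combination -h1
  have hqa : ∑ j, L.Ta j * μ j + p • L.Wa = L.qa h y g := by
    simp only [qa, ← hmu]; rfl
  have hqb : ∑ j, L.Tb j * μ j + p • L.Wb = L.qb h y g := by
    simp only [qb, ← hmu]; rfl
  have e2 := hX.eq_la
  have e3 := hX.eq_lb
  rw [hqa] at e2
  rw [hqb] at e3
  have f2 : g.2.1 - L.qa h y g = -(L.k • la) + pd ω lb := by rw [← e2]; ring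
  have f3 : g.2.2 - L.qb h y g = lb - pd ω la := by rw [← e3]; ring
  -- The combination `fa - ∂fb` equals `-(k - ∂²)λ₁`, and below `∂fa - k fb` equals `-(k - ∂²)λ₂`;
  -- the resolvent recovers each component up to its mean.
  have hla : la = L.la h y g := by
    have h1 := Res_eq h hk la
    rw [LinData.la, resA, f2, f3]
    simp only [map_add, map_sub, map_neg, map_smul, Res_pd]
    rw [hy]
    simp only
    linear_combination -h1
  have hlb : lb = L.lb h y g := by
    have h1 := Res_eq h hk lb
    rw [LinData.lb, resB, f2, f3]
    simp only [map_add, map_sub, map_neg, map_smul, Res_pd, smul_sub]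
    rw [hy]
    simp only
    linear_combination -h1
  have hfl : ∀ i, ∑ j, L.S i j * μ j + L.Ta i * la + L.Tb i * lb = L.flux h y g i := by
    intro i
    simp only [flux, ← hmu, ← hla, ← hlb]
  have hD : ∀ i, pd ω (χ i) = L.flux h y g i := by
    intro i
    have := hX.eq_chi i
    rw [hfl] at this
    linear_combination -this
  have hchi : ∀ i, χ i = algebraMap ℝ (TA m) (mn (χ i)) + Dinv h (L.flux h y g i) := by
    intro i
    rw [← hD, Dinv_D]; ring
  refine ⟨y, ?_, funext hmu, hla, hlb, rfl, hchi⟩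
  rw [Phi]
  refine Prod.ext (funext fun i => ?_) (Prod.ext ?_ (Prod.ext ?_ ?_))
  · simp only [← hD, mn_pd]; rfl
  · have := congrArg mn e2
    simp only [map_add, map_neg, map_smul, mn_pd, smul_eq_mul] at this
    simp only [hy]
    simp only [hy] at this
    linarith
  · have := congrArg mn e3
    simp only [map_add, map_sub, mn_pd] at this
    simp only [hy]
    simp only [hy] at this
    linarith
  · simp only
    rw [← hX.norm_lam, ← hla, ← hlb]
    congr 1
    refine Finset.sum_congr rfl fun i _ => ?_
    -- The mean of `χ i` contributes nothing to this pairing because `∂ᵢw` has mean zero.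
    conv_rhs => rw [hchi i]
    rw [add_mul, map_add, ← Algebra.smul_def, map_smul, mn_pd, smul_zero, zero_add]

/-- The solvability conditions are sufficient. -/
theorem algSol_of_Phi {L : LinData m} (hk : 0 ≤ L.k) {g : Rhs m} {γ : ℝ} {y : Par m}
    (hy : L.Phi h y g = (0, 0, 0, γ)) (χ₀ : Fin m → ℝ) :
    AlgSol ω L g γ (L.mu h y g) (L.la h y g) (L.lb h y g)
      (fun i => algebraMap ℝ (TA m) (χ₀ i) + Dinv h (L.flux h y g i)) y.2.1 := by
  rw [Phi] at hy
  simp only [Prod.mk.injEq] at hy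
  obtain ⟨h1, h2, h3, h4⟩ := hy
  set fa := g.2.1 - L.qa h y g with hfa
  set fb := g.2.2 - L.qb h y g with hfb
  refine ⟨fun j => ?_, ?_, ?_, fun i => ?_, ?_⟩
  · simp only [mu, map_sub, map_smul, pd_algebraMap, pd_Dinv, mn_pd, map_zero, sub_zero]
    ring
  · change _ + _ + L.qa h y g = _
    have h5 := Res_eq h hk fa
    have h6 : mn fa = -L.k * y.2.2.1 := by rw [hfa, map_sub]; linarith
    rw [h6] at h5
    rw [la, lb, resA, resB, ← hfa, ← hfb]
    simp only [map_add, map_sub, map_neg, map_smul, Res_pd, pd_algebraMap, smul_add, smul_sub,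
      smul_neg, map_mul] at h5 ⊢
    rw [Algebra.smul_def L.k (algebraMap ℝ (TA m) y.2.2.1)]
    linear_combination h5 + hfa
  · change _ - _ + L.qb h y g = _
    have h5 := Res_eq h hk fb
    have h6 : mn fb = y.2.2.2 := by rw [hfb, map_sub]; linarith
    rw [h6] at h5
    rw [la, lb, resA, resB, ← hfa, ← hfb]
    simp only [map_add, map_sub, map_neg, map_smul, Res_pd, pd_algebraMap] at h5 ⊢
    linear_combination h5 + hfb
  · change _ + L.flux h y g i = _
    have h5 : mn (L.flux h y g i) = 0 := congrFun h1 i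
    rw [map_add, pd_algebraMap, pd_Dinv, h5, map_zero]
    ring
  · rw [← h4]
    congr 1
    refine Finset.sum_congr rfl fun i _ => ?_
    rw [add_mul, map_add, ← Algebra.smul_def, map_smul, mn_pd, smul_zero, zero_add]

end LinData

/-! ### Uniform estimates for the linear problem -/

namespace TA
variable {I : Type*} {f : I → TA m} {δ ε : I → ℝ}

theorem isBigO_mul_of_le_one {ε δ : I → ℝ} (hε : ∀ i, |ε i| ≤ 1) :
    (fun i => ε i * δ i) =O[⊤] δ :=
  isBigO_top_of_le 1 fun i => by
    rw [abs_mul]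
    exact mul_le_mul_of_nonneg_right (hε i) (abs_nonneg _)

theorem isBigO_sum {ι : Type*} [Fintype ι] {f : ι → I → ℝ} (hf : ∀ a, f a =O[⊤] δ) :
    (fun i => ∑ a, f a i) =O[⊤] δ := by
  have h := Asymptotics.IsBigO.sum (s := Finset.univ) fun a _ => hf a
  exact h.congr_left fun i => Finset.sum_apply _ _ _

theorem UO.of_mul (hf : UO f fun i => ε i * δ i) (hε : ∀ i, |ε i| ≤ 1) : UO f δ :=
  hf.mono (isBigO_mul_of_le_one hε)

theorem UO.congr {f' : I → TA m} (hf : UO f δ) (hff' : ∀ i, f i = f' i) : UO f' δ := by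
  rwa [← funext hff']

theorem UO.mul_comm (hf : UO f fun i => δ i * ε i) : UO f fun i => ε i * δ i := by
  simpa only [_root_.mul_comm] using hf

theorem UO.one_mul (hf : UO f fun i => 1 * δ i) : UO f δ := by
  simpa only [_root_.one_mul] using hf

theorem UO.mul_one (hf : UO f fun i => δ i * 1) : UO f δ := by
  simpa only [_root_.mul_one] using hf

end TA

/-- The coefficients `L i` are `O(ε i)`-close to those of the unperturbed problem. -/
structure Near {I : Type*} (L : I → LinData m) (ε : I → ℝ) (S₀ : Matrix (Fin m) (Fin m) ℝ)
    (t₀ : Fin m → ℝ) : Prop where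
  k_mem : ∀ i, (L i).k ∈ Set.Icc (0 : ℝ) 1
  eps_le : ∀ i, |ε i| ≤ 1
  w : UO (fun i => (L i).w) ε
  Wa : UO (fun i => (L i).Wa - algebraMap ℝ (TA m) 1) ε
  Wb : UO (fun i => (L i).Wb) ε
  S : ∀ a b, UO (fun i => (L i).S a b - algebraMap ℝ (TA m) (S₀ a b)) ε
  Ta : ∀ j, UO (fun i => (L i).Ta j) ε
  Tb : ∀ j, UO (fun i => (L i).Tb j - algebraMap ℝ (TA m) (t₀ j)) ε

namespace Near
variable {I I' : Type*} {L : I → LinData m} {ε δ : I → ℝ} {S₀ : Matrix (Fin m) (Fin m) ℝ}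
  {t₀ : Fin m → ℝ} {ω : Fin m → ℝ} {τ : ℕ} {c₀ : ℝ} (h : Diophantine ω τ c₀)

theorem comp (hL : Near L ε S₀ t₀) (π : I' → I) :
    Near (fun i => L (π i)) (fun i => ε (π i)) S₀ t₀ where
  k_mem i := hL.k_mem (π i)
  eps_le i := hL.eps_le (π i)
  w := hL.w.comp π
  Wa := hL.Wa.comp π
  Wb := hL.Wb.comp π
  S a b := (hL.S a b).comp π
  Ta j := (hL.Ta j).comp π
  Tb j := (hL.Tb j).comp π

variable (hL : Near L ε S₀ t₀)
include hL

theorem eps_isBigO_one : ε =O[⊤] fun _ => (1 : ℝ) :=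
  isBigO_top_of_le 1 fun i => by simpa using hL.eps_le i

theorem k_isBigO_one : (fun i => (L i).k) =O[⊤] fun _ => (1 : ℝ) :=
  isBigO_top_of_le 1 fun i => by
    have := hL.k_mem i
    rw [abs_of_nonneg this.1]; simpa using this.2

theorem of_sub_const {f : I → TA m} {c : ℝ} (hf : UO (fun i => f i - algebraMap ℝ (TA m) c) ε) :
    UO f fun _ => 1 := by
  have h1 := (hf.mono hL.eps_isBigO_one).add (UO.fixed (algebraMap ℝ (TA m) c))
  simpa using h1

theorem Wa_one : UO (fun i => (L i).Wa) fun _ => 1 := hL.of_sub_const hL.Wa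
theorem Wb_one : UO (fun i => (L i).Wb) fun _ => 1 := hL.Wb.mono hL.eps_isBigO_one
theorem S_one (a b : Fin m) : UO (fun i => (L i).S a b) fun _ => 1 := hL.of_sub_const (hL.S a b)
theorem Ta_one (j : Fin m) : UO (fun i => (L i).Ta j) fun _ => 1 :=
  (hL.Ta j).mono hL.eps_isBigO_one
theorem Tb_one (j : Fin m) : UO (fun i => (L i).Tb j) fun _ => 1 := hL.of_sub_const (hL.Tb j)

omit hL in
theorem resA_UO {fa fb : I → TA m} (ha : UO fa δ) (hb : UO fb δ) :
    UO (fun i => (L i).resA h (fa i) (fb i)) δ :=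
  ((ha.sub (hb.pd ω)).Res h _).neg

theorem resB_UO {fa fb : I → TA m} (ha : UO fa δ) (hb : UO fb δ) :
    UO (fun i => (L i).resB h (fa i) (fb i)) δ :=
  (((ha.pd ω).sub (UO.smul hL.k_isBigO_one hb).one_mul).Res h _).neg

section Refined
variable {y : I → Par m} {g : I → Rhs m} (hy : y =O[⊤] δ)
  (hg : UO (fun i => (g i).1) fun i => ε i * δ i)

omit hL in
theorem _root_.LowerTori.Par.isBigO_iff {y : I → Par m} :
    y =O[⊤] δ ↔ (∀ j, (fun i => (y i).1 j) =O[⊤] δ) ∧ (fun i => (y i).2.1) =O[⊤] δ ∧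
      (fun i => (y i).2.2.1) =O[⊤] δ ∧ (fun i => (y i).2.2.2) =O[⊤] δ := by
  rw [← Asymptotics.isBigO_pi, ← Asymptotics.isBigO_prod_left, ← Asymptotics.isBigO_prod_left,
    ← Asymptotics.isBigO_prod_left]

include hy hg

/-- The oscillating part of `μ` comes only from `p ∇w` and `∇g₁`. The former carries `ε` through
`w`; the latter carries it by the standing requirement that `g₁` be smaller than the parameters by a
factor `ε`. -/
theorem mu_sub (j : Fin m) :
    UO (fun i => (L i).mu h (y i) (g i) j - algebraMap ℝ (TA m) ((y i).1 j))
      fun i => ε i * δ i := by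
  have h1 := (UO.smul (Par.isBigO_iff.1 hy).2.1 ((hL.w.pd (unitVec j)).Dinv h)).mul_comm
  refine (h1.neg.sub ((hg.pd (unitVec j)).Dinv h)).congr fun i => ?_
  simp only [LinData.mu]; ring

theorem mu_UO (j : Fin m) : UO (fun i => (L i).mu h (y i) (g i) j) δ := by
  refine (((hL.mu_sub h hy hg j).of_mul hL.eps_le).add
    (UO.const ((Par.isBigO_iff.1 hy).1 j))).congr fun i => ?_
  ring

/-- At leading order `t₁` vanishes and `W₁₁` is one, so only `p` is left. -/
theorem qa_sub : UO (fun i => (L i).qa h (y i) (g i) - algebraMap ℝ (TA m) (y i).2.1)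
    fun i => ε i * δ i := by
  have h1 := (UO.smul (Par.isBigO_iff.1 hy).2.1 hL.Wa).mul_comm
  have h2 := UO.sum Finset.univ fun j _ => (hL.Ta j).mul (hL.mu_UO h hy hg j)
  refine (h2.add h1).congr fun i => ?_
  simp only [LinData.qa, Algebra.smul_def, map_one]; ring

theorem qb_sub : UO (fun i => (L i).qb h (y i) (g i)
    - algebraMap ℝ (TA m) (∑ j, t₀ j * (y i).1 j)) fun i => ε i * δ i := by
  have h1 := (UO.smul (Par.isBigO_iff.1 hy).2.1 hL.Wb).mul_comm
  have h2 := UO.sum Finset.univ fun j _ => ((hL.Tb j).mul (hL.mu_UO h hy hg j)).add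
    ((UO.fixed (algebraMap ℝ (TA m) (t₀ j))).mul (hL.mu_sub h hy hg j)).one_mul
  refine (h2.add h1).congr fun i => ?_
  have h3 : ∀ j, ((L i).Tb j - algebraMap ℝ (TA m) (t₀ j)) * (L i).mu h (y i) (g i) j
      + algebraMap ℝ (TA m) (t₀ j) * ((L i).mu h (y i) (g i) j - algebraMap ℝ (TA m) ((y i).1 j))
      = (L i).Tb j * (L i).mu h (y i) (g i) j
        - algebraMap ℝ (TA m) (t₀ j) * algebraMap ℝ (TA m) ((y i).1 j) := fun j => by ring
  simp only [LinData.qb, h3, Finset.sum_sub_distrib, map_sum, map_mul]; ring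

theorem la_sub : UO (fun i => (L i).la h (y i) (g i) - algebraMap ℝ (TA m) (y i).2.2.1
    - (L i).resA h (g i).2.1 (g i).2.2) fun i => ε i * δ i := by
  refine (Near.resA_UO (L := L) h (hL.qa_sub h hy hg) (hL.qb_sub h hy hg)).neg.congr fun i => ?_
  simp only [LinData.la, LinData.resA_sub, LinData.resA_const]
  ring

theorem lb_sub : UO (fun i => (L i).lb h (y i) (g i) - algebraMap ℝ (TA m) (y i).2.2.2
    - (L i).resB h (g i).2.1 (g i).2.2) fun i => ε i * δ i := by
  refine (hL.resB_UO h (hL.qa_sub h hy hg) (hL.qb_sub h hy hg)).neg.congr fun i => ?_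
  simp only [LinData.lb, LinData.resB_sub, LinData.resB_const]
  ring

/-- The response of `λ` to `g₂` need not be small relative to `δ`, so it is subtracted exactly; all
other variable terms contain a coefficient of size `ε`. -/
theorem flux_sub (a : Fin m) : UO (fun i => (L i).flux h (y i) (g i) a
    - algebraMap ℝ (TA m) (∑ j, S₀ a j * (y i).1 j + t₀ a * (y i).2.2.2)
    - ((L i).Ta a * (L i).resA h (g i).2.1 (g i).2.2
      + (L i).Tb a * (L i).resB h (g i).2.1 (g i).2.2)) fun i => ε i * δ i := by
  have hyc := Par.isBigO_iff.1 hy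
  have h1 := UO.sum Finset.univ fun j _ => ((hL.S a j).mul (hL.mu_UO h hy hg j)).add
    ((UO.fixed (algebraMap ℝ (TA m) (S₀ a j))).mul (hL.mu_sub h hy hg j)).one_mul
  have h2 := (hL.Ta a).mul (UO.const hyc.2.2.1)
  have h3 := ((hL.Ta_one a).mul (hL.la_sub h hy hg)).one_mul
  have h4 := (hL.Tb a).mul (UO.const hyc.2.2.2)
  have h5 := ((hL.Tb_one a).mul (hL.lb_sub h hy hg)).one_mul
  refine ((((h1.add h2).add h3).add h4).add h5).congr fun i => ?_
  have h6 : ∀ j, ((L i).S a j - algebraMap ℝ (TA m) (S₀ a j)) * (L i).mu h (y i) (g i) j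
      + algebraMap ℝ (TA m) (S₀ a j)
        * ((L i).mu h (y i) (g i) j - algebraMap ℝ (TA m) ((y i).1 j))
      = (L i).S a j * (L i).mu h (y i) (g i) j
        - algebraMap ℝ (TA m) (S₀ a j) * algebraMap ℝ (TA m) ((y i).1 j) := fun j => by ring
  simp only [LinData.flux, h6, Finset.sum_sub_distrib, map_sum, map_mul, map_add]
  ring

end Refined
end Near

/-- The solvability conditions of the unperturbed problem. -/
def lam₀ (S₀ : Matrix (Fin m) (Fin m) ℝ) (t₀ : Fin m → ℝ) (k : ℝ) (y : Par m) : Par m :=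
  (fun a => ∑ j, S₀ a j * y.1 j + t₀ a * y.2.2.2, -k * y.2.2.1 + y.2.1,
    y.2.2.2 + ∑ j, t₀ j * y.1 j, y.2.2.1)

namespace LinData
variable {ω : Fin m → ℝ} {τ : ℕ} {c₀ : ℝ} (h : Diophantine ω τ c₀) (L : LinData m) (g : Rhs m)

/-- The leading contribution of `g₂` to the flux. -/
def srcFlux (a : Fin m) : TA m := L.Ta a * L.resA h g.2.1 g.2.2 + L.Tb a * L.resB h g.2.1 g.2.2

/-- The leading contribution of `g₂` to the solvability conditions. -/
def src : Par m :=
  (fun a => mn (L.srcFlux h g a), -mn g.2.1, -mn g.2.2,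
    mn (L.Wa * L.resA h g.2.1 g.2.2 + L.Wb * L.resB h g.2.1 g.2.2)
      + ∑ a, mn (Dinv h (L.srcFlux h g a) * pd (unitVec a) L.w))

theorem src_zero : L.src h 0 = 0 := by
  simp [src, srcFlux, resA, resB]
  rfl

end LinData

namespace Near
variable {I I' : Type*} {L : I → LinData m} {ε δ : I → ℝ} {S₀ : Matrix (Fin m) (Fin m) ℝ}
  {t₀ : Fin m → ℝ} {ω : Fin m → ℝ} {τ : ℕ} {c₀ : ℝ} (h : Diophantine ω τ c₀)
  (hL : Near L ε S₀ t₀) {y : I → Par m} {g : I → Rhs m}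
include hL

/-- The solvability map is the unperturbed one plus an explicit source from `g₂`, up to a factor
`ε`. Keeping the source apart allows it later to be estimated in a norm weaker than that of `g₂`. -/
theorem Phi_sub (hy : y =O[⊤] δ) (hg : UO (fun i => (g i).1) fun i => ε i * δ i) :
    (fun i => (L i).Phi h (y i) (g i) - lam₀ S₀ t₀ (L i).k (y i) - (L i).src h (g i))
      =O[⊤] fun i => ε i * δ i := by
  have hyc := Par.isBigO_iff.1 hy
  rw [Par.isBigO_iff]
  refine ⟨fun a => ?_, ?_, ?_, ?_⟩
  · refine (hL.flux_sub h hy hg a).mn.congr_left fun i => ?_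
    simp only [LinData.Phi, lam₀, LinData.src, LinData.srcFlux, map_sub, mn_algebraMap,
      Prod.fst_sub, Pi.sub_apply]
  · refine (hL.qa_sub h hy hg).mn.congr_left fun i => ?_
    simp only [LinData.Phi, lam₀, LinData.src, map_sub, mn_algebraMap, Prod.fst_sub, Prod.snd_sub]
    ring
  · refine (hL.qb_sub h hy hg).mn.congr_left fun i => ?_
    simp only [LinData.Phi, lam₀, LinData.src, map_sub, mn_algebraMap, Prod.fst_sub, Prod.snd_sub]
    ring
  · have h1 := hL.Wa.mul (UO.const hyc.2.2.1)
    have h2 := (hL.Wa_one.mul (hL.la_sub h hy hg)).one_mul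
    have h3 := hL.Wb.mul (UO.const hyc.2.2.2)
    have h4 := (hL.Wb_one.mul (hL.lb_sub h hy hg)).one_mul
    have h5 := fun a => ((((hL.flux_sub h hy hg a).Dinv h).mul
      ((hL.w.mono hL.eps_isBigO_one).pd (unitVec a))).mul_one).mn
    refine ((((h1.add h2).add h3).add h4).mn.add
      (isBigO_sum fun a => h5 a)).congr_left fun i => ?_
    -- Constants in the flux are annihilated by `∂⁻¹`, so its leading part drops out of the fourth
    -- condition.
    have h6 : (∑ a, mn (Dinv h ((L i).flux h (y i) (g i) a
        - algebraMap ℝ (TA m) (∑ j, S₀ a j * (y i).1 j + t₀ a * (y i).2.2.2)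
        - ((L i).Ta a * (L i).resA h (g i).2.1 (g i).2.2
          + (L i).Tb a * (L i).resB h (g i).2.1 (g i).2.2)) * pd (unitVec a) (L i).w))
        = (∑ a, mn (Dinv h ((L i).flux h (y i) (g i) a) * pd (unitVec a) (L i).w))
        - ∑ a, mn (Dinv h ((L i).srcFlux h (g i) a) * pd (unitVec a) (L i).w) := by
      rw [← Finset.sum_sub_distrib]
      refine Finset.sum_congr rfl fun a _ => ?_
      rw [map_sub, map_sub, Dinv_algebraMap, sub_zero, sub_mul, map_sub]
      rfl
    rw [h6]
    simp only [LinData.Phi, lam₀, LinData.src, Prod.snd_sub]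
    rw [show (L i).Wa * (L i).la h (y i) (g i) + (L i).Wb * (L i).lb h (y i) (g i)
      = ((L i).Wa - algebraMap ℝ (TA m) 1) * algebraMap ℝ (TA m) (y i).2.2.1
        + (L i).Wa * ((L i).la h (y i) (g i) - algebraMap ℝ (TA m) (y i).2.2.1
          - (L i).resA h (g i).2.1 (g i).2.2)
        + (L i).Wb * algebraMap ℝ (TA m) (y i).2.2.2
        + (L i).Wb * ((L i).lb h (y i) (g i) - algebraMap ℝ (TA m) (y i).2.2.2
          - (L i).resB h (g i).2.1 (g i).2.2)
        + ((L i).Wa * (L i).resA h (g i).2.1 (g i).2.2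
          + (L i).Wb * (L i).resB h (g i).2.1 (g i).2.2)
        + algebraMap ℝ (TA m) (y i).2.2.1 by rw [map_one]; ring]
    rw [map_add mn _ (algebraMap ℝ (TA m) _), mn_algebraMap, map_add mn _ ((L i).Wa * _ + _)]
    ring

omit hL in
-- Triangular elimination: the fourth entry is `mean λ₁`, and then the second gives `p`, uniformly
-- as `k ≤ 1`. The first entry minus `t₀` times the third is `K₀ mean μ`, which is inverted; the
-- third then gives `mean λ₂`.
theorem _root_.LowerTori.isBigO_of_lam₀ (hk : ∀ i, (L i).k ∈ Set.Icc (0 : ℝ) 1)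
    (hdet : (S₀ - Matrix.vecMulVec t₀ t₀).det ≠ 0)
    (hy : (fun i => lam₀ S₀ t₀ (L i).k (y i)) =O[⊤] δ) : y =O[⊤] δ := by
  obtain ⟨h1, h2, h3, h4⟩ := Par.isBigO_iff.1 hy
  simp only [lam₀] at h1 h2 h3 h4
  have hk1 : (fun i => (L i).k) =O[⊤] fun _ => (1 : ℝ) := isBigO_top_of_le 1 fun i => by
    rw [abs_of_nonneg (hk i).1]; simpa using (hk i).2
  have hp : (fun i => (y i).2.1) =O[⊤] δ := by
    have h5 := hk1.mul h4
    simp only [one_mul] at h5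
    refine (h2.add h5).congr_left fun i => by ring
  have hb : ∀ j, (fun i => (y i).1 j) =O[⊤] δ := by
    set K := S₀ - Matrix.vecMulVec t₀ t₀ with hK
    have hKy : ∀ i a, (K *ᵥ (y i).1) a = (∑ j, S₀ a j * (y i).1 j + t₀ a * (y i).2.2.2)
        - t₀ a * ((y i).2.2.2 + ∑ j, t₀ j * (y i).1 j) := by
      intro i a
      simp only [hK, Matrix.mulVec, dotProduct, Matrix.sub_apply, Matrix.vecMulVec_apply, sub_mul,
        Finset.sum_sub_distrib, mul_assoc, ← Finset.mul_sum]
      ring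
    have h5 : ∀ a, (fun i => (K *ᵥ (y i).1) a) =O[⊤] δ := fun a => by
      simp only [hKy]
      exact (h1 a).sub (h3.const_mul_left _)
    intro j
    have h6 : ∀ i, (y i).1 j = ∑ a, K⁻¹ j a * (K *ᵥ (y i).1) a := by
      intro i
      have : (K⁻¹ *ᵥ (K *ᵥ (y i).1)) j = (y i).1 j := by
        rw [Matrix.mulVec_mulVec, Matrix.nonsing_inv_mul _ (Ne.isUnit hdet), Matrix.one_mulVec]
      rw [← this]; rfl
    simp only [h6]
    exact isBigO_sum fun a => (h5 a).const_mul_left _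
  have hsum : (fun i => ∑ j, t₀ j * (y i).1 j) =O[⊤] δ :=
    isBigO_sum fun a => (hb a).const_mul_left _
  exact Par.isBigO_iff.2 ⟨hb, hp, h4, (h3.sub hsum).congr_left fun i => by ring⟩

/-- The linear part of the solvability conditions is bounded below. -/
theorem exists_norm_le (hdet : (S₀ - Matrix.vecMulVec t₀ t₀).det ≠ 0) :
    ∃ C, 0 ≤ C ∧ ∀ i (y : Par m), ‖y‖ ≤ C * (‖(L i).Lam h y‖ + |ε i| * ‖y‖) := by
  -- Taking all parameter vectors into the index set turns the asymptotic relation into an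
  -- inequality valid for every `y`.
  have hL' := hL.comp (fun q : I × Par m => q.1)
  have hy : (fun q : I × Par m => q.2) =O[⊤] fun q => ‖q.2‖ := by
    exact (Asymptotics.isBigO_refl _ _).norm_right
  have h1 := hL'.Phi_sub h hy (g := fun _ => 0) UO.zero
  have h2 : (fun q : I × Par m => (L q.1).Lam h q.2) =O[⊤]
      fun q => ‖(L q.1).Lam h q.2‖ + |ε q.1| * ‖q.2‖ :=
    Asymptotics.isBigO_top.2 ⟨1, fun q => by
      rw [one_mul, Real.norm_of_nonneg (by positivity)]
      have : 0 ≤ |ε q.1| * ‖q.2‖ := by positivity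
      linarith⟩
  have h3 : (fun q : I × Par m => ε q.1 * ‖q.2‖) =O[⊤]
      fun q => ‖(L q.1).Lam h q.2‖ + |ε q.1| * ‖q.2‖ := isBigO_top_of_le 1 fun q => by
    rw [one_mul, abs_mul, abs_norm]
    refine le_trans ?_ (le_abs_self _)
    have : 0 ≤ ‖(L q.1).Lam h q.2‖ := by positivity
    linarith
  have h4 := isBigO_of_lam₀ (L := fun q : I × Par m => L q.1) (y := fun q => q.2)
    hL'.k_mem hdet ((h2.sub (h1.trans h3)).congr_left fun q => by
      rw [LinData.src_zero, LinData.Lam_apply]; abel)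
  obtain ⟨C, hC⟩ := Asymptotics.isBigO_top.1 h4
  refine ⟨|C|, abs_nonneg C, fun i y => (hC (i, y)).trans ?_⟩
  rw [Real.norm_of_nonneg (by positivity)]
  exact mul_le_mul_of_nonneg_right (le_abs_self C) (by positivity)

/-- The parameters of a solution are controlled by the sources. -/
theorem isBigO_of_Phi_eq {C : ℝ} (hC : ∀ i (y : Par m), ‖y‖ ≤ C * ‖(L i).Lam h y‖) {R : I → Par m}
    (hR : ∀ i, (L i).Phi h (y i) (g i) = R i) (hsrc : (fun i => R i - (L i).src h (g i)) =O[⊤] δ)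
    (hg : UO (fun i => (g i).1) fun i => ε i * δ i) : y =O[⊤] δ := by
  have h0 : (fun _ : I => (0 : Par m)) =O[⊤] δ := Asymptotics.isBigO_zero _ _
  -- At `y = 0` the affine map `Phi` reduces to its inhomogeneous part, which is therefore the
  -- source up to `O(εδ)`.
  have h1 := hL.Phi_sub h h0 hg
  have hl : ∀ i, lam₀ S₀ t₀ (L i).k 0 = 0 := fun i => by
    simp [lam₀]; rfl
  simp only [hl, sub_zero] at h1
  have h2 : (fun i => (L i).Lam h (y i)) =O[⊤] δ :=
    (hsrc.sub (h1.trans (isBigO_mul_of_le_one hL.eps_le))).congr_left fun i => by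
      have := (L i).Phi_eq h (y i) (g i)
      rw [← hR, this]; abel
  exact (Asymptotics.isBigO_top.2 ⟨C, fun i => hC i (y i)⟩).trans h2

end Near

/-! ### The quadratic form -/

/-- The quadratic form in terms of `μ`, `f = J∂λ + Ωλ`, and `μ'`, `λ'`. -/
def LinData.quad (L : LinData m) (μ : Fin m → TA m) (fa fb : TA m) (μ' : Fin m → TA m)
    (la lb : TA m) : ℝ :=
  mn (∑ a, (∑ b, L.S a b * μ b) * μ' a - (fa * la + fb * lb))

/-- The right-hand sides of the second problem. -/
def LinData.rhs₂ (L : LinData m) : Rhs m := ((1 / 2 : ℝ) • (L.w * L.w), -(L.w * L.Wa), -(L.w * L.Wb))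

namespace Near
variable {I : Type*} {L : I → LinData m} {ε δ δ' : I → ℝ} {S₀ : Matrix (Fin m) (Fin m) ℝ}
  {t₀ : Fin m → ℝ} {ω : Fin m → ℝ} {τ : ℕ} {c₀ : ℝ} (h : Diophantine ω τ c₀)
  (hL : Near L ε S₀ t₀) {y : I → Par m} {g : I → Rhs m}
include hL

theorem quad_isBigO {μ μ' : Fin m → I → TA m} {fa fb la lb : I → TA m}
    (hμ : ∀ j, UO (μ j) δ) (hfa : UO fa δ) (hfb : UO fb δ) (hμ' : ∀ j, UO (μ' j) δ')
    (hla : UO la δ') (hlb : UO lb δ') :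
    (fun i => (L i).quad (fun j => μ j i) (fa i) (fb i) (fun j => μ' j i) (la i) (lb i))
      =O[⊤] fun i => δ i * δ' i := by
  have h1 := fun a b => ((hL.S_one a b).mul (hμ b)).one_mul
  have h2 := fun a => (UO.sum Finset.univ fun b _ => h1 a b).mul (hμ' a)
  exact ((UO.sum Finset.univ fun a _ => h2 a).sub ((hfa.mul hla).add (hfb.mul hlb))).mn

section
variable (hy : y =O[⊤] δ) (hg : UO (fun i => (g i).1) fun i => ε i * δ i)
include hy hg

theorem qa_UO : UO (fun i => (L i).qa h (y i) (g i)) δ := by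
  refine (((hL.qa_sub h hy hg).of_mul hL.eps_le).add
    (UO.const (Par.isBigO_iff.1 hy).2.1)).congr fun i => by ring

theorem qb_UO : UO (fun i => (L i).qb h (y i) (g i)) δ := by
  have h1 : (fun i => ∑ j, t₀ j * (y i).1 j) =O[⊤] δ :=
    isBigO_sum fun a => ((Par.isBigO_iff.1 hy).1 a).const_mul_left _
  refine (((hL.qb_sub h hy hg).of_mul hL.eps_le).add (UO.const h1)).congr fun i => by ring

variable (ha : UO (fun i => (g i).2.1) δ) (hb : UO (fun i => (g i).2.2) δ)
include ha hb

theorem la_UO : UO (fun i => (L i).la h (y i) (g i)) δ := by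
  refine ((((hL.la_sub h hy hg).of_mul hL.eps_le).add
    (UO.const (Par.isBigO_iff.1 hy).2.2.1)).add (resA_UO (L := L) h ha hb)).congr fun i => by ring

theorem lb_UO : UO (fun i => (L i).lb h (y i) (g i)) δ := by
  refine ((((hL.lb_sub h hy hg).of_mul hL.eps_le).add
    (UO.const (Par.isBigO_iff.1 hy).2.2.2)).add (hL.resB_UO h ha hb)).congr fun i => by ring

omit hy hg

theorem src_isBigO : (fun i => (L i).src h (g i)) =O[⊤] δ := by
  have hA := resA_UO (L := L) h ha hb
  have hB := hL.resB_UO h ha hb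
  have hf : ∀ a, UO (fun i => (L i).srcFlux h (g i) a) δ := fun a =>
    ((hL.Ta_one a).mul hA).one_mul.add ((hL.Tb_one a).mul hB).one_mul
  rw [Par.isBigO_iff]
  refine ⟨fun a => (hf a).mn, ha.mn.neg_left, hb.mn.neg_left, ?_⟩
  exact ((hL.Wa_one.mul hA).one_mul.add (hL.Wb_one.mul hB).one_mul).mn.add
    (isBigO_sum fun a => (((hf a).Dinv h).mul
      ((hL.w.mono hL.eps_isBigO_one).pd (unitVec a))).mul_one.mn)

end

variable {C : ℝ} (hC : ∀ i (y : Par m), ‖y‖ ≤ C * ‖(L i).Lam h y‖)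

section First
variable {y₁ : I → Par m} (h₁ : ∀ i, (L i).Phi h (y₁ i) 0 = (0, 0, 0, 1))
include hC h₁

theorem first_isBigO : y₁ =O[⊤] fun _ => (1 : ℝ) := by
  refine hL.isBigO_of_Phi_eq h (g := fun _ => 0) hC h₁ ?_ UO.zero
  simp only [LinData.src_zero, sub_zero]
  exact Asymptotics.isBigO_const_const _ one_ne_zero _

end First

section Second
variable {y₂ : I → Par m} (h₂ : ∀ i, (L i).Phi h (y₂ i) (L i).rhs₂ = 0)
  (hw : UO (fun i => (L i).w) δ)
include hw

/-- Since `g₁` is quadratic in `w`, one factor supplies `ε` and the other `δ`. -/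
theorem rhs₂_fst : UO (fun i => ((L i).rhs₂).1) fun i => ε i * δ i := by
  have h1 : (fun _ : I => (1 / 2 : ℝ)) =O[⊤] fun _ => (1 : ℝ) :=
    Asymptotics.isBigO_const_const _ one_ne_zero _
  exact (UO.smul h1 (hL.w.mul hw)).one_mul

theorem rhs₂_snd : UO (fun i => ((L i).rhs₂).2.1) δ := (hw.mul hL.Wa_one).mul_one.neg

theorem rhs₂_trd : UO (fun i => ((L i).rhs₂).2.2) δ := (hw.mul hL.Wb_one).mul_one.neg

include hC h₂

theorem second_isBigO : y₂ =O[⊤] δ := by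
  refine hL.isBigO_of_Phi_eq h (g := fun i => (L i).rhs₂) hC (R := fun _ => 0) h₂ ?_
    (hL.rhs₂_fst hw)
  simp only [zero_sub]
  exact (hL.src_isBigO h (hL.rhs₂_snd hw) (hL.rhs₂_trd hw)).neg_left

end Second

/-- The value of the quadratic form on two solutions of the linear problem. -/
def _root_.LowerTori.LinData.quadSol (L : LinData m) (y : Par m) (g : Rhs m) (y' : Par m)
    (g' : Rhs m) : ℝ :=
  L.quad (L.mu h y g) (g.2.1 - L.qa h y g) (g.2.2 - L.qb h y g) (L.mu h y' g') (L.la h y' g')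
    (L.lb h y' g')

theorem quadSol_isBigO {y' : I → Par m} {g' : I → Rhs m} (hy : y =O[⊤] δ)
    (hg : UO (fun i => (g i).1) fun i => ε i * δ i)
    (ha : UO (fun i => (g i).2.1) δ) (hb : UO (fun i => (g i).2.2) δ)
    (hy' : y' =O[⊤] δ') (hg' : UO (fun i => (g' i).1) fun i => ε i * δ' i)
    (ha' : UO (fun i => (g' i).2.1) δ') (hb' : UO (fun i => (g' i).2.2) δ') :
    (fun i => (L i).quadSol h (y i) (g i) (y' i) (g' i)) =O[⊤] fun i => δ i * δ' i :=
  hL.quad_isBigO (μ := fun j i => (L i).mu h (y i) (g i) j)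
    (μ' := fun j i => (L i).mu h (y' i) (g' i) j)
    (hL.mu_UO h hy hg) (ha.sub (hL.qa_UO h hy hg)) (hb.sub (hL.qb_UO h hy hg))
    (hL.mu_UO h hy' hg') (hL.la_UO h hy' hg' ha' hb') (hL.lb_UO h hy' hg' ha' hb')

/-- The factor of the fourth solvability condition in the direction of `mean λ₁`. -/
def _root_.LowerTori.LinData.kappa (L : LinData m) : ℝ :=
  mn L.Wa + ∑ a, mn (Dinv h (L.Ta a) * pd (unitVec a) L.w)

theorem kappa_sub : (fun i => (L i).kappa h - 1) =O[⊤] ε := by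
  have h1 := hL.Wa.mn.add (isBigO_sum fun a => (((hL.Ta a).Dinv h).mul
      ((hL.w.mono hL.eps_isBigO_one).pd (unitVec a))).mul_one.mn)
  refine h1.congr_left fun i => ?_
  simp only [LinData.kappa, map_sub, mn_algebraMap]
  ring

omit hL in
-- For `k = 0` the vector `(1,0)` is in the kernel of `Ω`, so constant `λ = (1,0)` with `μ = 0`, `p
-- = 0` satisfies the first two equations; only the flux `t₁` and the normalization remain.
theorem _root_.LowerTori.LinData.Lam_unit (L : LinData m) (hk : L.k = 0) :
    L.Lam h (0, 0, 1, 0) = (fun a => mn (L.Ta a), 0, 0, L.kappa h) := by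
  have hmu : ∀ j, L.mu h (0, 0, 1, 0) 0 j = 0 := fun j => by simp [LinData.mu]
  have hqa : L.qa h (0, 0, 1, 0) 0 = 0 := by simp [LinData.qa, hmu]
  have hqb : L.qb h (0, 0, 1, 0) 0 = 0 := by simp [LinData.qb, hmu]
  have hla : L.la h (0, 0, 1, 0) 0 = 1 := by simp [LinData.la, hqa, hqb, LinData.resA]
  have hlb : L.lb h (0, 0, 1, 0) 0 = 0 := by simp [LinData.lb, hqa, hqb, LinData.resB]
  have hfl : ∀ a, L.flux h (0, 0, 1, 0) 0 a = L.Ta a := fun a => by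
    simp [LinData.flux, hmu, hla, hlb]
  rw [LinData.Lam_apply, LinData.Phi]
  simp only [hfl, hqa, hqb, hla, hlb, hk, LinData.kappa]
  simp

/-! ### The first problem for `k = 0` -/

section Degenerate

theorem kappa_inv_sub (hκ : ∀ i, 1 / 2 ≤ (L i).kappa h) :
    (fun i => ((L i).kappa h)⁻¹ - 1) =O[⊤] ε := by
  obtain ⟨c, hc, hb⟩ := exists_of_isBigO_top (hL.kappa_sub h)
  refine isBigO_top_of_le (2 * c) fun i => ?_
  have h1 := hκ i
  have h2 := hb i
  have h3 : ((L i).kappa h)⁻¹ - 1 = -((L i).kappa h - 1) * ((L i).kappa h)⁻¹ := by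
    field_simp; ring
  have h4 : ((L i).kappa h)⁻¹ ≤ 2 := by
    rw [inv_le_comm₀ (by linarith) two_pos]; linarith
  have h5 : 0 ≤ ((L i).kappa h)⁻¹ := inv_nonneg.2 (by linarith)
  rw [h3, abs_mul, abs_neg, abs_of_nonneg h5]
  calc _ ≤ c * |ε i| * 2 := by gcongr
    _ = _ := by ring

/-- The deviation of the parameters of the first solution from the explicit solution which exists
for `k = 0` and `t₁` of mean value zero. -/
def _root_.LowerTori.LinData.dev (L : LinData m) (y : Par m) : Par m :=
  y - (L.kappa h)⁻¹ • (0, 0, 1, 0)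

omit hL in
-- Subtraction cancels the right-hand side `γ = 1`; the only remaining source is the mean of `t₁`,
-- which makes the deviation proportional to `μ₀`.
theorem Lam_dev (hk : ∀ i, (L i).k = 0) (hκ : ∀ i, 1 / 2 ≤ (L i).kappa h) {y₁ : I → Par m}
    (h₁ : ∀ i, (L i).Phi h (y₁ i) 0 = (0, 0, 0, 1)) (i : I) :
    (L i).Lam h ((L i).dev h (y₁ i))
      = (fun a => -((L i).kappa h)⁻¹ * mn ((L i).Ta a), 0, 0, 0) := by
  have hκ0 : (L i).kappa h ≠ 0 := by have := hκ i; positivity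
  rw [LinData.dev, map_sub, map_smul, LinData.Lam_unit h (L i) (hk i), LinData.Lam_apply, h₁ i]
  refine Prod.ext (funext fun a => ?_) (Prod.ext ?_ (Prod.ext ?_ ?_))
  · simp
  · simp
  · simp
  · simp [hκ0]

omit hL in
theorem mu_dev (L : LinData m) (y : Par m) (g : Rhs m) :
    L.mu h (L.dev h y) g = L.mu h y g := by
  ext1 j
  simp [LinData.mu, LinData.dev]

omit hL in
theorem qa_dev (L : LinData m) (y : Par m) (g : Rhs m) :
    L.qa h (L.dev h y) g = L.qa h y g := by
  simp only [LinData.qa, mu_dev]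
  simp [LinData.dev]

omit hL in
theorem qb_dev (L : LinData m) (y : Par m) (g : Rhs m) :
    L.qb h (L.dev h y) g = L.qb h y g := by
  simp only [LinData.qb, mu_dev]
  simp [LinData.dev]

omit hL in
theorem la_dev (L : LinData m) (y : Par m) (g : Rhs m) :
    L.la h y g = L.la h (L.dev h y) g + algebraMap ℝ (TA m) (L.kappa h)⁻¹ := by
  simp only [LinData.la, qa_dev, qb_dev]
  simp only [LinData.dev, Prod.snd_sub, Prod.fst_sub, map_sub, Prod.smul_snd, Prod.smul_fst,
    smul_eq_mul, mul_one]
  ring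

omit hL in
theorem lb_dev (L : LinData m) (y : Par m) (g : Rhs m) :
    L.lb h y g = L.lb h (L.dev h y) g := by
  simp only [LinData.lb, qa_dev, qb_dev]
  simp [LinData.dev]

omit hL in
-- The left argument enters only through `μ` and `g₂ - Tμ - pWᵀe₁`, neither of which sees `mean λ₁`.
theorem quadSol_dev_left (L : LinData m) (y y' : Par m) (g g' : Rhs m) :
    L.quadSol h (L.dev h y) g y' g' = L.quadSol h y g y' g' := by
  simp only [LinData.quadSol, qa_dev, qb_dev, mu_dev]

omit hL in
-- Changing `λ₁` by a constant changes the form by that constant times the mean of the first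
-- component of `Tμ + pWᵀe₁`, which is zero by the second solvability condition with `k = 0`.
theorem quadSol_dev_right (L : LinData m) (hk : L.k = 0) {y : Par m}
    (hy : L.Phi h y 0 = (0, 0, 0, 1)) :
    L.quadSol h (L.dev h y) 0 (L.dev h y) 0 = L.quadSol h y 0 y 0 := by
  have h1 : mn (L.qa h y 0) = 0 := by
    have := congrArg (fun q : Par m => q.2.1) hy
    simpa [LinData.Phi, hk] using this
  rw [quadSol_dev_left]
  simp only [LinData.quadSol, LinData.quad, mu_dev]
  rw [la_dev h L y 0, lb_dev h L y 0]
  have h2 : ∀ X q r l l' c : TA m, X - ((0 - q) * (l + c) + (0 - r) * l')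
      = X - ((0 - q) * l + (0 - r) * l') + c * q := fun X q r l l' c => by ring
  simp only [Prod.snd_zero, Prod.fst_zero]
  rw [h2, map_add, ← Algebra.smul_def, map_smul, h1, smul_zero, add_zero]

variable (hk : ∀ i, (L i).k = 0) (hκ : ∀ i, 1 / 2 ≤ (L i).kappa h) {μ₀ : I → Fin m → ℝ}
  (hμ₀ : ∀ i a, mn ((L i).Ta a) = ((S₀ - Matrix.vecMulVec t₀ t₀) *ᵥ μ₀ i) a)
  (hμδ : ∀ j, (fun i => μ₀ i j) =O[⊤] δ)
  {y₁ : I → Par m} (h₁ : ∀ i, (L i).Phi h (y₁ i) 0 = (0, 0, 0, 1))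
  (hdet : (S₀ - Matrix.vecMulVec t₀ t₀).det ≠ 0)
include hk hκ hμ₀ hμδ h₁ hC

omit hC hk hκ h₁ hL in
theorem mn_Ta_isBigO (a : Fin m) : (fun i => mn ((L i).Ta a)) =O[⊤] δ := by
  simp only [hμ₀, Matrix.mulVec, dotProduct]
  exact isBigO_sum fun b => (hμδ b).const_mul_left _

theorem dev_isBigO : (fun i => (L i).dev h (y₁ i)) =O[⊤] δ := by
  refine Asymptotics.IsBigO.trans (g := fun i => (L i).Lam h ((L i).dev h (y₁ i)))
    (Asymptotics.isBigO_top.2 ⟨C, fun i => hC i _⟩) ?_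
  simp only [Lam_dev h hk hκ h₁]
  have h0 := Asymptotics.isBigO_zero (E' := ℝ) (α := I) δ ⊤
  refine Par.isBigO_iff.2 ⟨fun a => ?_, h0, h0, h0⟩
  have h1 : (fun i => ((L i).kappa h)⁻¹) =O[⊤] fun _ => (1 : ℝ) :=
    (((hL.kappa_inv_sub h hκ).trans hL.eps_isBigO_one).add
      (Asymptotics.isBigO_refl (fun _ => (1 : ℝ)) ⊤)).congr_left fun i => by ring
  have h2 := h1.neg_left.mul (mn_Ta_isBigO hμ₀ hμδ a)
  simpa only [one_mul] using h2

include hdet in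
-- For `k = 0`, `lam₀` sends `(μ₀, 0, 0, -t₀·μ₀)` to `(K₀μ₀, 0, 0, 0)`, the vector of the mean of
-- `t₁`. The errors are the perturbation of `lam₀` and `κ⁻¹ - 1`, both `O(ε)` relative to `δ`.
theorem dev_add_isBigO : (fun i => (L i).dev h (y₁ i) + (μ₀ i, 0, 0, -∑ j, t₀ j * μ₀ i j))
    =O[⊤] fun i => ε i * δ i := by
  have hdev := hL.dev_isBigO h hC hk hκ hμ₀ hμδ h₁
  have h1 := hL.Phi_sub h hdev (g := fun _ => 0) UO.zero
  refine isBigO_of_lam₀ hL.k_mem hdet ?_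
  have h0 := Asymptotics.isBigO_zero (E' := ℝ) (α := I) (fun i => ε i * δ i) ⊤
  have h2 : (fun i => ((fun a => (-(((L i).kappa h)⁻¹ - 1)) * mn ((L i).Ta a), 0, 0, 0) : Par m))
      =O[⊤] fun i => ε i * δ i :=
    Par.isBigO_iff.2 ⟨fun a => (hL.kappa_inv_sub h hκ).neg_left.mul (mn_Ta_isBigO hμ₀ hμδ a),
      h0, h0, h0⟩
  refine (h2.sub h1).congr_left fun i => ?_
  rw [LinData.src_zero, ← LinData.Lam_apply, Lam_dev h hk hκ h₁]
  have h3 : ∀ a, mn ((L i).Ta a) = ∑ j, S₀ a j * μ₀ i j - t₀ a * ∑ j, t₀ j * μ₀ i j := fun a => by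
    simp only [hμ₀, Matrix.mulVec, dotProduct, Matrix.sub_apply, Matrix.vecMulVec_apply, sub_mul,
        Finset.sum_sub_distrib, mul_assoc, ← Finset.mul_sum]
  refine Prod.ext (funext fun a => ?_) (Prod.ext ?_ (Prod.ext ?_ ?_))
  · simp only [lam₀, hk, Prod.fst_sub, Pi.sub_apply, Prod.fst_add, Prod.snd_add, Pi.add_apply,
      mul_add, Finset.sum_add_distrib, Prod.fst_zero, Pi.zero_apply]
    rw [h3]; ring
  · simp [lam₀, hk]
  · simp only [lam₀, Prod.fst_sub, Prod.snd_sub, Prod.fst_add, Prod.snd_add, Pi.add_apply,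
      mul_add, Finset.sum_add_distrib, Prod.fst_zero, Prod.snd_zero]
    ring
  · simp [lam₀]

include hdet in
/-- The leading part of `L₁₁` for `k = 0`. -/
theorem quadSol_first_sub : (fun i => (L i).quadSol h (y₁ i) 0 (y₁ i) 0
    - ((S₀ - Matrix.vecMulVec t₀ t₀) *ᵥ μ₀ i) ⬝ᵥ μ₀ i) =O[⊤] fun i => ε i * δ i * δ i := by
  have hdev := hL.dev_isBigO h hC hk hκ hμ₀ hμδ h₁
  have hadd := Par.isBigO_iff.1 (hL.dev_add_isBigO h hC hk hκ hμ₀ hμδ h₁ hdet)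
  obtain ⟨z, hz⟩ : ∃ z : I → Par m, ∀ i, (L i).dev h (y₁ i) = z i := ⟨_, fun _ => rfl⟩
  simp only [hz] at hdev hadd
  have hc := Par.isBigO_iff.1 hdev
  have hg : UO (fun i => ((fun _ => 0 : I → Rhs m) i).1) fun i => ε i * δ i := UO.zero
  have hz0 : UO (fun _ : I => (0 : TA m)) δ := UO.zero
  set K := S₀ - Matrix.vecMulVec t₀ t₀ with hK
  have hr : ∀ j, (fun i => (z i).1 j + μ₀ i j) =O[⊤] fun i => ε i * δ i := hadd.1
  have hp : (fun i => (z i).2.1) =O[⊤] fun i => ε i * δ i :=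
    hadd.2.1.congr_left fun i => by simp
  have hs : (fun i => (z i).2.2.2 - ∑ j, t₀ j * μ₀ i j) =O[⊤] fun i => ε i * δ i :=
    hadd.2.2.2.congr_left fun i => by simp [sub_eq_add_neg]
  have hqa : UO (fun i => (L i).qa h (z i) 0) fun i => ε i * δ i :=
    ((hL.qa_sub h hdev hg).add (UO.const hp)).congr fun i => by ring
  have hla := hL.la_UO h hdev hg hz0 hz0
  have hlb := hL.lb_UO h hdev hg hz0 hz0
  have hlbs : UO (fun i => (L i).lb h (z i) 0 - algebraMap ℝ (TA m) (z i).2.2.2)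
      fun i => ε i * δ i := (hL.lb_sub h hdev hg).congr fun i => by
    simp [LinData.resB]
  have ht : (fun i => ∑ j, t₀ j * (z i).1 j) =O[⊤] δ :=
    isBigO_sum fun a => (hc.1 a).const_mul_left _
  -- the three parts of the quadratic form
  have e1 := hqa.mul hla
  have e2 := ((hL.qb_sub h hdev hg).mul hlb).add ((UO.const ht).mul hlbs).mul_comm
  have e3 := fun a b => (((((hL.S a b).mul (hL.mu_UO h hdev hg b)).add
    ((UO.fixed (algebraMap ℝ (TA m) (S₀ a b))).mul (hL.mu_sub h hdev hg b)).one_mul).mul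
      (hL.mu_UO h hdev hg a))).add
    ((UO.const ((hc.1 b).const_mul_left (S₀ a b))).mul (hL.mu_sub h hdev hg a)).mul_comm
  have e4 := ((UO.sum Finset.univ fun a _ => UO.sum Finset.univ fun b _ => e3 a b).add
    (e1.add e2)).mn
  -- What is left is algebra in the parameters. `f1` replaces `mean λ₂` by `-t₀·mean μ`, turning
  -- `S₀` into `K₀`; the difference of `f2` and `f3` replaces `mean μ` by `-μ₀`, without using
  -- symmetry of `K₀`.
  have f1 : (fun i => (∑ j, t₀ j * (z i).1 j) * ((z i).2.2.2 - ∑ j, t₀ j * μ₀ i j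
      + ∑ j, t₀ j * ((z i).1 j + μ₀ i j))) =O[⊤] fun i => ε i * δ i * δ i :=
    (ht.mul (hs.add (isBigO_sum fun j => (hr j).const_mul_left _))).congr_right fun i => by ring
  have f2 : (fun i => ∑ a, ∑ b, K a b * (((z i).1 b + μ₀ i b) * (z i).1 a)) =O[⊤]
      fun i => ε i * δ i * δ i :=
    isBigO_sum fun a => isBigO_sum fun b => ((hr b).mul (hc.1 a)).const_mul_left _
  have f3 : (fun i => ∑ a, ∑ b, K a b * (((z i).1 a + μ₀ i a) * μ₀ i b)) =O[⊤]
      fun i => ε i * δ i * δ i :=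
    isBigO_sum fun a => isBigO_sum fun b => ((hr a).mul (hμδ b)).const_mul_left _
  refine (((e4.add f1).add f2).sub f3).congr_left fun i => ?_
  rw [← quadSol_dev_right h (L i) (hk i) (h₁ i)]
  rw [hz]
  have g1 : ∀ a b, ((L i).S a b - algebraMap ℝ (TA m) (S₀ a b)) * (L i).mu h (z i) 0 b
      + algebraMap ℝ (TA m) (S₀ a b) * ((L i).mu h (z i) 0 b - algebraMap ℝ (TA m) ((z i).1 b))
      = (L i).S a b * (L i).mu h (z i) 0 b
        - algebraMap ℝ (TA m) (S₀ a b * (z i).1 b) := fun a b => by rw [map_mul]; ring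
  have g2 : ∀ a b, ((L i).S a b * (L i).mu h (z i) 0 b
        - algebraMap ℝ (TA m) (S₀ a b * (z i).1 b)) * (L i).mu h (z i) 0 a
      + algebraMap ℝ (TA m) (S₀ a b * (z i).1 b)
        * ((L i).mu h (z i) 0 a - algebraMap ℝ (TA m) ((z i).1 a))
      = (L i).S a b * (L i).mu h (z i) 0 b * (L i).mu h (z i) 0 a
        - algebraMap ℝ (TA m) (S₀ a b * (z i).1 b * (z i).1 a) := fun a b => by
    rw [map_mul _ (_ * _)]; ring
  simp only [g1, g2, Finset.sum_sub_distrib]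
  have g3 : (L i).quadSol h (z i) 0 (z i) 0 = mn (∑ a, ∑ b, (L i).S a b * (L i).mu h (z i) 0 b
      * (L i).mu h (z i) 0 a) + mn ((L i).qa h (z i) 0 * (L i).la h (z i) 0)
      + mn ((L i).qb h (z i) 0 * (L i).lb h (z i) 0) := by
    rw [LinData.quadSol, LinData.quad, ← map_add, ← map_add]
    simp only [Finset.sum_mul, Prod.snd_zero, Prod.fst_zero]
    congr 1
    ring
  have g4 : ((L i).qb h (z i) 0 - algebraMap ℝ (TA m) (∑ j, t₀ j * (z i).1 j))
        * (L i).lb h (z i) 0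
      + algebraMap ℝ (TA m) (∑ j, t₀ j * (z i).1 j)
        * ((L i).lb h (z i) 0 - algebraMap ℝ (TA m) (z i).2.2.2)
      = (L i).qb h (z i) 0 * (L i).lb h (z i) 0
        - algebraMap ℝ (TA m) ((∑ j, t₀ j * (z i).1 j) * (z i).2.2.2) := by
    rw [map_mul]; ring
  rw [g3, g4]
  simp only [map_add, map_sub, map_sum, mn_algebraMap]
  have g5 : (K *ᵥ μ₀ i) ⬝ᵥ μ₀ i = ∑ a, ∑ b, K a b * (μ₀ i b * μ₀ i a) := by
    simp only [Matrix.mulVec, dotProduct, Finset.sum_mul, mul_assoc]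
  have g6 : ∑ a, ∑ b, S₀ a b * (z i).1 b * (z i).1 a
      = ∑ a, ∑ b, K a b * ((z i).1 b * (z i).1 a)
        + (∑ j, t₀ j * (z i).1 j) * ∑ j, t₀ j * (z i).1 j := by
    rw [Finset.sum_mul_sum, ← Finset.sum_add_distrib]
    refine Finset.sum_congr rfl fun a _ => ?_
    rw [← Finset.sum_add_distrib]
    refine Finset.sum_congr rfl fun b _ => ?_
    rw [hK, Matrix.sub_apply, Matrix.vecMulVec_apply]; ring
  rw [g5, g6]
  have g7 : ∑ a, ∑ b, K a b * (((z i).1 b + μ₀ i b) * (z i).1 a)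
      = ∑ a, ∑ b, K a b * ((z i).1 b * (z i).1 a) + ∑ a, ∑ b, K a b * (μ₀ i b * (z i).1 a) := by
    simp only [add_mul, mul_add, Finset.sum_add_distrib]
  have g8 : ∑ a, ∑ b, K a b * (((z i).1 a + μ₀ i a) * μ₀ i b)
      = ∑ a, ∑ b, K a b * (μ₀ i b * (z i).1 a) + ∑ a, ∑ b, K a b * (μ₀ i b * μ₀ i a) := by
    simp only [← Finset.sum_add_distrib]
    exact Finset.sum_congr rfl fun a _ => Finset.sum_congr rfl fun b _ => by ring
  rw [g7, g8]
  simp only [mul_add, Finset.sum_add_distrib]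
  ring

end Degenerate

end Near

/-! ### The lower bound of the quadratic form of the second problem -/

section Energy
variable {ω : Fin m → ℝ} {τ : ℕ} {c₀ : ℝ} (h : Diophantine ω τ c₀)

/-- Pair the equation for `Res h k f` with `Res h k f` and integrate by parts; the mean of `f` is
invisible since the resolvent has mean zero. -/
theorem mn_mul_Res_self {k : ℝ} (hk : 0 ≤ k) (f : TA m) :
    mn (f * Res h k f) = k * mn (Res h k f * Res h k f)
      + mn (pd ω (Res h k f) * pd ω (Res h k f)) := by
  have h1 := congrArg (fun u => mn (u * Res h k f)) (Res_eq h hk f)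
  simp only [sub_mul, map_sub, ← Algebra.smul_def, map_smul, mn_Res, smul_mul_assoc,
    smul_eq_mul, mul_zero, sub_zero] at h1
  rw [← h1, mn_mul_pd, mul_comm (pd ω (pd ω _)), mn_mul_pd]
  ring

/-- The variational lower bound of the quadratic form of the resolvent. -/
theorem le_mn_mul_Res {k : ℝ} (hk : 0 ≤ k) (F φ : TA m) :
    2 * mn (F * φ) - 2 * (mn F * mn φ) - k * mn (φ * φ) - mn (pd ω φ * pd ω φ)
      ≤ mn (F * Res h k F) := by
  have h1 := mn_mul_Res_self h hk F
  have h2 := congrArg (fun u => mn (u * φ)) (Res_eq h hk F)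
  simp only [sub_mul, map_sub, ← Algebra.smul_def, map_smul, smul_mul_assoc,
    smul_eq_mul] at h2
  have h3 := mn_mul_pd ω φ (pd ω (Res h k F))
  rw [mul_comm φ] at h3
  set g := Res h k F
  -- Expand the nonnegative quantity `k‖g - φ‖² + ‖∂(g - φ)‖²`. The cross terms are evaluated by
  -- pairing the resolvent equation with `φ`, which produces the correction `mn F * mn φ`.
  have h4 := mul_nonneg hk (mn_sq_nonneg (g - φ))
  have h5 := mn_sq_nonneg (pd ω (g - φ))
  have h6 : (g - φ) * (g - φ) = g * g - (2 : ℝ) • (g * φ) + φ * φ := by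
    rw [two_smul]; ring
  have h7 : pd ω (g - φ) * pd ω (g - φ)
      = pd ω g * pd ω g - (2 : ℝ) • (pd ω φ * pd ω g) + pd ω φ * pd ω φ := by
    rw [two_smul, map_sub]; ring
  rw [h6] at h4
  rw [h7] at h5
  simp only [map_add, map_sub, map_smul, smul_eq_mul] at h4 h5
  linarith

/-- With `R` the resolvent of `fa - ∂fb`, the components are `λ₁ = -R` and `λ₂ = -∂R + fb - mean
fb`. Integration by parts leaves one resolvent form minus the variance of `fb`, which makes a lower
bound accessible. -/
theorem LinData.mn_res (L : LinData m) (hk : 0 ≤ L.k) (fa fb : TA m) :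
    -mn (fa * L.resA h fa fb + fb * L.resB h fa fb)
      = mn ((fa - pd ω fb) * Res h L.k (fa - pd ω fb)) - mn (fb * fb) + mn fb ^ 2 := by
  have h1 := Res_eq h hk fb
  obtain ⟨R, hR⟩ : ∃ R, Res h L.k (fa - pd ω fb) = R := ⟨_, rfl⟩
  have h2 : L.resB h fa fb = -pd ω R + fb - algebraMap ℝ (TA m) (mn fb) := by
    rw [LinData.resB, ← hR]
    simp only [map_sub, map_smul, Res_pd]
    linear_combination h1
  rw [LinData.resA, h2, hR]
  have h3 : fa * -R + fb * (-pd ω R + fb - algebraMap ℝ (TA m) (mn fb))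
    = -(fa * R) - fb * pd ω R + fb * fb - algebraMap ℝ (TA m) (mn fb) * fb := by ring
  rw [h3, map_sub, map_add, map_sub, map_neg, ← Algebra.smul_def, map_smul, mn_mul_pd, sub_mul,
    map_sub, smul_eq_mul]
  ring

/-- The square root of `mean (w (1 - ∂²)⁻¹ w)`. -/
def LinData.en (L : LinData m) : ℝ := Real.sqrt (mn (L.w * Res h 1 L.w))

theorem LinData.hasSum_en_sq (L : LinData m) :
    HasSum (fun s => resolventWeight ω 1 s * ‖cf L.w s‖ ^ 2) (L.en h ^ 2) := by
  have h1 := hasSum_mn_quad (φ := resSymb h 1) (ρ := resolventWeight ω 1) (fun _ => rfl) L.w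
  rw [LinData.en, Real.sq_sqrt]
  · exact h1
  · exact h1.nonneg fun s => mul_nonneg (resolventWeight_nonneg _ _ _) (by positivity)

theorem LinData.en_nonneg (L : LinData m) : 0 ≤ L.en h := Real.sqrt_nonneg _

theorem LinData.en_sq (L : LinData m) : L.en h ^ 2
    = mn (Res h 1 L.w * Res h 1 L.w) + mn (pd ω (Res h 1 L.w) * pd ω (Res h 1 L.w)) := by
  have h1 := mn_mul_Res_self h zero_le_one L.w
  rw [one_mul] at h1
  rw [LinData.en, Real.sq_sqrt, h1]
  rw [h1]
  exact add_nonneg (mn_sq_nonneg _) (mn_sq_nonneg _)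

theorem theta_sq_le (ω : Fin m → ℝ) (s : Fin m → ℤ) :
    theta ω s ^ 2 ≤ (∑ j, ω j ^ 2) * ∑ j, (s j : ℝ) ^ 2 :=
  Finset.sum_mul_sq_le_sq_mul_sq _ _ _

theorem sum_sq_le_len (s : Fin m → ℤ) : ∑ j, (s j : ℝ) ^ 2 ≤ len s ^ 2 := by
  have h1 := eucl_intCast_le s
  rw [eucl] at h1
  exact (Real.sqrt_le_left (len_nonneg s)).1 h1

/-- Fourier coefficients grow at most linearly, measured by the energy. -/
theorem LinData.norm_cf_le (L : LinData m) (hw : mn L.w = 0) (s : Fin m → ℤ) :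
    ‖cf L.w s‖ ≤ Real.sqrt (1 + ∑ j, ω j ^ 2) * (1 + len s) * L.en h := by
  have hl := len_nonneg s
  have hΩ : 0 ≤ ∑ j, ω j ^ 2 := Finset.sum_nonneg fun _ _ => sq_nonneg _
  by_cases hs : s = 0
  · subst hs
    rw [cf_zero, hw, Complex.ofReal_zero, norm_zero]
    have := L.en_nonneg h
    positivity
  have h1 := (L.hasSum_en_sq h).summable.le_tsum s fun t _ =>
    mul_nonneg (resolventWeight_nonneg _ _ _) (by positivity)
  rw [(L.hasSum_en_sq h).tsum_eq, resolventWeight, if_neg hs, abs_one, inv_mul_le_iff₀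
    (by positivity)] at h1
  refine (pow_le_pow_iff_left₀ (norm_nonneg _)
    (by have := L.en_nonneg h; positivity) two_ne_zero).1 ?_
  rw [mul_pow, mul_pow, Real.sq_sqrt (by positivity)]
  refine h1.trans (mul_le_mul_of_nonneg_right ?_ (sq_nonneg _))
  have h2 := theta_sq_le ω s
  have h3 := mul_le_mul_of_nonneg_left (sum_sq_le_len s) hΩ
  nlinarith

end Energy

/-! ### Estimates of `w` through its energy -/

section Family
variable {I : Type*} {L : I → LinData m} {ε δ : I → ℝ} {S₀ : Matrix (Fin m) (Fin m) ℝ}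
  {t₀ : Fin m → ℝ} {ω : Fin m → ℝ} {τ : ℕ} {c₀ : ℝ} (h : Diophantine ω τ c₀)
  (hw : ∀ i, mn (L i).w = 0)
include hw

/-- Pairing with `w` gains the energy norm. -/
theorem mn_w_mul_isBigO {u : I → TA m} (hu : UO u δ) :
    (fun i => mn ((L i).w * u i)) =O[⊤] fun i => (L i).en h * δ i := by
  obtain ⟨r, hr, c, hc, hd⟩ := hu
  obtain ⟨K, hK0, hK⟩ := exists_pow_mul_exp_le 1 (half_lt_self hr)
  set B := Real.sqrt (1 + ∑ j, ω j ^ 2) with hB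
  have hB0 : 0 ≤ B := Real.sqrt_nonneg _
  refine isBigO_top_of_le (B * c * K * ∑' s : Fin m → ℤ, Real.exp (-(r / 2 * len s))) fun i => ?_
  have h1 := hasSum_mn_mul (L i).w (u i)
  have hN := (L i).en_nonneg h
  have h2 := ((summable_exp_len (m := m) (half_pos hr)).hasSum.mul_left
    (B * c * K * ((L i).en h * |δ i|)))
  rw [← Real.norm_eq_abs, ← Complex.norm_real, ← h1.tsum_eq]
  refine (tsum_of_norm_bounded h2 fun s => ?_).trans (le_of_eq ?_)
  · have h3 := hd i (-s)
    have h4 := (L i).norm_cf_le h (hw i) s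
    rw [len_neg] at h3
    have h5 := hK (len s) (len_nonneg s)
    rw [pow_one] at h5
    have hl := len_nonneg s
    -- The coefficients of `w` grow at most linearly relative to the energy; the exponential decay
    -- of `u` absorbs this.
    rw [norm_mul]
    calc ‖cf (L i).w s‖ * ‖cf (u i) (-s)‖
        ≤ (B * (1 + len s) * (L i).en h) * (c * |δ i| * Real.exp (-(r * len s))) := by
          gcongr; exact h3
      _ = B * c * ((L i).en h * |δ i|) * ((1 + len s) * Real.exp (-(r * len s))) := by ring
      _ ≤ B * c * ((L i).en h * |δ i|) * (K * Real.exp (-(r / 2 * len s))) := by gcongr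
      _ = _ := by ring
  · rw [abs_mul, abs_of_nonneg hN]; ring

/-- Interpolation between the analytic bound and the energy norm. -/
theorem UO_w_interp (hwε : UO (fun i => (L i).w) ε) :
    UO (fun i => (L i).w) fun i => Real.sqrt (|ε i| * (L i).en h) := by
  obtain ⟨r, hr, c, hc, hd⟩ := hwε
  obtain ⟨K, hK0, hK⟩ := exists_pow_mul_exp_le 1 (half_lt_self hr)
  set B := Real.sqrt (1 + ∑ j, ω j ^ 2) with hB
  have hB0 : 0 ≤ B := Real.sqrt_nonneg _
  refine ⟨r / 4, by positivity, Real.sqrt (c * B * K), Real.sqrt_nonneg _, fun i s => ?_⟩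
  have hN := (L i).en_nonneg h
  have h3 := hd i s
  have h4 := (L i).norm_cf_le h (hw i) s
  have h5 := hK (len s) (len_nonneg s)
  rw [pow_one] at h5
  have hl := len_nonneg s
  rw [abs_of_nonneg (Real.sqrt_nonneg _)]
  refine (pow_le_pow_iff_left₀ (norm_nonneg _) (by positivity) two_ne_zero).1 ?_
  rw [mul_pow, mul_pow, Real.sq_sqrt (by positivity), Real.sq_sqrt (by positivity),
    ← Real.exp_nat_mul, sq]
  -- One factor takes the analytic bound, the other the energy bound. The square root of the product
  -- halves the remaining exponent `r/2`, which explains `r/4`.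
  calc ‖coef (L i).w.1 s‖ * ‖coef (L i).w.1 s‖
      ≤ (c * |ε i| * Real.exp (-(r * len s))) * (B * (1 + len s) * (L i).en h) := by
        gcongr; exact h4
    _ = c * B * (|ε i| * (L i).en h) * ((1 + len s) * Real.exp (-(r * len s))) := by ring
    _ ≤ c * B * (|ε i| * (L i).en h) * (K * Real.exp (-(r / 2 * len s))) := by gcongr
    _ = _ := by
      rw [show ((2 : ℕ) : ℝ) * -(r / 4 * len s) = -(r / 2 * len s) by push_cast; ring]
      ring

end Family

/-! ### The second problem measured in the energy -/

namespace Near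
variable {I : Type*} {L : I → LinData m} {ε δ : I → ℝ} {S₀ : Matrix (Fin m) (Fin m) ℝ}
  {t₀ : Fin m → ℝ} {ω : Fin m → ℝ} {τ : ℕ} {c₀ : ℝ} (h : Diophantine ω τ c₀)
  (hL : Near L ε S₀ t₀) (hw : ∀ i, mn (L i).w = 0)
include hL hw

/-- Two interpolated factors `sqrt(ε en)` multiply to `ε en`; the purely analytic bound of `w²`
would contain no energy. -/
theorem rhs₂_fst_en : UO (fun i => ((L i).rhs₂).1) fun i => ε i * (L i).en h := by
  have h1 := UO_w_interp h hw hL.w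
  have h2 : (fun _ : I => (1 / 2 : ℝ)) =O[⊤] fun _ => (1 : ℝ) :=
    Asymptotics.isBigO_const_const _ one_ne_zero _
  refine (UO.smul h2 (h1.mul h1)).one_mul.mono (isBigO_top_of_le 1 fun i => ?_)
  have hN := (L i).en_nonneg h
  rw [Real.mul_self_sqrt (by positivity), abs_mul, abs_mul, abs_abs, one_mul]

/-- By symmetry of the resolvent and integration by parts all operators pass to `v`, leaving `w`
paired with an analytic function of size `δ`. -/
theorem mn_mul_resA_isBigO {v : I → TA m} (hv : UO v δ) :
    (fun i => mn (v i * (L i).resA h (L i).rhs₂.2.1 (L i).rhs₂.2.2))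
      =O[⊤] fun i => (L i).en h * δ i := by
  have hR := hv.Res h fun i => (L i).k
  have h1 := ((hL.Wa_one.mul hR).one_mul.add (hL.Wb_one.mul (hR.pd ω)).one_mul)
  refine (mn_w_mul_isBigO h hw h1).congr_left fun i => ?_
  set R := Res h (L i).k (v i) with hR'
  have h2 := mn_mul_Res h (L i).k (v i) ((L i).rhs₂.2.1 - pd ω (L i).rhs₂.2.2)
  rw [← hR'] at h2
  have h3 : v i * (L i).resA h (L i).rhs₂.2.1 (L i).rhs₂.2.2
      = -(v i * Res h (L i).k ((L i).rhs₂.2.1 - pd ω (L i).rhs₂.2.2)) := by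
    rw [LinData.resA]; ring
  rw [h3, map_neg, h2, mul_sub, map_sub, mn_mul_pd, sub_neg_eq_add, ← map_add, ← map_neg]
  congr 1
  simp only [LinData.rhs₂]
  ring

theorem mn_mul_resB_isBigO {v : I → TA m} (hv : UO v δ) :
    (fun i => mn (v i * (L i).resB h (L i).rhs₂.2.1 (L i).rhs₂.2.2))
      =O[⊤] fun i => (L i).en h * δ i := by
  have hR := hv.Res h fun i => (L i).k
  have h1 := ((hL.Wa_one.mul (hR.pd ω)).one_mul.add
    (hL.Wb_one.mul (UO.smul hL.k_isBigO_one hR).one_mul).one_mul).neg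
  refine (mn_w_mul_isBigO h hw h1).congr_left fun i => ?_
  set R := Res h (L i).k (v i) with hR'
  have h2 := mn_mul_Res h (L i).k (v i) (pd ω (L i).rhs₂.2.1 - (L i).k • (L i).rhs₂.2.2)
  rw [← hR'] at h2
  have h3 : v i * (L i).resB h (L i).rhs₂.2.1 (L i).rhs₂.2.2
      = -(v i * Res h (L i).k (pd ω (L i).rhs₂.2.1 - (L i).k • (L i).rhs₂.2.2)) := by
    rw [LinData.resB]; ring
  rw [h3, map_neg, h2, mul_sub, map_sub, mn_mul_pd, sub_eq_add_neg, ← map_neg, ← map_neg,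
    ← map_add, ← map_neg]
  congr 1
  simp only [LinData.rhs₂, Algebra.smul_def]
  ring

/-- Each entry pairs `w` or a resolvent of `g₂` with something of size `ε`. Constant leading parts
of `Tb` and `Wa` may be removed, since `w` and the resolvents have mean zero; in the fourth entry
the derivative is moved off `w`. -/
theorem src_rhs₂_isBigO : (fun i => (L i).src h (L i).rhs₂) =O[⊤] fun i => (L i).en h * ε i := by
  have hf : ∀ a, UO (fun i => (L i).srcFlux h (L i).rhs₂ a) ε := fun a =>
    ((hL.Ta_one a).mul (resA_UO (L := L) h (hL.rhs₂_snd hL.w) (hL.rhs₂_trd hL.w))).one_mul.add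
      ((hL.Tb_one a).mul (hL.resB_UO h (hL.rhs₂_snd hL.w) (hL.rhs₂_trd hL.w))).one_mul
  rw [Par.isBigO_iff]
  refine ⟨fun a => ?_, ?_, ?_, ?_⟩
  · refine ((hL.mn_mul_resA_isBigO h hw (hL.Ta a)).add
      (hL.mn_mul_resB_isBigO h hw (hL.Tb a))).congr_left fun i => ?_
    simp only [LinData.src, LinData.srcFlux, sub_mul, map_sub, map_add, ← Algebra.smul_def,
      map_smul]
    simp [LinData.resB]
  · refine (mn_w_mul_isBigO h hw hL.Wa).congr_left fun i => ?_
    simp [LinData.src, LinData.rhs₂, mul_sub, hw]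
  · refine (mn_w_mul_isBigO h hw hL.Wb).congr_left fun i => ?_
    simp [LinData.src, LinData.rhs₂]
  · refine (((hL.mn_mul_resA_isBigO h hw hL.Wa).add
      (hL.mn_mul_resB_isBigO h hw hL.Wb)).add (isBigO_sum fun a =>
      (mn_w_mul_isBigO h hw (((hf a).Dinv h).pd (unitVec a))).neg_left)).congr_left fun i => ?_
    simp only [LinData.src, sub_mul, map_sub, map_add, ← Algebra.smul_def, map_smul, mn_mul_pd,
      mul_comm (L i).w]
    simp [LinData.resA]

variable {C : ℝ} (hC : ∀ i (y : Par m), ‖y‖ ≤ C * ‖(L i).Lam h y‖)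
  {y₂ : I → Par m} (h₂ : ∀ i, (L i).Phi h (y₂ i) (L i).rhs₂ = 0)
include hC h₂

/-- Apply `Phi_sub` at `y = 0` with `δ = en`: both the remainder and the source are `O(ε en)`, and
the linear part is boundedly invertible. -/
theorem second_isBigO_en : y₂ =O[⊤] fun i => ε i * (L i).en h := by
  have h0 := Asymptotics.isBigO_zero (E' := Par m) (α := I) (fun i => (L i).en h) ⊤
  have h1 := hL.Phi_sub h h0 (hL.rhs₂_fst_en h hw)
  have hs := (hL.src_rhs₂_isBigO h hw).congr_right fun i => mul_comm _ _
  have hl : ∀ i, lam₀ S₀ t₀ (L i).k 0 = 0 := fun i => by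
    simp [lam₀]; rfl
  simp only [hl, sub_zero] at h1
  refine (Asymptotics.isBigO_top.2 ⟨C, fun i => hC i (y₂ i)⟩ :
    y₂ =O[⊤] fun i => (L i).Lam h (y₂ i)).trans ?_
  refine ((h1.add hs).neg_left).congr_left fun i => ?_
  have := (L i).Phi_eq h (y₂ i) (L i).rhs₂
  rw [h₂ i] at this
  rw [sub_add_cancel, eq_comm, ← add_eq_zero_iff_eq_neg, ← this]

/-- The quadratic form of the second problem, up to small errors. -/
theorem quadSol_second_sub : (fun i => (L i).quadSol h (y₂ i) (L i).rhs₂ (y₂ i) (L i).rhs₂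
    + mn ((L i).rhs₂.2.1 * (L i).resA h (L i).rhs₂.2.1 (L i).rhs₂.2.2
        + (L i).rhs₂.2.2 * (L i).resB h (L i).rhs₂.2.1 (L i).rhs₂.2.2))
    =O[⊤] fun i => ε i * (L i).en h ^ 2 := by
  have hy := hL.second_isBigO_en h hw hC h₂
  have hyc := Par.isBigO_iff.1 hy
  have hyN : y₂ =O[⊤] fun i => (L i).en h := hy.trans (isBigO_mul_of_le_one hL.eps_le)
  have hg := hL.rhs₂_fst_en h hw
  obtain ⟨ρ, hρ⟩ : ∃ ρ : I → ℝ, ∀ i, ε i * (L i).en h = ρ i := ⟨_, fun _ => rfl⟩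
  have hρρ : (fun i => ρ i * ρ i) =O[⊤] fun i => ε i * (L i).en h ^ 2 :=
    isBigO_top_of_le 1 fun i => by
      rw [← hρ, one_mul, show ε i * (L i).en h * (ε i * (L i).en h)
        = ε i * (ε i * (L i).en h ^ 2) by ring, abs_mul]
      exact mul_le_of_le_one_left (abs_nonneg _) (hL.eps_le i)
  have hNρ : (fun i => (L i).en h * ρ i) =O[⊤] fun i => ε i * (L i).en h ^ 2 :=
    isBigO_top_of_le 1 fun i => by
      rw [← hρ, one_mul, show (L i).en h * (ε i * (L i).en h) = ε i * (L i).en h ^ 2 by ring]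
  have hmu : ∀ j, UO (fun i => (L i).mu h (y₂ i) (L i).rhs₂ j) ρ := fun j => by
    have := (hL.mu_sub h hyN hg j).add (UO.const (hyc.1 j))
    simp only [hρ, sub_add_cancel] at this
    exact this
  have hqa : UO (fun i => (L i).qa h (y₂ i) (L i).rhs₂) ρ := by
    have := (hL.qa_sub h hyN hg).add (UO.const hyc.2.1)
    simp only [hρ, sub_add_cancel] at this
    exact this
  have hqb : UO (fun i => (L i).qb h (y₂ i) (L i).rhs₂) ρ := by
    have := (hL.qb_sub h hyN hg).add (UO.const (isBigO_sum fun j => (hyc.1 j).const_mul_left (t₀ j)))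
    simp only [hρ, sub_add_cancel] at this
    exact this
  have hla : UO (fun i => (L i).la h (y₂ i) (L i).rhs₂
      - (L i).resA h (L i).rhs₂.2.1 (L i).rhs₂.2.2) ρ := by
    have := (hL.la_sub h hyN hg).add (UO.const hyc.2.2.1)
    simp only [hρ] at this
    exact this.congr fun i => by ring
  have hlb : UO (fun i => (L i).lb h (y₂ i) (L i).rhs₂
      - (L i).resB h (L i).rhs₂.2.1 (L i).rhs₂.2.2) ρ := by
    have := (hL.lb_sub h hyN hg).add (UO.const hyc.2.2.2)
    simp only [hρ] at this
    exact this.congr fun i => by ring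
  -- The four remainders: the `μ` part; `g₂` against the correction of `λ`; `Tμ + pWᵀe₁` against the
  -- resolvent of `g₂`; and the product of the two corrections.
  have e1 := (UO.sum Finset.univ fun a _ => (UO.sum Finset.univ fun b _ =>
    ((hL.S_one a b).mul (hmu b)).one_mul).mul (hmu a)).mn.trans hρρ
  have e2 := (mn_w_mul_isBigO h hw ((hL.Wa_one.mul hla).one_mul.add
    (hL.Wb_one.mul hlb).one_mul)).trans hNρ
  have e3 := ((hL.mn_mul_resA_isBigO h hw hqa).add (hL.mn_mul_resB_isBigO h hw hqb)).trans hNρ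
  have e4 := ((hqa.mul hla).add (hqb.mul hlb)).mn.trans hρρ
  refine (((e1.add e2).add e3).add e4).congr_left fun i => ?_
  simp only [LinData.quadSol, LinData.quad]
  rw [← map_add, ← map_add, ← map_add, ← map_add, ← map_add]
  congr 1
  simp only [LinData.rhs₂]
  ring

end Near

/-- Bound `c` uniformly and use `2|XY| ≤ X² + Y²`. Only mean squares of `X` and `Y` enter, which is
what the energy controls. -/
theorem mn_mul_mul_isBigO {I : Type*} {c X Y : I → TA m} {δ N : I → ℝ} (hc : UO c δ)
    (hX : ∀ i, mn (X i * X i) ≤ N i ^ 2) (hY : ∀ i, mn (Y i * Y i) ≤ N i ^ 2) :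
    (fun i => mn (c i * (X i * Y i))) =O[⊤] fun i => δ i * N i ^ 2 := by
  obtain ⟨K, hK, hb⟩ := hc.sup
  refine isBigO_top_of_le K fun i => ?_
  have h1 : ∀ x, |(c i * (X i * Y i)).1 x|
      ≤ ((K * |δ i| / 2) • (X i * X i + Y i * Y i) : TA m).1 x := fun x => by
    change |(c i).1 x * ((X i).1 x * (Y i).1 x)|
      ≤ K * |δ i| / 2 * ((X i).1 x * (X i).1 x + (Y i).1 x * (Y i).1 x)
    rw [abs_mul]
    have h2 : |(X i).1 x * (Y i).1 x| ≤ ((X i).1 x * (X i).1 x + (Y i).1 x * (Y i).1 x) / 2 := by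
      rw [abs_le]
      constructor <;> nlinarith [sq_nonneg ((X i).1 x + (Y i).1 x),
        sq_nonneg ((X i).1 x - (Y i).1 x)]
    calc _ ≤ K * |δ i| * (((X i).1 x * (X i).1 x + (Y i).1 x * (Y i).1 x) / 2) := by
          gcongr; exact hb i x
      _ = _ := by ring
  have h3 : mn ((K * |δ i| / 2) • (X i * X i + Y i * Y i) : TA m) ≤ K * |δ i * N i ^ 2| := by
    rw [map_smul, map_add, smul_eq_mul, abs_mul, abs_of_nonneg (sq_nonneg (N i))]
    have h4 : 0 ≤ K * |δ i| := by positivity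
    nlinarith [hX i, hY i]
  refine abs_le.2 ⟨?_, (mn_mono fun x => (le_abs_self _).trans (h1 x)).trans h3⟩
  have h5 : mn (-(c i * (X i * Y i))) ≤ K * |δ i * N i ^ 2| :=
    (mn_mono fun x => (neg_le_abs _).trans (h1 x)).trans h3
  rw [map_neg] at h5
  linarith

theorem LinData.w_eq {ω : Fin m → ℝ} {τ : ℕ} {c₀ : ℝ} (h : Diophantine ω τ c₀) (L : LinData m)
    (hw : mn L.w = 0) : L.w = Res h 1 L.w - pd ω (pd ω (Res h 1 L.w)) := by
  have h1 := Res_eq h zero_le_one L.w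
  rw [hw, map_zero, sub_zero, one_smul] at h1
  exact h1.symm

/-- The trial function in the variational bound. -/
theorem mn_trial (ω : Fin m → ℝ) (Wa b H : TA m) :
    2 * mn (-((H - pd ω (pd ω H)) * Wa) * (b * pd ω H - H))
      - mn ((b * pd ω H - H) * (b * pd ω H - H))
      - mn ((pd ω (b * pd ω H - H) + (H - pd ω (pd ω H)) * b)
        * (pd ω (b * pd ω H - H) + (H - pd ω (pd ω H)) * b))
    = mn (H * H) + mn (pd ω H * pd ω H)
      + mn ((Wa - 1 + (Wa - 1) - b * b) * (H * H))
      + mn ((pd ω Wa + pd ω Wa + b + b + b + b - Wa * b - Wa * b - b * pd ω b - b * pd ω b)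
        * (H * pd ω H))
      + mn ((Wa - 1 + (Wa - 1) - (pd ω Wa * b + Wa * pd ω b) - b * b - pd ω b * pd ω b
        + pd ω b + pd ω b) * (pd ω H * pd ω H)) := by
  have h1 := mn_mul_pd ω (Wa * H) (pd ω H)
  have h2 := mn_mul_pd ω (Wa * b) (pd ω H * pd ω H)
  rw [pd_mul] at h1
  rw [pd_mul, pd_mul] at h2
  rw [map_sub, pd_mul]
  set H1 := pd ω H
  set H2 := pd ω H1
  -- `Z1 = ∂(Wa H ∂H)` and `Z2 = ∂(Wa b (∂H)²)` are total derivatives; they remove the second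
  -- derivatives of `H`, which the energy does not control.
  obtain ⟨Z1, hZ1⟩ : ∃ Z, Wa * H * H2 + (pd ω Wa * H + Wa * H1) * H1 = Z := ⟨_, rfl⟩
  obtain ⟨Z2, hZ2⟩ : ∃ Z, Wa * b * (H2 * H1 + H1 * H2)
    + (pd ω Wa * b + Wa * pd ω b) * (H1 * H1) = Z := ⟨_, rfl⟩
  have f1 : mn Z1 = 0 := by rw [← hZ1, map_add, h1]; ring
  have f2 : mn Z2 = 0 := by rw [← hZ2, map_add, h2]; ring
  have key : -((H - H2) * Wa) * (b * H1 - H) + -((H - H2) * Wa) * (b * H1 - H)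
      - (b * H1 - H) * (b * H1 - H)
      - (pd ω b * H1 + b * H2 - H1 + (H - H2) * b) * (pd ω b * H1 + b * H2 - H1 + (H - H2) * b)
      = H * H + H1 * H1 + (Wa - 1 + (Wa - 1) - b * b) * (H * H)
      + (pd ω Wa + pd ω Wa + b + b + b + b - Wa * b - Wa * b - b * pd ω b - b * pd ω b) * (H * H1)
      + (Wa - 1 + (Wa - 1) - (pd ω Wa * b + Wa * pd ω b) - b * b - pd ω b * pd ω b
        + pd ω b + pd ω b) * (H1 * H1) - (Z1 + Z1) + Z2 := by
    rw [← hZ1, ← hZ2]; ring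
  have h3 := congrArg mn key
  rw [map_sub, map_sub, map_add, map_add, map_sub, map_add, map_add, map_add, map_add, map_add,
    f1, f2] at h3
  linarith

namespace Near
variable {I : Type*} {L : I → LinData m} {ε δ : I → ℝ} {S₀ : Matrix (Fin m) (Fin m) ℝ}
  {t₀ : Fin m → ℝ} {ω : Fin m → ℝ} {τ : ℕ} {c₀ : ℝ} (h : Diophantine ω τ c₀)
  (hL : Near L ε S₀ t₀) (hw : ∀ i, mn (L i).w = 0)
include hL hw

/-- Lower bound of the leading part of the quadratic form of the second problem. -/
theorem exists_le_res : ∃ c, 0 ≤ c ∧ ∀ i, (1 - c * |ε i|) * (L i).en h ^ 2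
    ≤ -mn ((L i).rhs₂.2.1 * (L i).resA h (L i).rhs₂.2.1 (L i).rhs₂.2.2
        + (L i).rhs₂.2.2 * (L i).resB h (L i).rhs₂.2.1 (L i).rhs₂.2.2) := by
  have hN := fun i => (L i).en_sq h
  have hX : ∀ i, mn (Res h 1 (L i).w * Res h 1 (L i).w) ≤ (L i).en h ^ 2 := fun i => by
    rw [hN]; linarith [mn_sq_nonneg (pd ω (Res h 1 (L i).w))]
  have hY : ∀ i, mn (pd ω (Res h 1 (L i).w) * pd ω (Res h 1 (L i).w)) ≤ (L i).en h ^ 2 :=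
    fun i => by rw [hN]; linarith [mn_sq_nonneg (Res h 1 (L i).w)]
  have ha : UO (fun i => (L i).Wa - 1) ε := by simpa using hL.Wa
  have hda : UO (fun i => pd ω (L i).Wa) ε := by
    have := hL.Wa.pd ω
    simpa only [map_sub, pd_algebraMap, sub_zero] using this
  have hdb := hL.Wb.pd ω
  have hbb := (hL.Wb_one.mul hL.Wb).one_mul
  have hWb := (hL.Wa_one.mul hL.Wb).one_mul
  have hbd := (hL.Wb_one.mul hdb).one_mul
  have h1 := mn_mul_mul_isBigO ((ha.add ha).sub hbb) hX hX
  have h2 := mn_mul_mul_isBigO ((((((((((hda.add hda).add hL.Wb).add hL.Wb).add hL.Wb).add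
    hL.Wb).sub hWb).sub hWb).sub hbd).sub hbd)) hX hY
  have h3 := mn_mul_mul_isBigO (((((((ha.add ha).sub ((hda.mul hL.Wb_one).mul_one.add
    (hL.Wa_one.mul hdb).one_mul)).sub hbb).sub ((hdb.mono hL.eps_isBigO_one).mul hdb).one_mul).add
      hdb).add hdb)) hY hY
  have h4 := ((mn_w_mul_isBigO h hw hL.Wa).mul (mn_w_mul_isBigO h hw (hdb.Res h fun _ => 1)))
  have h5 : (fun i => (L i).en h * ε i * ((L i).en h * ε i)) =O[⊤]
      fun i => ε i * (L i).en h ^ 2 := isBigO_top_of_le 1 fun i => by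
    rw [one_mul, show (L i).en h * ε i * ((L i).en h * ε i)
        = ε i * (ε i * (L i).en h ^ 2) by ring, abs_mul]
    exact mul_le_of_le_one_left (abs_nonneg _) (hL.eps_le i)
  obtain ⟨c, hc, hb⟩ := exists_of_isBigO_top
    (((h1.add h2).add h3).sub ((h4.trans h5).const_mul_left 2))
  refine ⟨c, hc, fun i => ?_⟩
  have h6 := (abs_le.1 (hb i)).1
  rw [abs_mul, abs_of_nonneg (sq_nonneg ((L i).en h))] at h6
  have hk := hL.k_mem i
  rw [LinData.mn_res h _ hk.1]
  set H := Res h 1 (L i).w with hH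
  -- To leading order the source is `-w`, so `-H` is the natural trial function. The term `Wb ∂H`
  -- makes the second derivative of `H` cancel in `∂φ + w Wb`.
  set φ := (L i).Wb * pd ω H - H with hφ
  have h7 := le_mn_mul_Res h hk.1 ((L i).rhs₂.2.1 - pd ω (L i).rhs₂.2.2) φ
  have h8 := mn_trial ω (L i).Wa (L i).Wb H
  have h9 := mul_le_mul_of_nonneg_right hk.2 (mn_sq_nonneg φ)
  have hwH := (L i).w_eq h (hw i)
  rw [← hwH, ← hφ] at h8
  have e1 : mn ((L i).rhs₂.2.1 - pd ω (L i).rhs₂.2.2)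
      = -mn ((L i).w * ((L i).Wa - algebraMap ℝ (TA m) 1)) := by
    simp [LinData.rhs₂, mul_sub, hw]
  have e2 : mn φ = -mn ((L i).w * Res h 1 (pd ω (L i).Wb)) := by
    rw [hφ, map_sub, mn_mul_pd, hH, mn_Res, sub_zero, mn_mul_Res, mul_comm]
  have ega : (L i).rhs₂.2.1 = -((L i).w * (L i).Wa) := rfl
  have egb : (L i).w * (L i).Wb = -(L i).rhs₂.2.2 := by simp [LinData.rhs₂]
  rw [e1, e2] at h7
  rw [← ega, egb] at h8
  set ga := (L i).rhs₂.2.1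
  set gb := (L i).rhs₂.2.2
  have e3 : mn ((ga - pd ω gb) * φ) = mn (ga * φ) + mn (gb * pd ω φ) := by
    rw [mn_mul_pd, sub_mul, map_sub, sub_eq_add_neg]
  -- The term `-mean(gb²)` from the variance completes the square with `2 mean(gb ∂φ) -
  -- mean((∂φ)²)`.
  have e4 : mn ((pd ω φ + -gb) * (pd ω φ + -gb))
      = mn (pd ω φ * pd ω φ) - 2 * mn (gb * pd ω φ) + mn (gb * gb) := by
    have : (pd ω φ + -gb) * (pd ω φ + -gb)
        = pd ω φ * pd ω φ - (gb * pd ω φ + gb * pd ω φ) + gb * gb := by ring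
    rw [this, map_add, map_sub, map_add]; ring
  rw [e3] at h7
  rw [e4] at h8
  have h10 := hN i
  rw [← hH] at h10
  have h11 := sq_nonneg (mn gb)
  linarith

/-- Lower bound of the quadratic form of the second problem. -/
theorem exists_le_quadSol_second {C : ℝ} (hC : ∀ i (y : Par m), ‖y‖ ≤ C * ‖(L i).Lam h y‖)
    {y₂ : I → Par m} (h₂ : ∀ i, (L i).Phi h (y₂ i) (L i).rhs₂ = 0) :
    ∃ c, 0 ≤ c ∧ ∀ i, (1 - c * |ε i|) * (L i).en h ^ 2
      ≤ (L i).quadSol h (y₂ i) (L i).rhs₂ (y₂ i) (L i).rhs₂ := by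
  obtain ⟨c, hc, hb⟩ := hL.exists_le_res h hw
  obtain ⟨c', hc', hb'⟩ := exists_of_isBigO_top (hL.quadSol_second_sub h hw hC h₂)
  refine ⟨c + c', by positivity, fun i => ?_⟩
  have h1 := hb i
  have h2 := (abs_le.1 (hb' i)).1
  rw [abs_mul, abs_of_nonneg (sq_nonneg ((L i).en h))] at h2
  linarith

end Near

/-! ### Comparison of the energy with the Sobolev norm -/

theorem norm_fourierHat_sq (u : (Fin m → ℝ) → ℝ) (s : Fin m → ℤ) :
    ‖fourierHat u s‖ ^ 2 = (2 * Real.pi) ^ m * ‖coef u s‖ ^ 2 := by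
  have hπ : 0 < 2 * Real.pi := by positivity
  have h1 : ∀ ξ : Fin m → ℝ, Complex.exp (-Complex.I * ((∑ i, (s i : ℝ) * ξ i : ℝ) : ℂ))
      = char (-s) (toC ξ) := fun ξ => by
    rw [char]
    congr 1
    push_cast
    simp only [Pi.neg_apply, toC, Int.cast_neg, neg_mul, Finset.sum_neg_distrib, mul_neg]
  have h2 : ((2 * Real.pi) ^ (-(m : ℝ) / 2)) ^ 2 = ((2 * Real.pi) ^ m)⁻¹ := by
    rw [← Real.rpow_natCast, ← Real.rpow_mul hπ.le, ← Real.rpow_natCast, ← Real.rpow_neg hπ.le]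
    congr 1
    push_cast; ring
  rw [fourierHat, coef, mean]
  simp only [h1]
  rw [norm_mul, norm_smul, mul_pow, mul_pow, Complex.norm_real, Real.norm_of_nonneg (by positivity),
    Real.norm_of_nonneg (by positivity), h2]
  field_simp
  ring

/-- The energy norm controls the Sobolev norm of order `-1`. -/
theorem LinData.sobolev_le {ω : Fin m → ℝ} {τ : ℕ} {c₀ : ℝ} (h : Diophantine ω τ c₀)
    (L : LinData m) (hw : mn L.w = 0) : sobolevNorm (-1) L.w.1 ^ 2
      ≤ (1 + ∑ j, ω j ^ 2) * (2 * Real.pi) ^ m * L.en h ^ 2 := by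
  have hΩ : 0 ≤ ∑ j, ω j ^ 2 := Finset.sum_nonneg fun _ _ => sq_nonneg _
  have hs : ∀ s : Fin m → ℤ, 0 ≤ ∑ i, (s i : ℝ) ^ 2 := fun s =>
    Finset.sum_nonneg fun _ _ => sq_nonneg _
  have h0 : ∀ s : Fin m → ℤ, 0 ≤ (1 + ∑ i, (s i : ℝ) ^ 2) ^ (-1 : ℝ)
      * ‖fourierHat L.w.1 s‖ ^ 2 := fun s => by
    have := hs s
    positivity
  have h1 := (L.hasSum_en_sq h).mul_left ((1 + ∑ j, ω j ^ 2) * (2 * Real.pi) ^ m)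
  have h2 : ∀ s : Fin m → ℤ, (1 + ∑ i, (s i : ℝ) ^ 2) ^ (-1 : ℝ) * ‖fourierHat L.w.1 s‖ ^ 2
      ≤ (1 + ∑ j, ω j ^ 2) * (2 * Real.pi) ^ m
        * (resolventWeight ω 1 s * ‖cf L.w s‖ ^ 2) := fun s => by
    rw [norm_fourierHat_sq, Real.rpow_neg_one]
    have hs' := hs s
    by_cases h3 : s = 0
    · subst h3
      have h4 : coef L.w.1 0 = 0 := by
        have := cf_zero L.w
        rw [hw, Complex.ofReal_zero] at this
        exact this
      rw [h4]
      simp [resolventWeight]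
    · rw [resolventWeight, if_neg h3, abs_one]
      have h4 := theta_sq_le ω s
      -- By Cauchy–Schwarz, `1 + (ω·s)² ≤ (1 + |ω|²)(1 + |s|²)`.
      have h5 : (1 + ∑ i, (s i : ℝ) ^ 2)⁻¹ ≤ (1 + ∑ j, ω j ^ 2) * (1 + theta ω s ^ 2)⁻¹ := by
        rw [← div_eq_mul_inv, inv_eq_one_div, div_le_div_iff₀ (by positivity) (by positivity)]
        nlinarith
      calc _ ≤ (1 + ∑ j, ω j ^ 2) * (1 + theta ω s ^ 2)⁻¹
            * ((2 * Real.pi) ^ m * ‖coef L.w.1 s‖ ^ 2) := by gcongr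
        _ = _ := by rw [cf]; ring
  rw [sobolevNorm, Real.sq_sqrt (tsum_nonneg h0)]
  exact hasSum_le h2 (Summable.of_nonneg_of_le h0 h2 h1.summable).hasSum h1

/-! ### The linear problem for functions and for elements of the algebra -/

namespace TA

/-- Evaluation at a point. -/
def ev (ξ : Fin m → ℝ) : TA m →ₐ[ℝ] ℝ := (Pi.evalAlgHom ℝ _ ξ).comp (analyticAlg m).val

theorem ext_ev {f g : TA m} (h : ∀ ξ, ev ξ f = ev ξ g) : f = g := Subtype.ext (funext h)

theorem mn_eq_mean (f : TA m) : mn f = mean fun ξ => ev ξ f := rfl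

theorem grad_apply {f : (Fin m → ℝ) → ℝ} {F : TA m} {c : ℝ} (hf : ∀ ξ, f ξ = ev ξ F + c)
    (ξ : Fin m → ℝ) (j : Fin m) : grad f ξ j = ev ξ (pd (unitVec j) F) := by
  have h1 : f = fun ξ => F.1 ξ + c := funext hf
  rw [grad, h1, fderiv_add_const, fderiv_apply]
  rfl

theorem dir_apply {a : ℕ} {f : (Fin m → ℝ) → (Fin a → ℝ)} {F : Fin a → TA m}
    (hf : ∀ ξ j, f ξ j = ev ξ (F j)) (ω ξ : Fin m → ℝ) (j : Fin a) :
    dir ω f ξ j = ev ξ (pd ω (F j)) := by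
  have h1 : f = fun ξ j => (F j).1 ξ := funext fun ξ => funext fun j => hf ξ j
  rw [dir, h1, fderiv_pi fun i => (F i).differentiableAt ξ]
  exact fderiv_apply (F j) ξ ω

/-- Functions on the torus as elements of the algebra of analytic functions. -/
def toTA (f : (Fin m → ℝ) → ℝ) : TA m := open Classical in
  if h : f ∈ analyticAlg m then ⟨f, h⟩ else 0

theorem ev_toTA {f : (Fin m → ℝ) → ℝ} (h : f ∈ analyticAlg m) (ξ : Fin m → ℝ) :
    ev ξ (toTA f) = f ξ := by
  rw [toTA, dif_pos h]; rfl

/-- Functions which are analytic on the open strip of width `R`, and bounded on smaller strips. -/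
def regAlg (m : ℕ) (R : ℝ) (hR : 0 < R) : Subalgebra ℝ (TA m) where
  carrier := {f | ∀ r < R, ∃ M, Decays f.1 r M}
  mul_mem' := by
    intro f g hf hg r hr
    obtain ⟨s, hs, hsR⟩ := exists_between (max_lt hr hR)
    obtain ⟨M, hM⟩ := hf s hsR
    obtain ⟨N, hN⟩ := hg s hsR
    exact ⟨_, (Decays.mul f.continuous f.periodic g.continuous g.periodic (le_max_right r 0) hs
      hM hN).mono (le_max_left r 0) le_rfl⟩
  add_mem' := by
    intro f g hf hg r hr
    obtain ⟨M, hM⟩ := hf r hr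
    obtain ⟨N, hN⟩ := hg r hr
    exact ⟨_, hM.add f.continuous g.continuous hN⟩
  algebraMap_mem' c r _ := ⟨|c|, decays_const c r⟩

/-- Multipliers lose an arbitrarily small width, so the open strip of width `R` is kept. Hence the
solutions lie in any fixed smaller strip, whereas the uniform estimates lose an unspecified amount.
-/
theorem mult_mem_regAlg {R : ℝ} {hR : 0 < R} (φ : Symb m) {f : TA m} (hf : f ∈ regAlg m R hR) :
    mult φ f ∈ regAlg m R hR := by
  intro r hr
  obtain ⟨s, hs, hsR⟩ := exists_between hr
  obtain ⟨M, hM⟩ := hf s hsR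
  obtain ⟨K, τ, hK⟩ := φ.bdd
  obtain ⟨K', hK'⟩ := exists_mult_decay (m := m) K τ hs
  refine ⟨K' * M, fun t => ?_⟩
  have h1 := cf_mult φ f t
  simp only [cf] at h1
  rw [h1]
  exact hK' _ M _ hK hM t

theorem anNorm_lt_top_of_mem {R r : ℝ} {hR : 0 < R} (hr0 : 0 < r) (hr : r < R) {f : TA m}
    (hf : f ∈ regAlg m R hR) : anNorm r 0 f.1 < ⊤ := by
  obtain ⟨s, hs, hsR⟩ := exists_between hr
  obtain ⟨M, hM⟩ := hf s hsR
  exact anNorm_lt_top_of_decays f hr0 hs hM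

end TA

theorem vecNorm_lt_top {a : ℕ} {r : ℝ} {d : ℕ} {f : (Fin m → ℝ) → (Fin a → ℝ)} :
    vecNorm r d f < ⊤ ↔ ∀ j, anNorm r d (fun ξ => f ξ j) < ⊤ := by
  rw [vecNorm]
  refine ⟨fun h j => (le_iSup (fun i => anNorm r d fun ξ => f ξ i) j).trans_lt h, fun h => ?_⟩
  rw [← Finset.sup_univ_eq_iSup]
  exact (Finset.sup_lt_iff (by simp)).2 fun j _ => h j

/-- `L` and `U` represent the coefficients `A` in the algebra of analytic functions. -/
structure Represents (A : Coeffs m) (k : ℝ) (L : LinData m) (U : Fin m → Fin m → TA m) : Prop where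
  k : L.k = k
  w₁ : ∀ ξ, A.w₁ ξ = ev ξ L.w + mean A.w₁
  Wa : ∀ ξ, A.W ξ 0 0 = ev ξ L.Wa
  Wb : ∀ ξ, A.W ξ 0 1 = ev ξ L.Wb
  S : ∀ a b ξ, A.S ξ a b = ev ξ (L.S a b)
  Ta : ∀ j ξ, A.T ξ 0 j = ev ξ (L.Ta j)
  Tb : ∀ j ξ, A.T ξ 1 j = ev ξ (L.Tb j)
  V : ∀ a b ξ, (A.V ξ)⁻¹ a b = ev ξ (U a b)

/-- The functions `μ`, `(la, lb)`, `χ` represent the unknowns `X`. -/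
structure RepresentsSol (X : Unknowns m) (μ : Fin m → TA m) (la lb : TA m) (χ : Fin m → TA m) :
    Prop where
  mu : ∀ ξ j, X.mu ξ j = ev ξ (μ j)
  la : ∀ ξ, X.lam ξ 0 = ev ξ la
  lb : ∀ ξ, X.lam ξ 1 = ev ξ lb
  chi : ∀ ξ j, X.chi ξ j = ev ξ (χ j)

section Bridge
variable {A : Coeffs m} {k r γ : ℝ} {L : LinData m} {U : Fin m → Fin m → TA m} {ω : Fin m → ℝ}
  {X : Unknowns m} {μ χ : Fin m → TA m} {la lb : TA m}
  {g₁ : (Fin m → ℝ) → ℝ} {g₂ : (Fin m → ℝ) → (Fin 2 → ℝ)} {g : Rhs m}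

theorem RepresentsSol.lam (hX : RepresentsSol X μ la lb χ) (ξ : Fin m → ℝ) (j : Fin 2) :
    X.lam ξ j = ev ξ (![la, lb] j) := by
  fin_cases j
  · exact hX.la ξ
  · exact hX.lb ξ

theorem J_Omega_zero (k : ℝ) (v u : Fin 2 → ℝ) :
    (J *ᵥ v + Omega k *ᵥ u) 0 = -(k * u 0) + v 1 := by
  simp [J, Omega, dotProduct, Fin.sum_univ_two]; ring

theorem J_Omega_one (k : ℝ) (v u : Fin 2 → ℝ) : (J *ᵥ v + Omega k *ᵥ u) 1 = u 1 - v 0 := by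
  simp [J, Omega, dotProduct, Fin.sum_univ_two]; ring

/-- Pointwise equations are equations in the algebra, because evaluations separate its elements. `V`
occurs only in the final condition, so it can be treated apart from the rest. -/
theorem solves_iff (hA : Represents A k L U) (hX : RepresentsSol X μ la lb χ)
    (hg₁ : ∀ ξ, g₁ ξ = ev ξ g.1) (hga : ∀ ξ, g₂ ξ 0 = ev ξ g.2.1)
    (hgb : ∀ ξ, g₂ ξ 1 = ev ξ g.2.2) :
    Solves A ω k r g₁ g₂ γ X ↔
      (vecNorm r 0 X.mu < ⊤ ∧ vecNorm r 0 X.lam < ⊤ ∧ vecNorm r 0 X.chi < ⊤) ∧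
      AlgSol ω L g γ μ la lb χ X.p ∧ ∀ i, ∑ j, mn (U j i * χ j) = 0 := by
  have hw := fun ξ j => grad_apply hA.w₁ ξ j
  have hg := grad_apply (f := g₁) (F := g.1) (c := 0) fun ξ => by rw [add_zero, hg₁]
  have hmu := dir_apply hX.mu ω
  have hlam := dir_apply hX.lam ω
  have hchi := dir_apply hX.chi ω
  have e1 : (∀ ξ, dir ω X.mu ξ = -(X.p • grad A.w₁ ξ) - grad g₁ ξ) ↔
      ∀ j, pd ω (μ j) = -(X.p • pd (unitVec j) L.w) - pd (unitVec j) g.1 := by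
    simp only [funext_iff, Pi.sub_apply, Pi.neg_apply, Pi.smul_apply, hmu, hw, hg, smul_eq_mul]
    refine ⟨fun h j => ext_ev fun ξ => ?_, fun h ξ j => ?_⟩
    · simpa using h ξ j
    · rw [h j]; simp
  have e2 : (∀ ξ, J *ᵥ dir ω X.lam ξ + Omega k *ᵥ X.lam ξ + A.T ξ *ᵥ X.mu ξ
      + X.p • ((A.W ξ)ᵀ *ᵥ Pi.single 0 1) = g₂ ξ) ↔
      (-(L.k • la) + pd ω lb + (∑ j, L.Ta j * μ j + X.p • L.Wa) = g.2.1 ∧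
        lb - pd ω la + (∑ j, L.Tb j * μ j + X.p • L.Wb) = g.2.2) := by
    have hWe : ∀ ξ i, ((A.W ξ)ᵀ *ᵥ Pi.single 0 1) i = A.W ξ 0 i := fun ξ i => by simp
    have h0 : ∀ ξ, (J *ᵥ dir ω X.lam ξ + Omega k *ᵥ X.lam ξ + A.T ξ *ᵥ X.mu ξ
        + X.p • ((A.W ξ)ᵀ *ᵥ Pi.single 0 1)) 0
        = ev ξ (-(L.k • la) + pd ω lb + (∑ j, L.Ta j * μ j + X.p • L.Wa)) := fun ξ => by
      rw [Pi.add_apply, Pi.add_apply, J_Omega_zero, ← hA.k, Pi.smul_apply, hWe]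
      simp only [Matrix.mulVec, dotProduct, hlam, hX.la, hX.mu, hA.Ta, hA.Wa, map_add, map_neg,
        map_smul, map_sum, map_mul, smul_eq_mul]
      exact add_assoc _ _ _
    have h1 : ∀ ξ, (J *ᵥ dir ω X.lam ξ + Omega k *ᵥ X.lam ξ + A.T ξ *ᵥ X.mu ξ
        + X.p • ((A.W ξ)ᵀ *ᵥ Pi.single 0 1)) 1
        = ev ξ (lb - pd ω la + (∑ j, L.Tb j * μ j + X.p • L.Wb)) := fun ξ => by
      rw [Pi.add_apply, Pi.add_apply, J_Omega_one, Pi.smul_apply, hWe]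
      simp only [Matrix.mulVec, dotProduct, hlam, hX.lb, hX.mu, hA.Tb, hA.Wb, map_add, map_sub,
        map_smul, map_sum, map_mul, smul_eq_mul]
      exact add_assoc _ _ _
    constructor
    · intro h
      exact ⟨ext_ev fun ξ => by rw [← h0, h, hga], ext_ev fun ξ => by rw [← h1, h, hgb]⟩
    · rintro ⟨ha, hb⟩ ξ
      ext i
      fin_cases i
      · exact (h0 ξ).trans (by rw [ha]; exact (hga ξ).symm)
      · exact (h1 ξ).trans (by rw [hb]; exact (hgb ξ).symm)
  have e3 : (∀ ξ, -dir ω X.chi ξ + A.S ξ *ᵥ X.mu ξ + (A.T ξ)ᵀ *ᵥ X.lam ξ = 0) ↔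
      ∀ i, -pd ω (χ i) + (∑ j, L.S i j * μ j + L.Ta i * la + L.Tb i * lb) = 0 := by
    have h0 : ∀ ξ i, (-dir ω X.chi ξ + A.S ξ *ᵥ X.mu ξ + (A.T ξ)ᵀ *ᵥ X.lam ξ) i
        = ev ξ (-pd ω (χ i) + (∑ j, L.S i j * μ j + L.Ta i * la + L.Tb i * lb)) := fun ξ i => by
      simp [Matrix.mulVec, dotProduct, hchi, hX.la, hX.lb, hX.mu, hA.S, hA.Ta, hA.Tb,
        Fin.sum_univ_two]
      ring
    refine ⟨fun h i => ext_ev fun ξ => ?_, fun h ξ => funext fun i => ?_⟩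
    · rw [← h0, h, map_zero]; rfl
    · rw [h0, h, map_zero]; rfl
  have e4 : mean (fun ξ => (A.W ξ *ᵥ X.lam ξ) 0) + mean (fun ξ => X.chi ξ ⬝ᵥ grad A.w₁ ξ)
      = mn (L.Wa * la + L.Wb * lb) + ∑ i, mn (χ i * pd (unitVec i) L.w) := by
    rw [← map_sum, mn_eq_mean, mn_eq_mean]
    simp [Matrix.mulVec, dotProduct, hX.la, hX.lb, hX.chi, hA.Wa, hA.Wb, hw, Fin.sum_univ_two]
  have e5 : ∀ i, mean (fun ξ => ((A.V ξ)⁻¹)ᵀ *ᵥ X.chi ξ) i = ∑ j, mn (U j i * χ j) := fun i => by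
    have h0 : ∀ ξ i, (((A.V ξ)⁻¹)ᵀ *ᵥ X.chi ξ) i = ev ξ (∑ j, U j i * χ j) := fun ξ i => by
      simp [Matrix.mulVec, dotProduct, hX.chi, hA.V]
    rw [mean_pi fun i => ?_, ← map_sum, mn_eq_mean]
    · simp only [h0]
    · simp only [h0]
      exact (∑ j, U j i * χ j).continuous
  constructor
  · intro h
    refine ⟨⟨h.mu_mem, h.lam_mem, h.chi_mem⟩, ⟨e1.1 h.eq_mu, (e2.1 h.eq_lam).1, (e2.1 h.eq_lam).2,
      e3.1 h.eq_chi, e4.symm.trans h.norm_lam⟩, fun i => ?_⟩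
    rw [← e5, h.norm_chi]; rfl
  · rintro ⟨⟨h1, h2, h3⟩, h, h4⟩
    exact ⟨h1, h2, h3, e1.2 h.eq_mu, e2.2 ⟨h.eq_la, h.eq_lb⟩, e3.2 h.eq_chi, e4.trans h.norm_lam,
      funext fun i => (e5 i).trans (h4 i)⟩

theorem Solves.exists_represents (hr : 0 < r) (h : Solves A ω k r g₁ g₂ γ X) :
    ∃ μ la lb χ, RepresentsSol X μ la lb χ := by
  have h1 := vecNorm_lt_top.1 h.mu_mem
  have h2 := vecNorm_lt_top.1 h.lam_mem
  have h3 := vecNorm_lt_top.1 h.chi_mem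
  exact ⟨fun j => ⟨_, mem_TA_of_anNorm_lt_top hr (h1 j)⟩, ⟨_, mem_TA_of_anNorm_lt_top hr (h2 0)⟩,
    ⟨_, mem_TA_of_anNorm_lt_top hr (h2 1)⟩, fun j => ⟨_, mem_TA_of_anNorm_lt_top hr (h3 j)⟩,
    ⟨fun _ _ => rfl, fun _ => rfl, fun _ => rfl, fun _ _ => rfl⟩⟩

end Bridge

/-- The coefficients are analytic on the open strip of width `R`. -/
structure LinData.Regular (L : LinData m) (R : ℝ) (hR : 0 < R) : Prop where
  w : L.w ∈ regAlg m R hR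
  Wa : L.Wa ∈ regAlg m R hR
  Wb : L.Wb ∈ regAlg m R hR
  S : ∀ a b, L.S a b ∈ regAlg m R hR
  Ta : ∀ j, L.Ta j ∈ regAlg m R hR
  Tb : ∀ j, L.Tb j ∈ regAlg m R hR

namespace LinData.Regular
variable {ω : Fin m → ℝ} {τ : ℕ} {c₀ : ℝ} (h : Diophantine ω τ c₀) {L : LinData m} {R : ℝ}
  {hR : 0 < R} (hL : L.Regular R hR) (y : Par m) {g : Rhs m} (hg : g.1 ∈ regAlg m R hR)
include hL hg

theorem mu (j : Fin m) : L.mu h y g j ∈ regAlg m R hR :=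
  sub_mem (sub_mem (Subalgebra.algebraMap_mem _ _)
    (Subalgebra.smul_mem _ (mult_mem_regAlg _ (mult_mem_regAlg _ hL.w)) _))
    (mult_mem_regAlg _ (mult_mem_regAlg _ hg))

theorem qa : L.qa h y g ∈ regAlg m R hR :=
  add_mem (sum_mem fun j _ => mul_mem (hL.Ta j) (hL.mu h y hg j)) (Subalgebra.smul_mem _ hL.Wa _)

theorem qb : L.qb h y g ∈ regAlg m R hR :=
  add_mem (sum_mem fun j _ => mul_mem (hL.Tb j) (hL.mu h y hg j)) (Subalgebra.smul_mem _ hL.Wb _)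

variable (ha : g.2.1 ∈ regAlg m R hR) (hb : g.2.2 ∈ regAlg m R hR)
include ha hb

theorem la : L.la h y g ∈ regAlg m R hR := by
  have hfa := sub_mem ha (hL.qa h y hg)
  have hfb := sub_mem hb (hL.qb h y hg)
  exact add_mem (Subalgebra.algebraMap_mem _ _)
    (neg_mem (mult_mem_regAlg _ (sub_mem hfa (mult_mem_regAlg _ hfb))))

theorem lb : L.lb h y g ∈ regAlg m R hR := by
  have hfa := sub_mem ha (hL.qa h y hg)
  have hfb := sub_mem hb (hL.qb h y hg)
  exact add_mem (Subalgebra.algebraMap_mem _ _)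
    (neg_mem (mult_mem_regAlg _ (sub_mem (mult_mem_regAlg _ hfa) (Subalgebra.smul_mem _ hfb _))))

theorem flux (i : Fin m) : L.flux h y g i ∈ regAlg m R hR :=
  add_mem (add_mem (sum_mem fun j _ => mul_mem (hL.S i j) (hL.mu h y hg j))
    (mul_mem (hL.Ta i) (hL.la h y hg ha hb))) (mul_mem (hL.Tb i) (hL.lb h y hg ha hb))

end LinData.Regular

/-! ### Existence, uniqueness and the form `L_ij` in terms of parameters -/

section Solve
variable {A : Coeffs m} {k r γ : ℝ} {L : LinData m} {U : Fin m → Fin m → TA m} {ω : Fin m → ℝ}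
  {g₁ : (Fin m → ℝ) → ℝ} {g₂ : (Fin m → ℝ) → (Fin 2 → ℝ)} {g : Rhs m}
  {τ : ℕ} {c₀ : ℝ} (h : Diophantine ω τ c₀)

/-- Solutions are determined by their parameters, up to the mean value of `χ`. -/
theorem Solves.exists_par (hA : Represents A k L U) (hk : 0 ≤ L.k)
    (hg₁ : ∀ ξ, g₁ ξ = ev ξ g.1) (hga : ∀ ξ, g₂ ξ 0 = ev ξ g.2.1)
    (hgb : ∀ ξ, g₂ ξ 1 = ev ξ g.2.2) (hr : 0 < r) {X : Unknowns m}
    (hX : Solves A ω k r g₁ g₂ γ X) :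
    ∃ (y : Par m) (χ₀ : Fin m → ℝ), L.Phi h y g = (0, 0, 0, γ) ∧
      RepresentsSol X (L.mu h y g) (L.la h y g) (L.lb h y g)
        (fun i => algebraMap ℝ (TA m) (χ₀ i) + Dinv h (L.flux h y g i)) ∧ X.p = y.2.1 ∧
      ∀ i, ∑ j, mn (U j i) * χ₀ j = -∑ j, mn (U j i * Dinv h (L.flux h y g j)) := by
  obtain ⟨μ, la, lb, χ, hrep⟩ := hX.exists_represents hr
  obtain ⟨-, hsol, hχ⟩ := (solves_iff hA hrep hg₁ hga hgb).1 hX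
  obtain ⟨y, hy, rfl, rfl, rfl, hp, hχ'⟩ := LinData.eq_of_algSol h hk hsol
  obtain ⟨χ₀, hχ₀⟩ : ∃ χ₀ : Fin m → ℝ, ∀ i, mn (χ i) = χ₀ i := ⟨_, fun _ => rfl⟩
  simp only [hχ₀] at hχ'
  obtain rfl : χ = fun i => algebraMap ℝ (TA m) (χ₀ i) + Dinv h (L.flux h y g i) := funext hχ'
  refine ⟨y, χ₀, hy, hrep, hp, fun i => ?_⟩
  have h1 := hχ i
  simp only [mul_add, map_add, mul_comm (U _ _) (algebraMap _ _ _), ← Algebra.smul_def, map_smul,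
    Finset.sum_add_distrib, smul_eq_mul] at h1
  simp only [mul_comm (mn _) (χ₀ _)]
  linarith

theorem RepresentsSol.ext {X X' : Unknowns m} {μ χ : Fin m → TA m} {la lb : TA m}
    (hX : RepresentsSol X μ la lb χ) (hX' : RepresentsSol X' μ la lb χ) (hp : X.p = X'.p) :
    X = X' := by
  obtain ⟨a, b, c, d⟩ := X
  obtain ⟨a', b', c', d'⟩ := X'
  obtain rfl : a = a' := funext₂ fun ξ j => (hX.mu ξ j).trans (hX'.mu ξ j).symm
  obtain rfl : b = b' := funext₂ fun ξ j => (hX.lam ξ j).trans (hX'.lam ξ j).symm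
  obtain rfl : c = c' := funext₂ fun ξ j => (hX.chi ξ j).trans (hX'.chi ξ j).symm
  obtain rfl : d = d' := hp
  rfl

/-- An injective endomorphism of the finite-dimensional parameter space is surjective, which solves
the solvability conditions; the mean of `χ` then solves a linear system with the mean of `V⁻ᵀ`.
Conversely any solution is determined by these data. -/
theorem Represents.existsUnique_solves (hA : Represents A k L U) (hk : 0 ≤ L.k)
    (hg₁ : ∀ ξ, g₁ ξ = ev ξ g.1) (hga : ∀ ξ, g₂ ξ 0 = ev ξ g.2.1)
    (hgb : ∀ ξ, g₂ ξ 1 = ev ξ g.2.2) (hr : 0 < r) {R : ℝ} {hR : 0 < R} (hrR : r < R)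
    (hL : L.Regular R hR) (rg₁ : g.1 ∈ regAlg m R hR) (rga : g.2.1 ∈ regAlg m R hR)
    (rgb : g.2.2 ∈ regAlg m R hR) (hΛ : Function.Injective (L.Lam h))
    (hU : IsUnit (Matrix.of fun i j => mn (U j i)).det) :
    ∃! X, Solves A ω k r g₁ g₂ γ X := by
  have hinj : ∀ χ χ' : Fin m → ℝ, (∀ i, ∑ j, mn (U j i) * χ j = ∑ j, mn (U j i) * χ' j) →
      χ = χ' := fun χ χ' hχ =>
    Matrix.mulVec_injective_of_isUnit ((Matrix.isUnit_iff_isUnit_det _).2 hU)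
      (funext fun i => hχ i)
  obtain ⟨y, hy⟩ := LinearMap.injective_iff_surjective.1 hΛ ((0, 0, 0, γ) - L.Phi h 0 g)
  have hy' : L.Phi h y g = (0, 0, 0, γ) := by rw [LinData.Phi_eq, hy, sub_add_cancel]
  obtain ⟨χ₀, hχ₀⟩ := Matrix.mulVec_surjective_iff_isUnit.2 ((Matrix.isUnit_iff_isUnit_det _).2 hU)
    (fun i => -∑ j, mn (U j i * Dinv h (L.flux h y g j)))
  replace hχ₀ : ∀ i, ∑ j, mn (U j i) * χ₀ j = -∑ j, mn (U j i * Dinv h (L.flux h y g j)) :=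
    congrFun hχ₀
  have hla := anNorm_lt_top_of_mem hr hrR (hL.la h y rg₁ rga rgb)
  have hlb := anNorm_lt_top_of_mem hr hrR (hL.lb h y rg₁ rga rgb)
  set X : Unknowns m := ⟨fun ξ j => ev ξ (L.mu h y g j), fun ξ => ![ev ξ (L.la h y g),
    ev ξ (L.lb h y g)], fun ξ j => ev ξ (algebraMap ℝ (TA m) (χ₀ j) + Dinv h (L.flux h y g j)),
    y.2.1⟩ with hX
  have hrep : RepresentsSol X (L.mu h y g) (L.la h y g) (L.lb h y g)
      (fun i => algebraMap ℝ (TA m) (χ₀ i) + Dinv h (L.flux h y g i)) :=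
    ⟨fun _ _ => rfl, fun _ => rfl, fun _ => rfl, fun _ _ => rfl⟩
  refine ⟨X, (solves_iff hA hrep hg₁ hga hgb).2 ⟨⟨?_, ?_, ?_⟩,
    LinData.algSol_of_Phi h hk hy' χ₀, fun i => ?_⟩, fun X' hX' => ?_⟩
  · exact vecNorm_lt_top.2 fun j => anNorm_lt_top_of_mem hr hrR (hL.mu h y rg₁ j)
  · exact vecNorm_lt_top.2 (Fin.forall_fin_two.2 ⟨hla, hlb⟩)
  · exact vecNorm_lt_top.2 fun j => anNorm_lt_top_of_mem hr hrR
      (add_mem (Subalgebra.algebraMap_mem _ _)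
        (mult_mem_regAlg _ (hL.flux h y rg₁ rga rgb j)))
  · have h1 := hχ₀ i
    simp only [mul_add, map_add, mul_comm (U _ _) (algebraMap _ _ _), ← Algebra.smul_def, map_smul,
      Finset.sum_add_distrib, smul_eq_mul]
    simp only [mul_comm (mn _) (χ₀ _)] at h1
    linarith
  · obtain ⟨y', χ', hy1, hrep', hp', hχ'⟩ := hX'.exists_par h hA hk hg₁ hga hgb hr
    obtain rfl : y' = y := hΛ (by
      rw [LinData.Phi_eq] at hy1 hy'
      exact add_right_cancel (hy1.trans hy'.symm))
    obtain rfl : χ' = χ₀ := hinj _ _ fun i => (hχ' i).trans (hχ₀ i).symm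
    exact hrep'.ext hrep hp'

/-- The second equation replaces `J∂λ + Ωλ` by `g₂ - Tμ - pWᵀe₁`, so that no derivative of `λ`
remains in the form. -/
theorem quadForm_eq (hA : Represents A k L U) (hga : ∀ ξ, g₂ ξ 0 = ev ξ g.2.1)
    (hgb : ∀ ξ, g₂ ξ 1 = ev ξ g.2.2) {X X' : Unknowns m} {y y' : Par m} {g' : Rhs m}
    {χ χ' : Fin m → TA m} (hX : Solves A ω k r g₁ g₂ γ X)
    (hrep : RepresentsSol X (L.mu h y g) (L.la h y g) (L.lb h y g) χ) (hp : X.p = y.2.1)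
    (hrep' : RepresentsSol X' (L.mu h y' g') (L.la h y' g') (L.lb h y' g') χ') :
    quadForm A ω k X X' = (2 * Real.pi) ^ m * L.quadSol h y g y' g' := by
  have h1 : ∀ ξ, J *ᵥ dir ω X.lam ξ + Omega k *ᵥ X.lam ξ
      = g₂ ξ - A.T ξ *ᵥ X.mu ξ - X.p • ((A.W ξ)ᵀ *ᵥ Pi.single 0 1) := fun ξ => by
    rw [← hX.eq_lam ξ]; abel
  have hWe : ∀ ξ i, ((A.W ξ)ᵀ *ᵥ Pi.single 0 1) i = A.W ξ 0 i := fun ξ i => by simp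
  rw [quadForm, LinData.quadSol, LinData.quad, ← torusInt_eq]
  congr 1
  funext ξ
  have hev : ∀ f : TA m, f.1 ξ = ev ξ f := fun _ => rfl
  rw [h1, hev]
  simp only [dotProduct, Fin.sum_univ_two, Pi.sub_apply, Pi.smul_apply, hWe]
  simp only [dotProduct, Matrix.mulVec, hga, hgb, hrep.mu, hrep'.mu, hrep'.la, hrep'.lb, hA.S, hA.Ta, hA.Tb, hA.Wa, hA.Wb, hp,
    LinData.qa, LinData.qb, map_sub, map_sum, map_mul, map_add, map_smul, smul_eq_mul]
  ring

end Solve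

theorem abs_le_eucl {a : ℕ} (v : Fin a → ℝ) (j : Fin a) : |v j| ≤ eucl v := by
  rw [eucl, ← Real.sqrt_sq_eq_abs]
  exact Real.sqrt_le_sqrt
    (Finset.single_le_sum (f := fun i => v i ^ 2) (fun i _ => sq_nonneg _) (Finset.mem_univ j))

theorem eucl_nonneg {a : ℕ} (v : Fin a → ℝ) : 0 ≤ eucl v := Real.sqrt_nonneg _

/-! ### Bounds for all pairs of solutions -/

namespace Near
variable {I : Type*} {L : I → LinData m} {ε η : I → ℝ} {S₀ : Matrix (Fin m) (Fin m) ℝ}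
  {t₀ : Fin m → ℝ} {ω : Fin m → ℝ} {τ : ℕ} {c₀ : ℝ} (h : Diophantine ω τ c₀)
  (hL : Near L ε S₀ t₀) (hdet : (S₀ - Matrix.vecMulVec t₀ t₀).det ≠ 0)
include hL hdet

theorem exists_norm_le_Lam : ∃ ε₀ > 0, ∃ C, ∀ i, |ε i| ≤ ε₀ →
    (∀ y : Par m, ‖y‖ ≤ C * ‖(L i).Lam h y‖) ∧ 1 / 2 ≤ (L i).kappa h := by
  obtain ⟨C, hC0, hC⟩ := hL.exists_norm_le h hdet
  obtain ⟨c, hc0, hc⟩ := exists_of_isBigO_top (hL.kappa_sub h)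
  -- This makes `C|ε| ≤ 1/2`, so that the perturbation is absorbed by the left side, and `c|ε| ≤
  -- 1/2`, so that `κ ≥ 1/2`.
  refine ⟨1 / (2 * (C + c + 1)), by positivity, 2 * C, fun i hi => ?_⟩
  have h1 : |ε i| * (2 * (C + c + 1)) ≤ 1 := by
    rwa [le_div_iff₀ (by positivity)] at hi
  have h2 := abs_nonneg (ε i)
  refine ⟨fun y => ?_, ?_⟩
  · have h3 := hC i y
    have h4 : C * (|ε i| * ‖y‖) ≤ 1 / 2 * ‖y‖ := by
      rw [← mul_assoc]
      refine mul_le_mul_of_nonneg_right ?_ (norm_nonneg _)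
      nlinarith
    nlinarith
  · have h3 := (abs_le.1 (hc i)).1
    nlinarith

variable (hw : ∀ i, mn (L i).w = 0) (hη : UO (fun i => (L i).w) η)
include hw hη

/-- The estimates for the quadratic form on the solutions of the two problems. -/
theorem exists_bounds : ∃ ε₀ > 0, ∃ c > 0, ∀ i, |ε i| ≤ ε₀ → Function.Injective ((L i).Lam h) ∧
    ∀ y₁ y₂ : Par m, (L i).Phi h y₁ 0 = (0, 0, 0, 1) → (L i).Phi h y₂ (L i).rhs₂ = 0 →
      |(L i).quadSol h y₁ 0 y₂ (L i).rhs₂| ≤ c * |ε i| ∧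
      |(L i).quadSol h y₁ 0 y₁ 0| ≤ c ∧
      c⁻¹ * (L i).en h ^ 2 ≤ |(L i).quadSol h y₂ (L i).rhs₂ y₂ (L i).rhs₂| ∧
      |(L i).quadSol h y₂ (L i).rhs₂ y₂ (L i).rhs₂| ≤ c * η i ^ 2 ∧
      ∀ μ₀ : Fin m → ℝ, (L i).k = 0 →
        (∀ a, mn ((L i).Ta a) = ((S₀ - Matrix.vecMulVec t₀ t₀) *ᵥ μ₀) a) →
        |(L i).quadSol h y₁ 0 y₁ 0 - ((S₀ - Matrix.vecMulVec t₀ t₀) *ᵥ μ₀) ⬝ᵥ μ₀|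
          ≤ c * |ε i| * eucl μ₀ ^ 2 ∧
        |(L i).quadSol h y₁ 0 y₂ (L i).rhs₂| ≤ c * |ε i| * eucl μ₀ := by
  obtain ⟨ε₁, hε₁, C, hC⟩ := hL.exists_norm_le_Lam h hdet
  -- the family of all pairs of solutions
  obtain ⟨Q, π, Y₁, Y₂, hQC, hQκ, hQ₁, hQ₂, hQ⟩ : ∃ (Q : Type _) (π : Q → I) (Y₁ Y₂ : Q → Par m),
      (∀ q (y : Par m), ‖y‖ ≤ C * ‖(L (π q)).Lam h y‖) ∧ (∀ q, 1 / 2 ≤ (L (π q)).kappa h) ∧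
      (∀ q, (L (π q)).Phi h (Y₁ q) 0 = (0, 0, 0, 1)) ∧
      (∀ q, (L (π q)).Phi h (Y₂ q) (L (π q)).rhs₂ = 0) ∧
      ∀ i, |ε i| ≤ ε₁ → ∀ y₁ y₂ : Par m, (L i).Phi h y₁ 0 = (0, 0, 0, 1) →
        (L i).Phi h y₂ (L i).rhs₂ = 0 → ∃ q, π q = i ∧ Y₁ q = y₁ ∧ Y₂ q = y₂ :=
    ⟨{q : I × Par m × Par m // |ε q.1| ≤ ε₁ ∧ (L q.1).Phi h q.2.1 0 = (0, 0, 0, 1) ∧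
        (L q.1).Phi h q.2.2 (L q.1).rhs₂ = 0}, fun q => q.1.1, fun q => q.1.2.1, fun q => q.1.2.2,
      fun q => (hC _ q.2.1).1, fun q => (hC _ q.2.1).2, fun q => q.2.2.1, fun q => q.2.2.2,
      fun i hi y₁ y₂ h₁ h₂ => ⟨⟨(i, y₁, y₂), hi, h₁, h₂⟩, rfl, rfl, rfl⟩⟩
  have hN := hL.comp π
  have hwε := hN.w
  have hwη := hη.comp π
  have y₁O := hN.first_isBigO h hQC hQ₁
  have y₂O := hN.second_isBigO h hQC hQ₂ hwε
  have y₂η := hN.second_isBigO h hQC hQ₂ hwη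
  have hz : UO (fun _ : Q => (0 : TA m)) fun q => ε (π q) * 1 := UO.zero
  have hz1 : UO (fun _ : Q => (0 : TA m)) fun _ => (1 : ℝ) := UO.zero
  have b12 := hN.quadSol_isBigO h (g := fun _ => 0) (g' := fun q => (L (π q)).rhs₂) y₁O hz hz1 hz1
    y₂O (hN.rhs₂_fst hwε) (hN.rhs₂_snd hwε) (hN.rhs₂_trd hwε)
  have b11 := hN.quadSol_isBigO h (g := fun _ => 0) (g' := fun _ => 0) y₁O hz hz1 hz1
    y₁O hz hz1 hz1
  have b22 := hN.quadSol_isBigO h (g := fun q => (L (π q)).rhs₂) (g' := fun q => (L (π q)).rhs₂)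
    y₂η (hN.rhs₂_fst hwη) (hN.rhs₂_snd hwη) (hN.rhs₂_trd hwη)
    y₂η (hN.rhs₂_fst hwη) (hN.rhs₂_snd hwη) (hN.rhs₂_trd hwη)
  obtain ⟨a12, ha12, b12⟩ := exists_of_isBigO_top b12
  obtain ⟨a11, ha11, b11⟩ := exists_of_isBigO_top b11
  obtain ⟨a22, ha22, b22⟩ := exists_of_isBigO_top b22
  obtain ⟨a, ha, hlow⟩ := hN.exists_le_quadSol_second h (fun q => hw (π q)) hQC hQ₂
  -- the degenerate case
  obtain ⟨d, hd, e, he, hdeg⟩ : ∃ d, 0 ≤ d ∧ ∃ e, 0 ≤ e ∧ ∀ q (μ₀ : Fin m → ℝ),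
      (L (π q)).k = 0 →
      (∀ a, mn ((L (π q)).Ta a) = ((S₀ - Matrix.vecMulVec t₀ t₀) *ᵥ μ₀) a) →
      |(L (π q)).quadSol h (Y₁ q) 0 (Y₁ q) 0 - ((S₀ - Matrix.vecMulVec t₀ t₀) *ᵥ μ₀) ⬝ᵥ μ₀|
          ≤ d * |ε (π q) * eucl μ₀ * eucl μ₀| ∧
        |(L (π q)).quadSol h (Y₁ q) 0 (Y₂ q) (L (π q)).rhs₂| ≤ e * |eucl μ₀ * ε (π q)| := by
    -- The vectors `μ₀` join the index set, with `δ = |μ₀|`, so the constants do not depend on them.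
    set Q' := {q : Q × (Fin m → ℝ) // (L (π q.1)).k = 0 ∧
      ∀ a, mn ((L (π q.1)).Ta a) = ((S₀ - Matrix.vecMulVec t₀ t₀) *ᵥ q.2) a} with hQ'
    have hN' := hN.comp fun q : Q' => q.1.1
    have hμ : ∀ j, (fun q : Q' => q.1.2 j) =O[⊤] fun q => eucl q.1.2 := fun j =>
      isBigO_top_of_le 1 fun q => by
        rw [one_mul, abs_of_nonneg (eucl_nonneg _)]; exact abs_le_eucl _ _
    have hdev := hN'.dev_isBigO h (fun q => hQC _) (fun q => q.2.1) (fun q => hQκ _)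
      (fun q => q.2.2) hμ (fun q => hQ₁ _)
    have c11 := hN'.quadSol_first_sub h (fun q => hQC _) (fun q => q.2.1) (fun q => hQκ _)
      (fun q => q.2.2) hμ (fun q => hQ₁ _) hdet
    have c12 := hN'.quadSol_isBigO h (g := fun _ => 0) (g' := fun q => (L (π q.1.1)).rhs₂)
      hdev UO.zero UO.zero UO.zero (hN'.second_isBigO h (fun q => hQC _) (fun q => hQ₂ _) hN'.w)
      (hN'.rhs₂_fst hN'.w) (hN'.rhs₂_snd hN'.w) (hN'.rhs₂_trd hN'.w)
    simp only [quadSol_dev_left] at c12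
    obtain ⟨d, hd, c11⟩ := exists_of_isBigO_top c11
    obtain ⟨e, he, c12⟩ := exists_of_isBigO_top c12
    exact ⟨d, hd, e, he, fun q μ₀ hk hμ₀ => ⟨c11 ⟨(q, μ₀), hk, hμ₀⟩, c12 ⟨(q, μ₀), hk, hμ₀⟩⟩⟩
  -- The summand `2` gives `c⁻¹ ≤ 1/2`; the smallness of `ε` below gives `1 - a|ε| ≥ 1/2`.
  set c := a12 + a11 + a22 + d + e + 2 with hc
  have hc0 : 0 < c := by positivity
  refine ⟨min ε₁ (1 / (2 * (a + 1))), by positivity, c, hc0, fun i hi => ⟨?_, ?_⟩⟩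
  · have h1 := (hC i (hi.trans (min_le_left _ _))).1
    refine (injective_iff_map_eq_zero _).2 fun y hy => ?_
    have h2 := h1 y
    rw [hy, norm_zero, mul_zero] at h2
    exact norm_le_zero_iff.1 h2
  intro y₁ y₂ h₁ h₂
  obtain ⟨q, rfl, rfl, rfl⟩ := hQ i (hi.trans (min_le_left _ _)) y₁ y₂ h₁ h₂
  have hεa : |ε (π q)| * (2 * (a + 1)) ≤ 1 := by
    have := hi.trans (min_le_right _ _)
    rwa [le_div_iff₀ (by positivity)] at this
  have hε0 := abs_nonneg (ε (π q))
  refine ⟨?_, ?_, ?_, ?_, fun μ₀ hk hμ₀ => ⟨?_, ?_⟩⟩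
  · refine (b12 q).trans ?_
    rw [one_mul]
    exact mul_le_mul_of_nonneg_right (by linarith) hε0
  · refine (b11 q).trans ?_
    rw [one_mul, abs_one, mul_one]
    linarith
  · refine le_trans ?_ ((hlow q).trans (le_abs_self _))
    refine mul_le_mul_of_nonneg_right ?_ (sq_nonneg _)
    have h3 : c⁻¹ ≤ 2⁻¹ := inv_anti₀ two_pos (by linarith)
    nlinarith
  · refine (b22 q).trans ?_
    rw [abs_mul, abs_mul_abs_self, ← sq]
    exact mul_le_mul_of_nonneg_right (by linarith) (sq_nonneg _)
  · refine ((hdeg q μ₀ hk hμ₀).1).trans ?_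
    rw [abs_mul, abs_mul, abs_of_nonneg (eucl_nonneg μ₀), mul_assoc, mul_assoc, ← sq]
    exact mul_le_mul_of_nonneg_right (by linarith) (by positivity)
  · refine ((hdeg q μ₀ hk hμ₀).2).trans ?_
    rw [abs_mul, abs_of_nonneg (eucl_nonneg μ₀), mul_comm (eucl μ₀), mul_assoc]
    exact mul_le_mul_of_nonneg_right (by linarith) (mul_nonneg hε0 (eucl_nonneg μ₀))

end Near

/-! ### The family of all admissible coefficients -/

/-- The coefficients as elements of the algebra of analytic functions. -/
def Coeffs.lin (A : Coeffs m) (k : ℝ) : LinData m where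
  k := k
  w := toTA (osc A.w₁)
  Wa := toTA fun ξ => A.W ξ 0 0
  Wb := toTA fun ξ => A.W ξ 0 1
  S a b := toTA fun ξ => A.S ξ a b
  Ta j := toTA fun ξ => A.T ξ 0 j
  Tb j := toTA fun ξ => A.T ξ 1 j

/-- The entries of `V⁻¹` as elements of the algebra of analytic functions. -/
def Coeffs.vinv (A : Coeffs m) (a b : Fin m) : TA m := toTA fun ξ => (A.V ξ)⁻¹ a b

theorem anNorm_mono {R : ℝ} {d d' : ℕ} (h : d ≤ d') (f : (Fin m → ℝ) → ℝ) :
    anNorm R d f ≤ anNorm R d' f :=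
  iInf₂_mono fun _ _ => biSup_mono fun _ hl => hl.trans h

theorem anNorm_le_matNorm {a b : ℕ} {R : ℝ} {d : ℕ} (B : (Fin m → ℝ) → Matrix (Fin a) (Fin b) ℝ)
    (i : Fin a) (j : Fin b) : anNorm R d (fun ξ => B ξ i j) ≤ matNorm R d B :=
  le_iSup₂ (f := fun i j => anNorm R d fun ξ => B ξ i j) i j

section Approx
variable {R M c : ℝ} {d : ℕ} {f : (Fin m → ℝ) → ℝ} (hR : 0 < R)
  (hf : anNorm R d (fun ξ => f ξ - c) ≤ ENNReal.ofReal M)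
include hR hf

theorem mem_of_anNorm_sub_le : f ∈ analyticAlg m := by
  have h1 := mem_TA_of_anNorm_lt_top hR (hf.trans_lt ENNReal.ofReal_lt_top)
  have h2 := (analyticAlg m).add_mem h1 ((analyticAlg m).algebraMap_mem c)
  convert h2 using 1
  ext ξ
  simp

theorem decays_toTA_sub (hM : 0 ≤ M) {r : ℝ} (hr0 : 0 ≤ r) (hr : r < R) :
    Decays (toTA f - algebraMap ℝ (TA m) c).1 r M := by
  have h1 : (toTA f - algebraMap ℝ (TA m) c).1 = fun ξ => f ξ - c := by
    ext ξ
    exact congrArg (· - c) (ev_toTA (mem_of_anNorm_sub_le hR hf) ξ)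
  rw [h1]
  exact decays_of_anNorm_le hM hf hr0 hr

theorem toTA_mem_regAlg (hM : 0 ≤ M) : toTA f ∈ regAlg m R hR := by
  have h1 : toTA f - algebraMap ℝ (TA m) c ∈ regAlg m R hR := fun r hr =>
    ⟨M, (decays_toTA_sub hR hf hM (le_max_right r 0) (max_lt hr hR)).mono (le_max_left r 0) le_rfl⟩
  have h2 := add_mem h1 ((regAlg m R hR).algebraMap_mem c)
  rwa [sub_add_cancel] at h2

end Approx

theorem ofReal_mul_abs_le (C ε : ℝ) : ENNReal.ofReal (C * |ε|) ≤ ENNReal.ofReal (|C| * |ε|) :=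
  ENNReal.ofReal_le_ofReal (mul_le_mul_of_nonneg_right (le_abs_self C) (abs_nonneg ε))

section Admissible
variable {A : Coeffs m} {H₀ : (Fin m → ℝ) × ℝ → ℝ} {ϱ σ C α ε : ℝ} {d : ℕ}
  (hA : A.Admissible H₀ ϱ σ d C α ε)
include hA

namespace Coeffs.Admissible

theorem V_le (a b : Fin m) : anNorm (σ / 2 * ϱ) 0 (fun ξ => (A.V ξ)⁻¹ a b - (1 : Matrix _ _ ℝ) a b)
    ≤ ENNReal.ofReal (|C| * |ε|) :=
  (anNorm_le_matNorm (fun ξ => (A.V ξ)⁻¹ - 1) a b).trans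
    ((le_self_add.trans (le_self_add.trans hA.est₁)).trans (ofReal_mul_abs_le C ε))

theorem w_le : anNorm (σ / 2 * ϱ) d (fun ξ => osc A.w₁ ξ - 0) ≤ ENNReal.ofReal (|C| * |ε|) := by
  simp only [sub_zero, osc, hA.mean_w₁]
  exact (le_add_self.trans (le_self_add.trans hA.est₁)).trans (ofReal_mul_abs_le C ε)

theorem W_le (a b : Fin 2) : anNorm (σ / 2 * ϱ) d (fun ξ => A.W ξ a b - (1 : Matrix _ _ ℝ) a b)
    ≤ ENNReal.ofReal (|C| * |ε|) :=
  (anNorm_le_matNorm (fun ξ => A.W ξ - 1) a b).trans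
    ((le_add_self.trans hA.est₁).trans (ofReal_mul_abs_le C ε))

theorem S_le (a b : Fin m) : anNorm (σ / 2 * ϱ) (d - 1) (fun ξ => A.S ξ a b - S₀ H₀ a b)
    ≤ ENNReal.ofReal (|C| * |ε|) :=
  (anNorm_le_matNorm (fun ξ => A.S ξ - S₀ H₀) a b).trans
    ((le_self_add.trans hA.est₂).trans (ofReal_mul_abs_le C ε))

theorem T_le (a : Fin 2) (b : Fin m) :
    anNorm (σ / 2 * ϱ) (d - 1) (fun ξ => A.T ξ a b - T₀ H₀ a b) ≤ ENNReal.ofReal (|C| * |ε|) :=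
  (anNorm_le_matNorm (fun ξ => A.T ξ - T₀ H₀) a b).trans
    ((le_add_self.trans hA.est₂).trans (ofReal_mul_abs_le C ε))

theorem anNorm_osc_le : anNorm (σ / 2 * ϱ) 0 (osc A.w₁) ≤ ENNReal.ofReal (|C| * |ε|) := by
  have h1 := hA.w_le
  simp only [sub_zero] at h1
  exact (anNorm_mono (Nat.zero_le d) _).trans h1

theorem toReal_anNorm_osc_sq_le : (anNorm (σ / 2 * ϱ) 0 (osc A.w₁)).toReal ^ 2
    ≤ C ^ 2 * |ε| ^ 2 := by
  have h1 := ENNReal.toReal_mono ENNReal.ofReal_ne_top hA.anNorm_osc_le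
  rw [ENNReal.toReal_ofReal (by positivity)] at h1
  rw [← sq_abs C, ← mul_pow]
  exact pow_le_pow_left₀ ENNReal.toReal_nonneg h1 2

variable (hR : 0 < σ / 2 * ϱ)
include hR

theorem represents (k : ℝ) : Represents A k (A.lin k) A.vinv where
  k := rfl
  w₁ ξ := by
    rw [Coeffs.lin]
    simp only
    rw [ev_toTA (mem_of_anNorm_sub_le hR hA.w_le), osc, sub_add_cancel]
  Wa ξ := (ev_toTA (mem_of_anNorm_sub_le hR (hA.W_le 0 0)) ξ).symm
  Wb ξ := (ev_toTA (mem_of_anNorm_sub_le hR (hA.W_le 0 1)) ξ).symm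
  S a b ξ := (ev_toTA (mem_of_anNorm_sub_le hR (hA.S_le a b)) ξ).symm
  Ta j ξ := (ev_toTA (mem_of_anNorm_sub_le hR (hA.T_le 0 j)) ξ).symm
  Tb j ξ := (ev_toTA (mem_of_anNorm_sub_le hR (hA.T_le 1 j)) ξ).symm
  V a b ξ := (ev_toTA (mem_of_anNorm_sub_le hR (hA.V_le a b)) ξ).symm

theorem regular (k : ℝ) : (A.lin k).Regular (σ / 2 * ϱ) hR where
  w := toTA_mem_regAlg hR hA.w_le (by positivity)
  Wa := toTA_mem_regAlg hR (hA.W_le 0 0) (by positivity)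
  Wb := toTA_mem_regAlg hR (hA.W_le 0 1) (by positivity)
  S a b := toTA_mem_regAlg hR (hA.S_le a b) (by positivity)
  Ta j := toTA_mem_regAlg hR (hA.T_le 0 j) (by positivity)
  Tb j := toTA_mem_regAlg hR (hA.T_le 1 j) (by positivity)

theorem mn_w (k : ℝ) : mn (A.lin k).w = 0 := by
  have hrep := hA.represents hR k
  have h1 : mean A.w₁ = mn (A.lin k).w + mean A.w₁ := by
    conv_lhs => rw [funext hrep.w₁]
    rw [mean_add (f := fun ξ => ev ξ (A.lin k).w) (A.lin k).w.continuous continuous_const,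
      mean_const]
    rfl
  linarith

theorem mn_Ta (k : ℝ) (hK : (K₀ H₀).det ≠ 0) (a : Fin m) :
    mn ((A.lin k).Ta a) = (K₀ H₀ *ᵥ mu₀ H₀ A) a := by
  have hrep := hA.represents hR k
  rw [mu₀, Matrix.mulVec_mulVec, Matrix.mul_nonsing_inv _ (Ne.isUnit hK), Matrix.one_mulVec,
    mean_pi fun i => ?_, mn_eq_mean]
  · simp only [hrep.Ta]
  · simp only [hrep.Ta]
    exact ((A.lin k).Ta i).continuous

theorem osc_eq (k : ℝ) : osc A.w₁ = (A.lin k).w.1 := by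
  ext ξ
  exact (ev_toTA (mem_of_anNorm_sub_le hR hA.w_le) ξ).symm

end Coeffs.Admissible
end Admissible

theorem UO_of_decays {I : Type*} {f : I → TA m} {δ : I → ℝ} {R c : ℝ} (hR : 0 < R) (hc : 0 ≤ c)
    (h : ∀ i r, 0 ≤ r → r < R → Decays (f i).1 r (c * |δ i|)) : UO f δ :=
  ⟨R / 2, half_pos hR, c, hc, fun i => h i _ (half_pos hR).le (half_lt_self hR)⟩

/-! ### Uniformity over all admissible coefficients -/

section Family
variable {I : Type*} {A : I → Coeffs m} {H₀ : (Fin m → ℝ) × ℝ → ℝ} {ϱ σ C : ℝ} {α ε k : I → ℝ}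
  {d : ℕ} (hA : ∀ i, (A i).Admissible H₀ ϱ σ d C (α i) (ε i)) (hR : 0 < σ / 2 * ϱ)
include hA hR

theorem near_lin (hε : ∀ i, |ε i| ≤ 1) (hk : ∀ i, k i ∈ Set.Icc (0 : ℝ) 1) :
    Near (fun i => (A i).lin (k i)) ε (S₀ H₀) (t₀ H₀) where
  k_mem := hk
  eps_le := hε
  w := by
    have : UO (fun i => ((A i).lin (k i)).w - algebraMap ℝ (TA m) 0) ε :=
      UO_of_decays hR (abs_nonneg C) fun i r hr0 hr =>
        decays_toTA_sub hR (hA i).w_le (by positivity) hr0 hr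
    simpa using this
  Wa := UO_of_decays hR (abs_nonneg C) fun i r hr0 hr =>
    decays_toTA_sub hR ((hA i).W_le 0 0) (by positivity) hr0 hr
  Wb := by
    have : UO (fun i => ((A i).lin (k i)).Wb - algebraMap ℝ (TA m) 0) ε :=
      UO_of_decays hR (abs_nonneg C) fun i r hr0 hr =>
        decays_toTA_sub hR ((hA i).W_le 0 1) (by positivity) hr0 hr
    simpa using this
  S a b := UO_of_decays hR (abs_nonneg C) fun i r hr0 hr =>
    decays_toTA_sub hR ((hA i).S_le a b) (by positivity) hr0 hr
  Ta j := by
    have : UO (fun i => ((A i).lin (k i)).Ta j - algebraMap ℝ (TA m) 0) ε :=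
      UO_of_decays hR (abs_nonneg C) fun i r hr0 hr =>
        decays_toTA_sub hR ((hA i).T_le 0 j) (by positivity) hr0 hr
    simpa using this
  Tb j := UO_of_decays hR (abs_nonneg C) fun i r hr0 hr =>
    decays_toTA_sub hR ((hA i).T_le 1 j) (by positivity) hr0 hr

theorem UO_vinv (a b : Fin m) : UO (fun i => (A i).vinv a b
    - algebraMap ℝ (TA m) ((1 : Matrix (Fin m) (Fin m) ℝ) a b)) ε :=
  UO_of_decays hR (abs_nonneg C) fun i r hr0 hr =>
    decays_toTA_sub hR ((hA i).V_le a b) (by positivity) hr0 hr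

/-- The analytic norm of `w` is itself used as the size function. With it the bound for the second
solution gives the upper estimate of `L₂₂`. -/
theorem UO_w_anNorm : UO (fun i => ((A i).lin (k i)).w)
    fun i => (anNorm (σ / 2 * ϱ) 0 (osc (A i).w₁)).toReal := by
  refine UO_of_decays hR zero_le_one fun i r hr0 hr => ?_
  rw [one_mul, abs_of_nonneg ENNReal.toReal_nonneg, ← (hA i).osc_eq hR]
  refine decays_of_anNorm_le (d := 0) ENNReal.toReal_nonneg (le_of_eq ?_) hr0 hr
  rw [ENNReal.ofReal_toReal ((hA i).anNorm_osc_le.trans_lt ENNReal.ofReal_lt_top).ne]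

/-- The matrix of mean values of `V⁻ᵀ` is invertible for small `ε`. -/
theorem exists_isUnit_det : ∃ ε₀ > 0, ∀ i, |ε i| ≤ ε₀ →
    IsUnit (Matrix.of fun a b => mn ((A i).vinv b a)).det := by
  -- The determinant is nonzero near the identity, and the mean of `V⁻¹` is entrywise within `O(ε)`
  -- of it.
  have h1 : ContinuousAt (fun f : Fin m → Fin m → ℝ => (Matrix.of f).det)
      (fun a b => (1 : Matrix (Fin m) (Fin m) ℝ) a b) :=
    (Continuous.matrix_det (A := fun f : Fin m → Fin m → ℝ => Matrix.of f)
      continuous_id).continuousAt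
  have h2 : (Matrix.of fun a b => (1 : Matrix (Fin m) (Fin m) ℝ) a b).det ≠ 0 := by
    rw [show (Matrix.of fun a b => (1 : Matrix (Fin m) (Fin m) ℝ) a b) = 1 from rfl,
      Matrix.det_one]
    exact one_ne_zero
  obtain ⟨δ, hδ, h3⟩ := Metric.eventually_nhds_iff.1 (h1.eventually_ne h2)
  have h4 := fun a b => exists_of_isBigO_top (UO_vinv hA hR a b).mn
  choose c hc0 hc using h4
  set s := ∑ a, ∑ b, c a b with hs
  have hs0 : 0 ≤ s := Finset.sum_nonneg fun a _ => Finset.sum_nonneg fun b _ => hc0 a b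
  have hcs : ∀ a b, c a b ≤ s := fun a b =>
    (Finset.single_le_sum (f := fun b => c a b) (fun b _ => hc0 a b) (Finset.mem_univ b)).trans
      (Finset.single_le_sum (f := fun a => ∑ b, c a b)
        (fun a _ => Finset.sum_nonneg fun b _ => hc0 a b) (Finset.mem_univ a))
  refine ⟨δ / (2 * (s + 1)), by positivity, fun i hi => (h3 ?_).isUnit⟩
  rw [le_div_iff₀ (by positivity)] at hi
  refine (dist_pi_lt_iff hδ).2 fun a => (dist_pi_lt_iff hδ).2 fun b => ?_
  have h5 := hc b a i
  rw [map_sub, mn_algebraMap] at h5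
  have h6 : (1 : Matrix (Fin m) (Fin m) ℝ) b a = (1 : Matrix (Fin m) (Fin m) ℝ) a b := by
    simp only [Matrix.one_apply, eq_comm]
  rw [h6] at h5
  have h7 := abs_nonneg (ε i)
  have h8 := mul_le_mul_of_nonneg_right (hcs b a) h7
  refine (Real.dist_eq _ _).trans_lt (h5.trans_lt ?_)
  nlinarith

end Family

section Problems
variable {A : Coeffs m} {H₀ : (Fin m → ℝ) × ℝ → ℝ} {ϱ σ C α ε k : ℝ} {d : ℕ}
  (hA : A.Admissible H₀ ϱ σ d C α ε) (hR : 0 < σ / 2 * ϱ)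
include hA hR

namespace Coeffs.Admissible

theorem rhs₂_fst (ξ : Fin m → ℝ) :
    (1 / 2 : ℝ) * osc A.w₁ ξ ^ 2 = ev ξ (A.lin k).rhs₂.1 := by
  rw [hA.osc_eq hR k, sq]; rfl

theorem rhs₂_snd (ξ : Fin m → ℝ) :
    (-(osc A.w₁ ξ • ((A.W ξ)ᵀ *ᵥ Pi.single 0 1))) 0 = ev ξ (A.lin k).rhs₂.2.1 := by
  have h1 : ((A.W ξ)ᵀ *ᵥ Pi.single 0 1) 0 = A.W ξ 0 0 := by simp
  rw [Pi.neg_apply, Pi.smul_apply, h1, (hA.represents hR k).Wa, hA.osc_eq hR k]; rfl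

theorem rhs₂_trd (ξ : Fin m → ℝ) :
    (-(osc A.w₁ ξ • ((A.W ξ)ᵀ *ᵥ Pi.single 0 1))) 1 = ev ξ (A.lin k).rhs₂.2.2 := by
  have h1 : ((A.W ξ)ᵀ *ᵥ Pi.single 0 1) 1 = A.W ξ 0 1 := by simp
  rw [Pi.neg_apply, Pi.smul_apply, h1, (hA.represents hR k).Wb, hA.osc_eq hR k]; rfl

end Coeffs.Admissible
end Problems

/-- The main theorem for an arbitrary number of angles. -/
theorem exists_unique_solutions_and_bounds (H₀ : (Fin m → ℝ) × ℝ → ℝ) {ω : Fin m → ℝ} {τ : ℕ}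
    {c₀ : ℝ} (h : Diophantine ω τ c₀) (hK : (K₀ H₀).det ≠ 0) {ϱ σ : ℝ} (hϱ : 0 < ϱ) (hσ : 0 < σ)
    (d : ℕ) (C : ℝ) :
    ∃ ε₀ > 0, ∃ c > 0, ∀ ε : ℝ, |ε| ≤ ε₀ → ∀ α : ℝ, ∀ k ∈ Set.Icc (0 : ℝ) 1,
      ∀ A : Coeffs m, A.Admissible H₀ ϱ σ d C α ε →
        (∃! X : Unknowns m, Solves₁ A ω k (σ / 4 * ϱ) X) ∧
        (∃! X : Unknowns m, Solves₂ A ω k (σ / 4 * ϱ) X) ∧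
        ∀ X₁ X₂ : Unknowns m,
          Solves₁ A ω k (σ / 4 * ϱ) X₁ → Solves₂ A ω k (σ / 4 * ϱ) X₂ →
          |quadForm A ω k X₁ X₂| ≤ c * |ε| ∧
          |quadForm A ω k X₁ X₁| ≤ c ∧
          c⁻¹ * sobolevNorm (-1) (osc A.w₁) ^ 2 ≤ |quadForm A ω k X₂ X₂| ∧
          |quadForm A ω k X₂ X₂| ≤ c * (anNorm (σ / 2 * ϱ) 0 (osc A.w₁)).toReal ^ 2 ∧
          (anNorm (σ / 2 * ϱ) 0 (osc A.w₁)).toReal ^ 2 ≤ c * |ε| ^ 2 ∧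
          (k = 0 →
            |quadForm A ω k X₁ X₁
                - (2 * Real.pi) ^ m * ((K₀ H₀ *ᵥ mu₀ H₀ A) ⬝ᵥ mu₀ H₀ A)|
              ≤ c * |ε| * eucl (mu₀ H₀ A) ^ 2 ∧
            |quadForm A ω k X₁ X₂| ≤ c * |ε| * eucl (mu₀ H₀ A)) := by
  have hR : 0 < σ / 2 * ϱ := by positivity
  have hr : 0 < σ / 4 * ϱ := by positivity
  have hrR : σ / 4 * ϱ < σ / 2 * ϱ := by gcongr; norm_num
  -- All admissible data `(ε, α, k, A)` form one index set, so the constants obtained depend only on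
  -- the fixed data. The restriction `|ε| ≤ 1` is what `Near` requires.
  set I := {q : ℝ × ℝ × ℝ × Coeffs m // |q.1| ≤ 1 ∧ q.2.2.1 ∈ Set.Icc (0 : ℝ) 1 ∧
    q.2.2.2.Admissible H₀ ϱ σ d C q.2.1 q.1}
  have hI : ∀ i : I, i.1.2.2.2.Admissible H₀ ϱ σ d C i.1.2.1 i.1.1 := fun i => i.2.2.2
  have hL := near_lin (A := fun i : I => i.1.2.2.2) (k := fun i => i.1.2.2.1) hI hR
    (fun i => i.2.1) (fun i => i.2.2.1)
  obtain ⟨ε₁, hε₁, c, hc, hb⟩ := hL.exists_bounds h hK (fun i => (hI i).mn_w hR _)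
    (UO_w_anNorm hI hR)
  obtain ⟨ε₂, hε₂, hU⟩ := exists_isUnit_det hI hR
  set P := (2 * Real.pi) ^ m with hP
  have hP0 : 0 < P := by positivity
  set Ω := 1 + ∑ j, ω j ^ 2 with hΩ
  have hΩ0 : 0 < Ω := by
    have : 0 ≤ ∑ j, ω j ^ 2 := Finset.sum_nonneg fun _ _ => sq_nonneg _
    positivity
  -- In the constant, `P c` accounts for the volume of the torus, `Ω c` for the passage from the
  -- energy to the Sobolev norm, and `C²` for the bound of `w` by `ε`.
  refine ⟨min 1 (min ε₁ ε₂), by positivity, P * c + Ω * c + C ^ 2, by positivity,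
    fun ε hε α k hk A hA => ?_⟩
  obtain ⟨hε1, hε'⟩ := le_min_iff.1 hε
  obtain ⟨hεε₁, hεε₂⟩ := le_min_iff.1 hε'
  obtain ⟨hinj, hbd⟩ := hb ⟨(ε, α, k, A), hε1, hk, hA⟩ hεε₁
  have hdet := hU ⟨(ε, α, k, A), hε1, hk, hA⟩ hεε₂
  simp only at hinj hbd hdet
  have hrep := hA.represents hR k
  have hreg := hA.regular hR k
  have hz : ∀ ξ : Fin m → ℝ, (0 : (Fin m → ℝ) → ℝ) ξ = ev ξ (0 : Rhs m).1 := fun ξ =>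
    (map_zero (ev ξ)).symm
  have hz2 : ∀ (j : Fin 2) (ξ : Fin m → ℝ), (0 : (Fin m → ℝ) → (Fin 2 → ℝ)) ξ j
      = ev ξ (0 : TA m) := fun j ξ => (map_zero (ev ξ)).symm
  have h1 := hA.rhs₂_fst hR (k := k)
  have h2 := hA.rhs₂_snd hR (k := k)
  have h3 := hA.rhs₂_trd hR (k := k)
  refine ⟨hrep.existsUnique_solves h hk.1 hz (hz2 0) (hz2 1) hr hrR hreg (zero_mem _) (zero_mem _)
    (zero_mem _) hinj hdet, hrep.existsUnique_solves h hk.1 h1 h2 h3 hr hrR hreg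
    (Subalgebra.smul_mem _ (mul_mem hreg.w hreg.w) _) (neg_mem (mul_mem hreg.w hreg.Wa))
    (neg_mem (mul_mem hreg.w hreg.Wb)) hinj hdet, fun X₁ X₂ hX₁ hX₂ => ?_⟩
  obtain ⟨y₁, χ₁, hy₁, hr₁, hp₁, -⟩ := hX₁.exists_par h hrep hk.1 (g := 0) hz (hz2 0) (hz2 1) hr
  obtain ⟨y₂, χ₂, hy₂, hr₂, hp₂, -⟩ := hX₂.exists_par h hrep hk.1 h1 h2 h3 hr
  have q12 := quadForm_eq h hrep (hz2 0) (hz2 1) hX₁ hr₁ hp₁ hr₂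
  have q11 := quadForm_eq h hrep (hz2 0) (hz2 1) hX₁ hr₁ hp₁ hr₁
  have q22 := quadForm_eq h hrep h2 h3 hX₂ hr₂ hp₂ hr₂
  obtain ⟨b12, b11, b22, b22', b0⟩ := hbd y₁ y₂ hy₁ hy₂
  have hη := hA.toReal_anNorm_osc_sq_le
  have hsob := (A.lin k).sobolev_le h (hA.mn_w hR k)
  rw [← hA.osc_eq hR k, ← hP, ← hΩ] at hsob
  rw [q12, q11, q22, ← hP]
  have habs : ∀ x : ℝ, |P * x| = P * |x| := fun x => by rw [abs_mul, abs_of_pos hP0]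
  have hCsq := sq_nonneg C
  have hΩc : 0 < Ω * c := by positivity
  have hPc : 0 < P * c := by positivity
  have hcP : P * c ≤ P * c + Ω * c + C ^ 2 := by linarith
  refine ⟨?_, ?_, ?_, ?_, ?_, fun hk0 => ?_⟩
  · rw [habs]
    calc _ ≤ P * (c * |ε|) := mul_le_mul_of_nonneg_left b12 hP0.le
      _ = P * c * |ε| := by ring
      _ ≤ _ := mul_le_mul_of_nonneg_right hcP (abs_nonneg ε)
  · rw [habs]
    exact (mul_le_mul_of_nonneg_left b11 hP0.le).trans hcP
  · rw [habs]
    calc _ ≤ (Ω * c)⁻¹ * (Ω * P * (A.lin k).en h ^ 2) := by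
          gcongr
          linarith
      _ = P * (c⁻¹ * (A.lin k).en h ^ 2) := by field_simp
      _ ≤ _ := mul_le_mul_of_nonneg_left b22 hP0.le
  · rw [habs]
    refine (mul_le_mul_of_nonneg_left b22' hP0.le).trans ?_
    rw [← mul_assoc]
    exact mul_le_mul_of_nonneg_right hcP (sq_nonneg _)
  · refine hη.trans (mul_le_mul_of_nonneg_right ?_ (sq_nonneg _))
    linarith
  · obtain ⟨b1, b2⟩ := b0 (mu₀ H₀ A) hk0 (hA.mn_Ta hR k hK)
    have he := eucl_nonneg (mu₀ H₀ A)
    have hε0 := abs_nonneg ε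
    constructor
    · rw [← mul_sub, habs]
      calc _ ≤ P * (c * |ε| * eucl (mu₀ H₀ A) ^ 2) := mul_le_mul_of_nonneg_left b1 hP0.le
        _ = P * c * |ε| * eucl (mu₀ H₀ A) ^ 2 := by ring
        _ ≤ _ := by gcongr
    · rw [habs]
      calc _ ≤ P * (c * |ε| * eucl (mu₀ H₀ A)) := mul_le_mul_of_nonneg_left b2 hP0.le
        _ = P * c * |ε| * eucl (mu₀ H₀ A) := by ring
        _ ≤ _ := by gcongr

end LowerTori

end

theorem mainTheorem4 (n : ℕ) (hn : 2 ≤ n)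
    (H₀ : (Fin (n - 1) → ℝ) × ℝ → ℝ) (hH₀ : AnalyticAt ℝ H₀ 0)
    (ω : Fin (n - 1) → ℝ) (hω : ∀ i, fderiv ℝ H₀ 0 (yDir i) = ω i)
    (hz : fderiv ℝ H₀ 0 zDir = 0)
    (c₀ : ℝ) (hdio : Diophantine ω n c₀)
    (hK : (K₀ H₀).det ≠ 0)
    (ϱ : ℝ) (hϱ : 0 < ϱ) (σ : ℝ) (hσ : σ ∈ Set.Ioc (1 / 2 : ℝ) 1) (d : ℕ) (hd : 2 ≤ d) (C : ℝ) :
    ∃ ε₀ > 0, ∃ c > 0, ∀ ε : ℝ, |ε| ≤ ε₀ → ∀ α : ℝ, ∀ k ∈ Set.Icc (0 : ℝ) 1,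
      ∀ A : Coeffs (n - 1), A.Admissible H₀ ϱ σ d C α ε →
        (∃! X : Unknowns (n - 1), Solves₁ A ω k (σ / 4 * ϱ) X) ∧
        (∃! X : Unknowns (n - 1), Solves₂ A ω k (σ / 4 * ϱ) X) ∧
        ∀ X₁ X₂ : Unknowns (n - 1),
          Solves₁ A ω k (σ / 4 * ϱ) X₁ → Solves₂ A ω k (σ / 4 * ϱ) X₂ →
          |quadForm A ω k X₁ X₂| ≤ c * |ε| ∧
          |quadForm A ω k X₁ X₁| ≤ c ∧
          c⁻¹ * sobolevNorm (-1) (osc A.w₁) ^ 2 ≤ |quadForm A ω k X₂ X₂| ∧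
          |quadForm A ω k X₂ X₂| ≤ c * (anNorm (σ / 2 * ϱ) 0 (osc A.w₁)).toReal ^ 2 ∧
          (anNorm (σ / 2 * ϱ) 0 (osc A.w₁)).toReal ^ 2 ≤ c * |ε| ^ 2 ∧
          (k = 0 →
            |quadForm A ω k X₁ X₁
                - (2 * Real.pi) ^ (n - 1) * ((K₀ H₀ *ᵥ mu₀ H₀ A) ⬝ᵥ mu₀ H₀ A)|
              ≤ c * |ε| * eucl (mu₀ H₀ A) ^ 2 ∧
            |quadForm A ω k X₁ X₂| ≤ c * |ε| * eucl (mu₀ H₀ A)) :=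
  exists_unique_solutions_and_bounds H₀ hdio hK hϱ (by have := hσ.1; linarith) d C
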